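/- Let $\varphi(x)=e^{-x^2}$ on $\mathbb R$. For a tempered distribution $u\in\mathcal S'(\mathbb R)$ put $V_\varphi u(t,\nu)=\langle u,\ e^{-2\pi i\nu\,\cdot}\varphi(\cdot-t)\rangle$ (so $V_\varphi u(t,\nu)=\int u(x)e^{-2\pi i x\nu}\varphi(x-t)\,dx$ if $u$ is a function), and for $1\le p,q\le\infty$ let $$\|u\|_{M^{p,q}}=\Big(\int\Big(\int|V_\varphi u(t,\nu)|^p\,dt\Big)^{q/p}d\nu\Big)^{1/q}$$ with the usual modification if $p=\infty$ or $q=\infty$; the modulation space $M^{p,q}=M^{p,q}(\mathbb R)$ consists of all $u\in\mathcal S'(\mathbb R)$ with $\|u\|_{M^{p,q}}<\infty$. For $f,g,h\in\mathcal S(\mathbb R)$ let $$\mathrm{TH}(f,g,h)(x)=\lim_{\epsilon\to0^+}\int_{|t|>\epsilon}f(x-t)\,g(x+t)\,h(x+2t)\,\frac{dt}{t}$$ be the trilinear Hilbert transform; the limit exists for every $x\in\mathbb R$, and $\mathrm{TH}(f,g,h)$ defines a tempered distribution by integration against Schwartz functions. **Theorem 4.6.** Let $p,p_0,p_1\in(1,\infty)$,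 $1\le q\le\infty$, and let $p',q'$ be the conjugate exponents of $p,q$. Then $\mathrm{TH}$, initially defined on $\mathcal S(\mathbb R)^3$, extends to a bounded trilinear operator from $M^{p_1,1}\times M^{p,q}\times M^{p',q'}$ into $M^{p_0,\infty}$: there are a constant $C>0$, depending only on $p,p_0,p_1,q$, and a trilinear extension $T$ of $\mathrm{TH}$ with $$\|T(f,g,h)\|_{M^{p_0,\infty}}\le C\,\|f\|_{M^{p_1,1}}\,\|g\|_{M^{p,q}}\,\|h\|_{M^{p',q'}}$$ for all $f\in M^{p_1,1}$, $g\in M^{p,q}$, $h\in M^{p',q'}$; in particular this estimate holds for $\mathrm{TH}(f,g,h)$ with $f,g,h\in\mathcal S(\mathbb R)$. In particular, for all $1\le r<\infty$ and $\epsilon>0$, $\mathrm{TH}$ extends to a bounded trilinear operator from $M^{r,1}\times L^2(\mathbb R)\times L^2(\mathbb R)$ into $M^{1+\epsilon,\infty}$, with a bound $C\|f\|_{M^{r,1}}\|g\|_{L^2}\|h\|_{L^2}$ where $C$ depends only on $r$ and $\epsilon$. -/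

import Mathlib

open MeasureTheory Filter Topology
open scoped SchwartzMap ENNReal NNReal

noncomputable section

namespace ModulationSpaces

/-- The Gaussian window `e^{-x^2}`, translated by `t` and multiplied by the character
`x ↦ e^{-2πiνx}`, as a function on the real line. -/
def gaussAtomFun (t ν : ℝ) (x : ℝ) : ℂ :=
  Complex.exp (-(2 * Real.pi * ν * x * Complex.I)) * Complex.exp (-((x - t : ℝ) : ℂ) ^ 2)

theorem norm_gaussAtomFun (t ν x : ℝ) :
    ‖gaussAtomFun t ν x‖ = Real.exp (-(x - t) ^ 2) := by
  have h1 : (-(2 * Real.pi * ν * x * Complex.I) : ℂ) =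
      ((-(2 * Real.pi * ν * x) : ℝ) : ℂ) * Complex.I := by
    push_cast; ring
  have h2 : (-((x - t : ℝ) : ℂ) ^ 2) = ((-(x - t) ^ 2 : ℝ) : ℂ) := by
    push_cast; ring
  rw [gaussAtomFun, norm_mul, h1, h2, Complex.norm_exp_ofReal_mul_I, one_mul,
    Complex.norm_exp_ofReal]

section Smoothness

open scoped ContDiff

theorem contDiff_gaussAtomFun (t ν : ℝ) : ContDiff ℝ ∞ (gaussAtomFun t ν) := by
  have h0 : ContDiff ℝ ∞ (fun x : ℝ => (x : ℂ)) := Complex.ofRealCLM.contDiff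
  have h1 : ContDiff ℝ ∞ (fun x : ℝ => ((x - t : ℝ) : ℂ)) :=
    Complex.ofRealCLM.contDiff.comp (contDiff_id.sub contDiff_const)
  unfold gaussAtomFun
  exact (((contDiff_const.mul h0).mul contDiff_const).neg.cexp).mul (h1.pow 2).neg.cexp

end Smoothness

theorem hasDerivAt_gaussAtomFun (t ν x : ℝ) :
    HasDerivAt (gaussAtomFun t ν)
      ((-(2 * Real.pi * ν * Complex.I) - 2 * ((x : ℂ) - t)) * gaussAtomFun t ν x) x := by
  have h0 : HasDerivAt (fun x : ℝ => (x : ℂ)) 1 x := Complex.ofRealCLM.hasDerivAt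
  have h1 : HasDerivAt (fun x : ℝ => ((x - t : ℝ) : ℂ)) 1 x := by
    simp only [Complex.ofReal_sub]
    exact h0.sub_const (t : ℂ)
  have h2 := ((((h0.const_mul (2 * Real.pi * ν : ℂ)).mul_const Complex.I).fun_neg).cexp).mul
    ((h1.fun_pow 2).fun_neg.cexp)
  refine h2.congr_deriv ?_
  simp only [gaussAtomFun]
  push_cast
  ring

theorem iteratedDeriv_gaussAtomFun (t ν : ℝ) (n : ℕ) : ∃ P : Polynomial ℂ,
    iteratedDeriv n (gaussAtomFun t ν) = fun x : ℝ => P.eval (x : ℂ) * gaussAtomFun t ν x := by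
  induction n with
  | zero => exact ⟨1, by simp⟩
  | succ n ih =>
    obtain ⟨P, hP⟩ := ih
    refine ⟨P.derivative + P * (Polynomial.C (-(2 * Real.pi * ν * Complex.I) + 2 * t)
      - 2 * Polynomial.X), ?_⟩
    rw [iteratedDeriv_succ, hP]
    funext x
    have h0 : HasDerivAt (fun x : ℝ => P.eval (x : ℂ)) (P.derivative.eval (x : ℂ)) x :=
      (P.hasDerivAt (x : ℂ)).comp_ofReal
    rw [(h0.fun_mul (hasDerivAt_gaussAtomFun t ν x)).deriv]
    simp
    ring

theorem exp_neg_sq_le (t x : ℝ) :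
    Real.exp (-(x - t) ^ 2) ≤ Real.exp (1 + |t|) * Real.exp (-|x|) := by
  rw [← Real.exp_add]
  apply Real.exp_le_exp.mpr
  have h1 : |x| ≤ |x - t| + |t| := by simpa using abs_add_le (x - t) t
  have h2 : (x - t) ^ 2 = |x - t| ^ 2 := (sq_abs _).symm
  nlinarith [sq_nonneg (|x - t| - 1), abs_nonneg (x - t)]

theorem pow_mul_exp_neg_abs_le (k : ℕ) (x : ℝ) :
    |x| ^ k * Real.exp (-|x|) ≤ k.factorial := by
  have h := Real.pow_div_factorial_le_exp |x| (abs_nonneg x) k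
  rw [div_le_iff₀ (by positivity)] at h
  rw [Real.exp_neg, ← div_eq_mul_inv, div_le_iff₀ (Real.exp_pos _)]
  linarith

theorem decay_gaussAtomFun (t ν : ℝ) (k : ℕ) (P : Polynomial ℂ) :
    ∃ C : ℝ, ∀ x : ℝ, |x| ^ k * ‖P.eval (x : ℂ) * gaussAtomFun t ν x‖ ≤ C := by
  induction P using Polynomial.induction_on' with
  | add P Q hP hQ =>
    obtain ⟨C, hC⟩ := hP
    obtain ⟨D, hD⟩ := hQ
    refine ⟨C + D, fun x => ?_⟩
    calc |x| ^ k * ‖(P + Q).eval (x : ℂ) * gaussAtomFun t ν x‖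
        ≤ |x| ^ k * (‖P.eval (x : ℂ) * gaussAtomFun t ν x‖
            + ‖Q.eval (x : ℂ) * gaussAtomFun t ν x‖) := by
          gcongr
          rw [Polynomial.eval_add, add_mul]
          exact norm_add_le _ _
      _ ≤ C + D := by rw [mul_add]; exact add_le_add (hC x) (hD x)
  | monomial n a =>
    refine ⟨‖a‖ * Real.exp (1 + |t|) * (k + n).factorial, fun x => ?_⟩
    have h1 := exp_neg_sq_le t x
    have h2 := pow_mul_exp_neg_abs_le (k + n) x
    rw [norm_mul, norm_gaussAtomFun, Polynomial.eval_monomial, norm_mul, norm_pow,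
      Complex.norm_real, Real.norm_eq_abs]
    calc |x| ^ k * (‖a‖ * |x| ^ n * Real.exp (-(x - t) ^ 2))
        ≤ |x| ^ k * (‖a‖ * |x| ^ n * (Real.exp (1 + |t|) * Real.exp (-|x|))) := by gcongr
      _ = ‖a‖ * Real.exp (1 + |t|) * (|x| ^ (k + n) * Real.exp (-|x|)) := by ring
      _ ≤ _ := by gcongr

/-- The time-frequency shifted Gaussian `x ↦ e^{-2πiνx} e^{-(x-t)^2}` as a Schwartz function. -/
def gaussAtom (t ν : ℝ) : 𝓢(ℝ, ℂ) where
  toFun := gaussAtomFun t ν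
  smooth' := contDiff_gaussAtomFun t ν
  decay' k n := by
    obtain ⟨P, hP⟩ := iteratedDeriv_gaussAtomFun t ν n
    obtain ⟨C, hC⟩ := decay_gaussAtomFun t ν k P
    refine ⟨C, fun x => ?_⟩
    rw [norm_iteratedFDeriv_eq_norm_iteratedDeriv, hP]
    exact hC x

/-- The short-time Fourier transform of a tempered distribution with the Gaussian window
`φ(x) = e^{-x^2}`; for a function, `V_φ f (t, ν) = ∫ f(x) e^{-2πixν} φ(x - t) dx`. -/
def stft (u : 𝓢'(ℝ, ℂ)) (t ν : ℝ) : ℂ := u (gaussAtom t ν)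

/-- The modulation space norm `(∫ (∫ |V_φ u (t, ν)|^p dt)^{q/p} dν)^{1/q}`, with the essential
supremum in place of the integral for an infinite exponent. -/
def modNorm (p q : ℝ≥0∞) (u : 𝓢'(ℝ, ℂ)) : ℝ≥0∞ :=
  eLpNorm (fun ν : ℝ => eLpNorm (fun t : ℝ => stft u t ν) p volume) q volume

/-- The modulation space `M^{p,q}(ℝ)`. -/
def modSpace (p q : ℝ≥0∞) : Set 𝓢'(ℝ, ℂ) := {u | modNorm p q u < ∞}

/-- The truncated integral `∫_{|t| > ε} f(x - t) g(x + t) h(x + 2t) dt / t`. -/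
def truncatedTH (f g h : ℝ → ℂ) (x ε : ℝ) : ℂ :=
  ∫ t in {t : ℝ | ε < |t|}, f (x - t) * g (x + t) * h (x + 2 * t) / (t : ℂ)

/-- The trilinear Hilbert transform, defined by a principal value. -/
def trilinearHilbert (f g h : ℝ → ℂ) (x : ℝ) : ℂ :=
  limUnder (𝓝[>] (0 : ℝ)) (truncatedTH f g h x)

/-- The principal value defining `TH(f, g, h)(x)` exists for every `x`, and the tempered
distribution `u` is the function `TH(f, g, h)`. -/
def IsTrilinearHilbert (f g h : 𝓢(ℝ, ℂ)) (u : 𝓢'(ℝ, ℂ)) : Prop :=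
  (∀ x : ℝ, Tendsto (truncatedTH f g h x) (𝓝[>] (0 : ℝ)) (𝓝 (trilinearHilbert f g h x))) ∧
  ∀ φ : 𝓢(ℝ, ℂ), Integrable (fun x : ℝ => φ x * trilinearHilbert f g h x) ∧
    u φ = ∫ x : ℝ, φ x * trilinearHilbert f g h x

/-- `T` is trilinear as a map on `M₁ × M₂ × M₃`, where each `Mᵢ` is a linear subspace of `Eᵢ`. -/
structure IsTrilinearOn {E₁ E₂ E₃ F : Type*} [AddCommGroup E₁] [Module ℂ E₁]
    [AddCommGroup E₂] [Module ℂ E₂] [AddCommGroup E₃] [Module ℂ E₃] [AddCommGroup F] [Module ℂ F]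
    (M₁ : Set E₁) (M₂ : Set E₂) (M₃ : Set E₃) (T : E₁ → E₂ → E₃ → F) : Prop where
  map_left : ∀ (a b : ℂ), ∀ u ∈ M₁, ∀ u' ∈ M₁, ∀ v ∈ M₂, ∀ w ∈ M₃,
    T (a • u + b • u') v w = a • T u v w + b • T u' v w
  map_middle : ∀ (a b : ℂ), ∀ u ∈ M₁, ∀ v ∈ M₂, ∀ v' ∈ M₂, ∀ w ∈ M₃,
    T u (a • v + b • v') w = a • T u v w + b • T u v' w
  map_right : ∀ (a b : ℂ), ∀ u ∈ M₁, ∀ v ∈ M₂, ∀ w ∈ M₃, ∀ w' ∈ M₃,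
    T u v (a • w + b • w') = a • T u v w + b • T u v w'

end ModulationSpaces

end

noncomputable section

namespace ModulationSpaces

/-- The entire function `β ↦ p.v. ∫ e^{-5t²+βt} dt/t`, in an absolutely convergent form. -/
def gaussPV (β : ℂ) : ℂ :=
  (Real.pi / 5 : ℂ) ^ (1 / 2 : ℂ) * ∫ σ in (0 : ℝ)..1, β * Complex.exp (β ^ 2 * σ ^ 2 / 20)

theorem continuous_gaussPV : Continuous gaussPV := by
  unfold gaussPV
  refine continuous_const.mul ?_
  apply intervalIntegral.continuous_parametric_intervalIntegral_of_continuous'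
  fun_prop

theorem integral_sq_mul_exp_le (b : ℝ) :
    ∫ σ in (0 : ℝ)..1, b * Real.exp (-(b * (1 - σ))) ≤ 1 := by
  have h : ∀ σ ∈ Set.uIcc (0 : ℝ) 1,
      HasDerivAt (fun σ => Real.exp (-(b * (1 - σ)))) (b * Real.exp (-(b * (1 - σ)))) σ := by
    intro σ _
    have h1 : HasDerivAt (fun σ : ℝ => -(b * (1 - σ))) b σ := by
      have := (((hasDerivAt_id σ).const_sub 1).const_mul b).fun_neg
      simpa using this
    simpa [mul_comm] using h1.exp
  rw [intervalIntegral.integral_eq_sub_of_hasDerivAt h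
    (Continuous.intervalIntegrable (by fun_prop) _ _)]
  have := Real.exp_pos (-(b * (1 - 0)))
  simp
  simpa using this.le

theorem integral_abs_mul_gaussian_le (θ : ℝ) :
    ∫ σ in (0 : ℝ)..1, |θ| * Real.exp (-(θ ^ 2 * σ ^ 2 / 20)) ≤ Real.sqrt (20 * Real.pi) := by
  rcases eq_or_ne θ 0 with rfl | hθ
  · simp
  have hb : 0 < θ ^ 2 / 20 := by positivity
  rw [intervalIntegral.integral_const_mul, intervalIntegral.integral_of_le zero_le_one]
  have h1 : ∫ σ in Set.Ioc (0 : ℝ) 1, Real.exp (-(θ ^ 2 * σ ^ 2 / 20)) ≤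
      ∫ σ : ℝ, Real.exp (-(θ ^ 2 / 20) * σ ^ 2) := by
    have : ∀ σ : ℝ, Real.exp (-(θ ^ 2 * σ ^ 2 / 20)) = Real.exp (-(θ ^ 2 / 20) * σ ^ 2) := by
      intro σ; congr 1; ring
    simp_rw [this]
    apply setIntegral_le_integral (integrable_exp_neg_mul_sq hb)
    exact Eventually.of_forall fun _ => (Real.exp_pos _).le
  rw [integral_gaussian] at h1
  calc |θ| * _ ≤ |θ| * √(Real.pi / (θ ^ 2 / 20)) := by gcongr
    _ = √(θ ^ 2) * √(Real.pi / (θ ^ 2 / 20)) := by rw [Real.sqrt_sq_eq_abs]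
    _ = _ := by
      rw [← Real.sqrt_mul (by positivity)]; congr 1; field_simp

theorem one_add_mul_exp_bound (L θ σ : ℝ) (h0 : 0 ≤ σ) (h1 : σ ≤ 1) :
    (1 + |L|) * ((|L| + |θ|) * Real.exp ((L ^ 2 - θ ^ 2) * σ ^ 2 / 20)) ≤
      Real.exp (L ^ 2 / 20) * (41 + 440 * (L ^ 2 / 20 * Real.exp (-(L ^ 2 / 20 * (1 - σ))))
        + 11 * (|θ| * Real.exp (-(θ ^ 2 * σ ^ 2 / 20)))) := by
  have e1 : Real.exp ((L ^ 2 - θ ^ 2) * σ ^ 2 / 20) ≤ Real.exp (L ^ 2 / 20) *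
      (Real.exp (-(L ^ 2 / 20 * (1 - σ))) * Real.exp (-(θ ^ 2 * σ ^ 2 / 20))) := by
    rw [← Real.exp_add, ← Real.exp_add]
    apply Real.exp_le_exp.mpr
    have : L ^ 2 * σ ^ 2 ≤ L ^ 2 * σ := by
      apply mul_le_mul_of_nonneg_left _ (sq_nonneg L); nlinarith
    nlinarith
  set X := Real.exp (-(L ^ 2 / 20 * (1 - σ))) with hX
  set Y := Real.exp (-(θ ^ 2 * σ ^ 2 / 20)) with hY
  have hX0 : 0 < X := Real.exp_pos _
  have hY0 : 0 < Y := Real.exp_pos _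
  have hX1 : X ≤ 1 := Real.exp_le_one_iff.mpr (by
    have : 0 ≤ L ^ 2 / 20 * (1 - σ) := mul_nonneg (by positivity) (by linarith)
    linarith)
  have hY1 : Y ≤ 1 := Real.exp_le_one_iff.mpr (by
    have : 0 ≤ θ ^ 2 * σ ^ 2 / 20 := by positivity
    linarith)
  have hL := abs_nonneg L
  have hθ := abs_nonneg θ
  have hL2 : L ^ 2 = |L| ^ 2 := (sq_abs L).symm
  have hθ2 : θ ^ 2 = |θ| ^ 2 := (sq_abs θ).symm
  have t1 : (1 + |L|) * |L| * (X * Y) ≤ 1 + 40 * (L ^ 2 / 20 * X) := by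
    have : (1 + |L|) * |L| ≤ 1 + 2 * L ^ 2 := by rw [hL2]; nlinarith [sq_nonneg (|L| - 1)]
    calc (1 + |L|) * |L| * (X * Y) ≤ (1 + 2 * L ^ 2) * (X * 1) := by gcongr
      _ = X + 40 * (L ^ 2 / 20 * X) := by ring
      _ ≤ _ := by gcongr
  have t2 : (1 + |L|) * |θ| * (X * Y) ≤ 40 + 400 * (L ^ 2 / 20 * X) + 11 * (|θ| * Y) := by
    rcases le_total σ (1 / 2) with hσ | hσ
    · have hx : (1 + |L|) * X ≤ 11 := by
        have hle : X ≤ Real.exp (-(L ^ 2 / 40)) := by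
          apply Real.exp_le_exp.mpr; nlinarith [sq_nonneg L]
        have : 1 + |L| ≤ 11 * Real.exp (L ^ 2 / 40) := by
          have := Real.add_one_le_exp (L ^ 2 / 40)
          rw [hL2] at this ⊢
          nlinarith [sq_nonneg (|L| - 2)]
        calc (1 + |L|) * X ≤ (11 * Real.exp (L ^ 2 / 40)) * Real.exp (-(L ^ 2 / 40)) := by gcongr
          _ = 11 := by rw [mul_assoc, ← Real.exp_add]; simp
      have : 0 ≤ L ^ 2 / 20 * X := by positivity
      calc (1 + |L|) * |θ| * (X * Y) = ((1 + |L|) * X) * (|θ| * Y) := by ring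
        _ ≤ 11 * (|θ| * Y) := by gcongr
        _ ≤ _ := by linarith
    · have hy : |θ| * Y ≤ 20 := by
        have hle : Y ≤ Real.exp (-(θ ^ 2 / 80)) := by
          apply Real.exp_le_exp.mpr
          have : 1 / 4 ≤ σ ^ 2 := by nlinarith
          nlinarith [sq_nonneg θ]
        have : |θ| ≤ 20 * Real.exp (θ ^ 2 / 80) := by
          have := Real.add_one_le_exp (θ ^ 2 / 80)
          rw [hθ2] at this ⊢
          nlinarith [sq_nonneg (|θ| - 2)]
        calc |θ| * Y ≤ (20 * Real.exp (θ ^ 2 / 80)) * Real.exp (-(θ ^ 2 / 80)) := by gcongr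
          _ = 20 := by rw [mul_assoc, ← Real.exp_add]; simp
      have : 1 + |L| ≤ 2 + L ^ 2 := by rw [hL2]; nlinarith [sq_nonneg (|L| - 1)]
      calc (1 + |L|) * |θ| * (X * Y) = ((1 + |L|) * X) * (|θ| * Y) := by ring
        _ ≤ ((2 + L ^ 2) * X) * 20 := by gcongr
        _ = 40 * X + 400 * (L ^ 2 / 20 * X) := by ring
        _ ≤ 40 * 1 + 400 * (L ^ 2 / 20 * X) + 11 * (|θ| * Y) := by
          have : 0 ≤ 11 * (|θ| * Y) := by positivity
          linarith
        _ = _ := by ring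
  calc (1 + |L|) * ((|L| + |θ|) * Real.exp ((L ^ 2 - θ ^ 2) * σ ^ 2 / 20))
      ≤ (1 + |L|) * ((|L| + |θ|) * (Real.exp (L ^ 2 / 20) * (X * Y))) := by gcongr
    _ = Real.exp (L ^ 2 / 20) *
        ((1 + |L|) * |L| * (X * Y) + (1 + |L|) * |θ| * (X * Y)) := by ring
    _ ≤ Real.exp (L ^ 2 / 20) * ((1 + 40 * (L ^ 2 / 20 * X)) +
        (40 + 400 * (L ^ 2 / 20 * X) + 11 * (|θ| * Y))) := by gcongr
    _ = _ := by ring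

theorem norm_gaussPV_le : ∃ C : ℝ, 0 < C ∧ ∀ β : ℂ,
    ‖gaussPV β‖ ≤ C * (Real.exp (β.re ^ 2 / 20) / (1 + |β.re|)) := by
  set A := ‖(Real.pi / 5 : ℂ) ^ (1 / 2 : ℂ)‖
  refine ⟨(A + 1) * (481 + 11 * Real.sqrt (20 * Real.pi)), by positivity, fun β => ?_⟩
  have hL : 0 < 1 + |β.re| := by positivity
  rw [mul_div_assoc', le_div_iff₀ hL, gaussPV, norm_mul]
  have key : ‖∫ σ in (0 : ℝ)..1, β * Complex.exp (β ^ 2 * σ ^ 2 / 20)‖ * (1 + |β.re|) ≤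
      (481 + 11 * Real.sqrt (20 * Real.pi)) * Real.exp (β.re ^ 2 / 20) := by
    have h1 : ‖∫ σ in (0 : ℝ)..1, β * Complex.exp (β ^ 2 * σ ^ 2 / 20)‖ ≤
        ∫ σ in (0 : ℝ)..1, ‖β * Complex.exp (β ^ 2 * σ ^ 2 / 20)‖ :=
      intervalIntegral.norm_integral_le_integral_norm zero_le_one
    calc _ ≤ (∫ σ in (0 : ℝ)..1, ‖β * Complex.exp (β ^ 2 * σ ^ 2 / 20)‖) * (1 + |β.re|) := by
          gcongr
      _ = ∫ σ in (0 : ℝ)..1, ‖β * Complex.exp (β ^ 2 * σ ^ 2 / 20)‖ * (1 + |β.re|) := by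
          rw [intervalIntegral.integral_mul_const]
      _ ≤ ∫ σ in (0 : ℝ)..1, Real.exp (β.re ^ 2 / 20) *
          (41 + 440 * (β.re ^ 2 / 20 * Real.exp (-(β.re ^ 2 / 20 * (1 - σ))))
          + 11 * (|β.im| * Real.exp (-(β.im ^ 2 * σ ^ 2 / 20)))) := by
          apply intervalIntegral.integral_mono_on zero_le_one
          · exact Continuous.intervalIntegrable (by fun_prop) _ _
          · exact Continuous.intervalIntegrable (by fun_prop) _ _
          · intro σ hσ
            refine le_trans ?_ (one_add_mul_exp_bound β.re β.im σ hσ.1 hσ.2)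
            rw [norm_mul, Complex.norm_exp, mul_comm]
            have : (β ^ 2 * σ ^ 2 / 20 : ℂ).re = (β.re ^ 2 - β.im ^ 2) * σ ^ 2 / 20 := by
              have : (β ^ 2 * σ ^ 2 / 20 : ℂ) = ((σ ^ 2 / 20 : ℝ) : ℂ) * (β * β) := by
                push_cast; ring
              rw [this, Complex.re_ofReal_mul, Complex.mul_re]; ring
            rw [this]
            gcongr
            exact Complex.norm_le_abs_re_add_abs_im β
      _ ≤ _ := by
          rw [intervalIntegral.integral_const_mul, mul_comm]
          gcongr
          rw [intervalIntegral.integral_add, intervalIntegral.integral_add,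
            intervalIntegral.integral_const_mul, intervalIntegral.integral_const_mul]
          · have h2 := integral_sq_mul_exp_le (β.re ^ 2 / 20)
            have h3 := integral_abs_mul_gaussian_le β.im
            simp only [intervalIntegral.integral_const]
            simp only [intervalIntegral.integral_const_mul, sub_zero, one_smul] at h2 h3 ⊢
            linarith
          all_goals exact Continuous.intervalIntegrable (by fun_prop) _ _
  calc A * _ * (1 + |β.re|) = A * (‖∫ σ in (0 : ℝ)..1, β * Complex.exp (β ^ 2 * σ ^ 2 / 20)‖ *
        (1 + |β.re|)) := by ring
    _ ≤ (A + 1) * ((481 + 11 * Real.sqrt (20 * Real.pi)) * Real.exp (β.re ^ 2 / 20)) := by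
        gcongr; linarith
    _ = _ := by ring

theorem integral_gaussian_odd (β : ℂ) :
    ∫ t in Set.Ioi (0 : ℝ), Complex.exp (-5 * (t : ℂ) ^ 2) *
      ((Complex.exp (β * t) - Complex.exp (-(β * t))) / t) = gaussPV β := by
  have h1 : ∀ t : ℝ, 0 < t → Complex.exp (-5 * (t : ℂ) ^ 2) *
      ((Complex.exp (β * t) - Complex.exp (-(β * t))) / t) =
      ∫ σ in (0 : ℝ)..1, Complex.exp (-5 * (t : ℂ) ^ 2) * (β * (Complex.exp (β * σ * t) +
        Complex.exp (-(β * σ * t)))) := by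
    intro t ht
    have ht' : (t : ℂ) ≠ 0 := by exact_mod_cast ht.ne'
    rw [intervalIntegral.integral_const_mul]
    congr 1
    have hd : ∀ σ ∈ Set.uIcc (0 : ℝ) 1, HasDerivAt
        (fun σ : ℝ => (Complex.exp (β * σ * t) - Complex.exp (-(β * σ * t))) / t)
        (β * (Complex.exp (β * σ * t) + Complex.exp (-(β * σ * t)))) σ := by
      intro σ _
      have h0 : HasDerivAt (fun σ : ℝ => β * σ * t) (β * t) σ := by
        have := ((Complex.ofRealCLM.hasDerivAt (x := σ)).const_mul β).mul_const (t : ℂ)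
        simpa using this
      refine ((h0.cexp.fun_sub h0.fun_neg.cexp).div_const (t : ℂ)).congr_deriv ?_
      field_simp
      ring
    rw [intervalIntegral.integral_eq_sub_of_hasDerivAt hd
      (Continuous.intervalIntegrable (by fun_prop) _ _)]
    simp
  rw [setIntegral_congr_fun measurableSet_Ioi fun t ht => h1 t ht,
    ← intervalIntegral_integral_swap, gaussPV, ← intervalIntegral.integral_const_mul]
  · apply intervalIntegral.integral_congr
    intro σ _
    have hint : Integrable (fun t : ℝ => Complex.exp (-5 * (t : ℂ) ^ 2 + β * σ * t + 0)) := by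
      exact integrable_cexp_quadratic (by norm_num) (β * σ) 0
    have h2 := integral_cexp_quadratic (b := -5) (by norm_num) (β * σ) 0
    have h3 : ∫ t : ℝ, Complex.exp (-5 * (t : ℂ) ^ 2 + β * σ * t + 0) =
        ∫ t in Set.Ioi (0 : ℝ), (Complex.exp (-5 * (t : ℂ) ^ 2 + β * σ * t + 0) +
          Complex.exp (-5 * ((-t : ℝ) : ℂ) ^ 2 + β * σ * (-t : ℝ) + 0)) := by
      rw [integral_add hint.integrableOn hint.comp_neg.integrableOn,
        integral_comp_neg_Ioi (f := fun t : ℝ => Complex.exp (-5 * (t : ℂ) ^ 2 + β * σ * t + 0)),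
        neg_zero, add_comm]
      rw [← integral_add_compl (measurableSet_Iic (a := (0:ℝ))) hint, Set.compl_Iic]
    have h4 : ∀ t : ℝ, Complex.exp (-5 * (t : ℂ) ^ 2) * (β * (Complex.exp (β * σ * t) +
        Complex.exp (-(β * σ * t)))) = β * (Complex.exp (-5 * (t : ℂ) ^ 2 + β * σ * t + 0) +
          Complex.exp (-5 * ((-t : ℝ) : ℂ) ^ 2 + β * σ * (-t : ℝ) + 0)) := by
      intro t
      rw [Complex.exp_add, Complex.exp_add, Complex.exp_add, Complex.exp_add]
      push_cast
      simp only [neg_sq, mul_neg, Complex.exp_zero]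
      ring
    simp only [h4]
    rw [integral_const_mul, ← h3, h2]
    have : (0 - (β * σ) ^ 2 / (4 * -5) : ℂ) = β ^ 2 * σ ^ 2 / 20 := by ring
    rw [this]
    simp only [neg_neg]
    ring
  · rw [Set.uIoc_of_le zero_le_one]
    have hmaj : Integrable (fun t : ℝ => ‖β‖ * 2 * Real.exp (-5 * t ^ 2 + ‖β‖ * t))
        (volume.restrict (Set.Ioi 0)) := by
      have := (integrable_cexp_quadratic (b := 5) (by norm_num) (‖β‖ : ℂ) 0).norm
      refine Integrable.integrableOn (Integrable.const_mul (this.congr ?_) _)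
      refine Eventually.of_forall fun t => ?_
      simp only [Complex.norm_exp]
      congr 1
      have : (-5 * (t : ℂ) ^ 2 + (‖β‖ : ℂ) * t + 0) = ((-5 * t ^ 2 + ‖β‖ * t : ℝ) : ℂ) := by
        push_cast; ring
      rw [this, Complex.ofReal_re]
    refine Integrable.mono' (hmaj.comp_snd (volume.restrict (Set.Ioc (0 : ℝ) 1))) ?_ ?_
    · apply Continuous.aestronglyMeasurable
      simp only [Function.uncurry_def]
      fun_prop
    · rw [Measure.prod_restrict]
      refine (ae_restrict_iff' (measurableSet_Ioc.prod measurableSet_Ioi)).mpr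
        (Eventually.of_forall ?_)
      rintro ⟨σ, t⟩ ⟨hσ, ht⟩
      simp only [Set.mem_Ioc, Set.mem_Ioi] at hσ ht
      simp only [Function.uncurry]
      have hn : ∀ s : ℂ, ‖s‖ ≤ ‖β‖ * t → ‖Complex.exp s‖ ≤ Real.exp (‖β‖ * t) := fun s hs =>
        (Complex.norm_exp_le_exp_norm s).trans (Real.exp_le_exp.mpr hs)
      have hs : ‖β * σ * t‖ ≤ ‖β‖ * t := by
        rw [norm_mul, norm_mul, Complex.norm_real, Complex.norm_real, Real.norm_of_nonneg ht.le,
          Real.norm_of_nonneg hσ.1.le]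
        have := mul_le_mul_of_nonneg_left hσ.2 (norm_nonneg β)
        nlinarith
      have he : ‖Complex.exp (-5 * (t : ℂ) ^ 2)‖ = Real.exp (-5 * t ^ 2) := by
        have : (-5 * (t : ℂ) ^ 2) = ((-5 * t ^ 2 : ℝ) : ℂ) := by push_cast; ring
        rw [this, Complex.norm_exp_ofReal]
      rw [norm_mul, he, norm_mul, Real.exp_add]
      calc _ ≤ Real.exp (-5 * t ^ 2) * (‖β‖ * (Real.exp (‖β‖ * t) + Real.exp (‖β‖ * t))) := by
            gcongr
            exact (norm_add_le _ _).trans (add_le_add (hn _ hs) (hn _ (by rwa [norm_neg])))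
        _ = _ := by ring

/-- The atom at a point `(s, ν)` of phase space: `x ↦ e^{2πiνx} e^{-(x-s)^2}`. -/
def phaseAtom (z : ℝ × ℝ) (x : ℝ) : ℂ := gaussAtomFun z.1 (-z.2) x

/-- The integrand of the quadrilinear form of `TH` at four atoms. -/
def quadAtom (z : (ℝ × ℝ) × (ℝ × ℝ) × (ℝ × ℝ) × (ℝ × ℝ)) (x t : ℝ) : ℂ :=
  phaseAtom z.1 x * (phaseAtom z.2.1 (x - t) * phaseAtom z.2.2.1 (x + t) *
    phaseAtom z.2.2.2 (x + 2 * t))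

/-- Half the linear coefficient of `quadAtom z` in `x`, at `t = 0`, times two. -/
def quadAlpha (z : (ℝ × ℝ) × (ℝ × ℝ) × (ℝ × ℝ) × (ℝ × ℝ)) : ℂ :=
  2 * Real.pi * (z.1.2 + z.2.1.2 + z.2.2.1.2 + z.2.2.2.2 : ℝ) * Complex.I +
    2 * (z.1.1 + z.2.1.1 + z.2.2.1.1 + z.2.2.2.1 : ℝ)

/-- The linear coefficient in `t` of the exponent of `∫ quadAtom z x t dx`. -/
def quadBeta (z : (ℝ × ℝ) × (ℝ × ℝ) × (ℝ × ℝ) × (ℝ × ℝ)) : ℂ :=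
  2 * Real.pi * (-z.2.1.2 + z.2.2.1.2 + 2 * z.2.2.2.2 : ℝ) * Complex.I +
    (-2 * z.2.1.1 + 2 * z.2.2.1.1 + 4 * z.2.2.2.1 : ℝ) - quadAlpha z / 2

/-- The constant term of the exponent of `∫ quadAtom z x t dx`. -/
def quadGamma (z : (ℝ × ℝ) × (ℝ × ℝ) × (ℝ × ℝ) × (ℝ × ℝ)) : ℂ :=
  quadAlpha z ^ 2 / 16 - (z.1.1 ^ 2 + z.2.1.1 ^ 2 + z.2.2.1.1 ^ 2 + z.2.2.2.1 ^ 2 : ℝ)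

/-- The quadrilinear form `⟨TH(f, g, h), ψ⟩` at four atoms. -/
def thKernel (z : (ℝ × ℝ) × (ℝ × ℝ) × (ℝ × ℝ) × (ℝ × ℝ)) : ℂ :=
  (Real.pi / 4 : ℂ) ^ (1 / 2 : ℂ) * Complex.exp (quadGamma z) * gaussPV (quadBeta z)

theorem continuous_thKernel : Continuous thKernel := by
  have h := continuous_gaussPV
  unfold thKernel quadGamma quadBeta quadAlpha
  fun_prop

theorem quadAtom_eq (z : (ℝ × ℝ) × (ℝ × ℝ) × (ℝ × ℝ) × (ℝ × ℝ)) (x t : ℝ) :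
    quadAtom z x t = Complex.exp (-4 * (x : ℂ) ^ 2 + (quadAlpha z - 4 * t) * x +
      (2 * Real.pi * t * (-z.2.1.2 + z.2.2.1.2 + 2 * z.2.2.2.2 : ℝ) * Complex.I -
        (z.1.1 ^ 2 + (z.2.1.1 + t) ^ 2 + (z.2.2.1.1 - t) ^ 2 + (z.2.2.2.1 - 2 * t) ^ 2 : ℝ))) := by
  simp only [quadAtom, phaseAtom, gaussAtomFun, ← Complex.exp_add, quadAlpha]
  congr 1
  push_cast
  ring

theorem integral_quadAtom (z : (ℝ × ℝ) × (ℝ × ℝ) × (ℝ × ℝ) × (ℝ × ℝ)) (t : ℝ) :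
    ∫ x : ℝ, quadAtom z x t = (Real.pi / 4 : ℂ) ^ (1 / 2 : ℂ) * Complex.exp (quadGamma z) *
      (Complex.exp (-5 * (t : ℂ) ^ 2) * Complex.exp (quadBeta z * t)) := by
  simp_rw [quadAtom_eq]
  rw [integral_cexp_quadratic (by norm_num), neg_neg, ← Complex.exp_add,
    mul_assoc ((Real.pi / 4 : ℂ) ^ (1 / 2 : ℂ)),
    ← Complex.exp_add]
  congr 2
  simp only [quadGamma, quadBeta]
  push_cast
  ring

theorem norm_exp_quadGamma (z : (ℝ × ℝ) × (ℝ × ℝ) × (ℝ × ℝ) × (ℝ × ℝ)) :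
    ‖Complex.exp (quadGamma z)‖ = Real.exp (
      -(Real.pi ^ 2 / 4 * (z.1.2 + z.2.1.2 + z.2.2.1.2 + z.2.2.2.2) ^ 2) +
      ((z.1.1 + z.2.1.1 + z.2.2.1.1 + z.2.2.2.1) ^ 2 / 4 -
      (z.1.1 ^ 2 + z.2.1.1 ^ 2 + z.2.2.1.1 ^ 2 + z.2.2.2.1 ^ 2))) := by
  rw [Complex.norm_exp]
  congr 1
  have : quadGamma z = ((-(Real.pi ^ 2 / 4 * (z.1.2 + z.2.1.2 + z.2.2.1.2 + z.2.2.2.2) ^ 2) +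
      ((z.1.1 + z.2.1.1 + z.2.2.1.1 + z.2.2.2.1) ^ 2 / 4 -
      (z.1.1 ^ 2 + z.2.1.1 ^ 2 + z.2.2.1.1 ^ 2 + z.2.2.2.1 ^ 2)) : ℝ) : ℂ) +
      ((Real.pi / 2 * (z.1.2 + z.2.1.2 + z.2.2.1.2 + z.2.2.2.2) *
        (z.1.1 + z.2.1.1 + z.2.2.1.1 + z.2.2.2.1) : ℝ) : ℂ) * Complex.I := by
    simp only [quadGamma, quadAlpha]
    push_cast
    ring_nf
    rw [Complex.I_sq]
    ring
  rw [this, Complex.add_re, Complex.ofReal_re, Complex.re_ofReal_mul, Complex.I_re, mul_zero,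
    add_zero]

theorem quadBeta_re (z : (ℝ × ℝ) × (ℝ × ℝ) × (ℝ × ℝ) × (ℝ × ℝ)) :
    (quadBeta z).re = -z.1.1 - 3 * z.2.1.1 + z.2.2.1.1 + 3 * z.2.2.2.1 := by
  have : quadBeta z = ((-z.1.1 - 3 * z.2.1.1 + z.2.2.1.1 + 3 * z.2.2.2.1 : ℝ) : ℂ) +
      ((2 * Real.pi * (-z.2.1.2 + z.2.2.1.2 + 2 * z.2.2.2.2) -
        Real.pi * (z.1.2 + z.2.1.2 + z.2.2.1.2 + z.2.2.2.2) : ℝ) : ℂ) * Complex.I := by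
    simp only [quadBeta, quadAlpha]
    push_cast
    ring
  rw [this, Complex.add_re, Complex.ofReal_re, Complex.re_ofReal_mul, Complex.I_re, mul_zero,
    add_zero]

theorem norm_thKernel_le_gaussian : ∃ C : ℝ, 0 < C ∧
    ∀ z : (ℝ × ℝ) × (ℝ × ℝ) × (ℝ × ℝ) × (ℝ × ℝ), ‖thKernel z‖ ≤
      C * (Real.exp (-(2 * (z.1.2 + z.2.1.2 + z.2.2.1.2 + z.2.2.2.2) ^ 2)) *
        Real.exp (-(((z.2.1.1 - z.1.1 + (z.2.2.2.1 - z.2.2.1.1)) ^ 2 +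
          (z.2.2.1.1 - z.1.1 - (z.2.2.2.1 - z.2.2.1.1)) ^ 2) / 20)) /
        (1 + |z.2.2.2.1 - z.2.2.1.1|)) := by
  obtain ⟨C, hC, hb⟩ := norm_gaussPV_le
  set A := ‖(Real.pi / 4 : ℂ) ^ (1 / 2 : ℂ)‖
  refine ⟨(A + 1) * C * 71, by positivity, fun z => ?_⟩
  set s0 := z.1.1
  set s1 := z.2.1.1
  set s2 := z.2.2.1.1
  set s3 := z.2.2.2.1
  set η := z.1.2 + z.2.1.2 + z.2.2.1.2 + z.2.2.2.2
  set τ := s3 - s2 with hτ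
  set a := s1 - s0 + τ with ha
  set b := s2 - s0 - τ with hb'
  have hbz := hb (quadBeta z)
  rw [quadBeta_re] at hbz
  set Λ := -s0 - 3 * s1 + s2 + 3 * s3 with hΛ
  rw [thKernel, norm_mul, norm_mul, norm_exp_quadGamma]
  have hpi : 8 ≤ Real.pi ^ 2 := by nlinarith [Real.pi_gt_three]
  have hLe : Λ = 10 * τ - 3 * a + 4 * b := by simp only [hΛ, ha, hb', hτ]; ring
  have hdecay : 1 / (1 + |Λ|) ≤ (1 + 3 * |a| + 4 * |b|) / (1 + |τ|) := by
    rw [div_le_div_iff₀ (by positivity) (by positivity)]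
    have : 10 * |τ| ≤ |Λ| + 3 * |a| + 4 * |b| := by
      have h1 : 10 * τ = Λ + 3 * a - 4 * b := by rw [hLe]; ring
      calc 10 * |τ| = |10 * τ| := by rw [abs_mul]; norm_num
        _ = |Λ + 3 * a - 4 * b| := by rw [h1]
        _ ≤ |Λ + 3 * a| + |4 * b| := abs_sub _ _
        _ ≤ |Λ| + |3 * a| + |4 * b| := by gcongr; exact abs_add_le _ _
        _ = _ := by rw [abs_mul, abs_mul]; norm_num
    have := abs_nonneg τ
    have := abs_nonneg Λ
    have := abs_nonneg a
    have := abs_nonneg b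
    nlinarith [mul_nonneg (abs_nonneg Λ) (abs_nonneg a), mul_nonneg (abs_nonneg Λ) (abs_nonneg b)]
  have hpoly : 1 + 3 * |a| + 4 * |b| ≤ 71 * Real.exp ((a ^ 2 + b ^ 2) / 20) := by
    have := Real.add_one_le_exp ((a ^ 2 + b ^ 2) / 20)
    have h1 : |a| ^ 2 = a ^ 2 := sq_abs a
    have h2 : |b| ^ 2 = b ^ 2 := sq_abs b
    nlinarith [sq_nonneg (|a| - 1), sq_nonneg (|b| - 1)]
  have hexp : Real.exp (-(Real.pi ^ 2 / 4 * η ^ 2) +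
      ((s0 + s1 + s2 + s3) ^ 2 / 4 - (s0 ^ 2 + s1 ^ 2 + s2 ^ 2 + s3 ^ 2))) *
      Real.exp (Λ ^ 2 / 20) ≤ Real.exp (-(2 * η ^ 2)) * (Real.exp (-((a ^ 2 + b ^ 2) / 20)) *
        Real.exp (-((a ^ 2 + b ^ 2) / 20))) := by
    rw [← Real.exp_add, ← Real.exp_add, ← Real.exp_add]
    apply Real.exp_le_exp.mpr
    have h1 : (s0 + s1 + s2 + s3) ^ 2 / 4 - (s0 ^ 2 + s1 ^ 2 + s2 ^ 2 + s3 ^ 2) + Λ ^ 2 / 20 =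
        -((6 * a ^ 2 + 4 * a * b + 4 * b ^ 2) / 20) := by
      simp only [hΛ, ha, hb', hτ]; ring
    nlinarith [sq_nonneg (a + b), sq_nonneg a, sq_nonneg η,
      mul_le_mul_of_nonneg_right hpi (sq_nonneg η)]
  calc _ ≤ A * Real.exp (-(Real.pi ^ 2 / 4 * η ^ 2) +
      ((s0 + s1 + s2 + s3) ^ 2 / 4 - (s0 ^ 2 + s1 ^ 2 + s2 ^ 2 + s3 ^ 2))) *
        (C * (Real.exp (Λ ^ 2 / 20) / (1 + |Λ|))) := by gcongr
    _ = A * C * (Real.exp (-(Real.pi ^ 2 / 4 * η ^ 2) +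
      ((s0 + s1 + s2 + s3) ^ 2 / 4 - (s0 ^ 2 + s1 ^ 2 + s2 ^ 2 + s3 ^ 2))) *
      Real.exp (Λ ^ 2 / 20)) * (1 / (1 + |Λ|)) := by ring
    _ ≤ (A + 1) * C * (Real.exp (-(2 * η ^ 2)) * (Real.exp (-((a ^ 2 + b ^ 2) / 20)) *
        Real.exp (-((a ^ 2 + b ^ 2) / 20)))) *
        ((71 * Real.exp ((a ^ 2 + b ^ 2) / 20)) / (1 + |τ|)) := by
      have hd2 : 1 / (1 + |Λ|) ≤ (71 * Real.exp ((a ^ 2 + b ^ 2) / 20)) / (1 + |τ|) :=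
        hdecay.trans (div_le_div_of_nonneg_right hpoly (by positivity))
      refine mul_le_mul (mul_le_mul ?_ hexp (by positivity) (by positivity)) hd2 (by positivity)
        (by positivity)
      gcongr
      linarith
    _ = (A + 1) * C * 71 * (Real.exp (-(2 * η ^ 2)) * Real.exp (-((a ^ 2 + b ^ 2) / 20)) *
        (Real.exp (-((a ^ 2 + b ^ 2) / 20)) * Real.exp ((a ^ 2 + b ^ 2) / 20)) / (1 + |τ|)) := by
      ring
    _ = _ := by
      rw [← Real.exp_add (-((a ^ 2 + b ^ 2) / 20)), neg_add_cancel, Real.exp_zero, mul_one]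

/-- The Gaussian weight that concentrates the four phase space points on the set where
`ν + ν₁ + ν₂ + ν₃ = 0`, and the time variables are `s, s - τ, s + τ, s + 2τ`. -/
def phaseWeight (z : ℝ × ℝ) (w : (ℝ × ℝ) × (ℝ × ℝ) × (ℝ × ℝ)) : ℝ :=
  Real.exp (-(z.2 + w.1.2 + w.2.1.2 + w.2.2.2) ^ 2) *
    (Real.exp (-((w.1.1 - z.1 + (w.2.2.1 - w.2.1.1)) ^ 2 / 40)) *
      Real.exp (-((w.2.1.1 - z.1 - (w.2.2.1 - w.2.1.1)) ^ 2 / 40)))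

theorem norm_thKernel_le : ∃ C : ℝ, 0 < C ∧ ∀ z w, ‖thKernel (z, w)‖ ≤
    C * (phaseWeight z w / (1 + |w.2.2.1 - w.2.1.1|)) := by
  obtain ⟨C, hC, h⟩ := norm_thKernel_le_gaussian
  refine ⟨C, hC, fun z w => (h (z, w)).trans ?_⟩
  simp only [phaseWeight, ← Real.exp_add]
  have : 0 < 1 + |w.2.2.1 - w.2.1.1| := by positivity
  refine mul_le_mul_of_nonneg_left (div_le_div_of_nonneg_right (Real.exp_le_exp.mpr ?_) this.le)
    hC.le
  have := sq_nonneg (z.2 + w.1.2 + w.2.1.2 + w.2.2.2)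
  have := sq_nonneg (w.1.1 - z.1 + (w.2.2.1 - w.2.1.1))
  have := sq_nonneg (w.2.1.1 - z.1 - (w.2.2.1 - w.2.1.1))
  linarith

theorem norm_integral_gaussAtomFun_mul (s ν s' ν' : ℝ) :
    ‖∫ x : ℝ, gaussAtomFun s' ν' x * gaussAtomFun s ν x‖ =
      ‖(Real.pi / 2 : ℂ) ^ (1 / 2 : ℂ)‖ *
        Real.exp (-((s - s') ^ 2 / 2) - Real.pi ^ 2 / 2 * (ν + ν') ^ 2) := by
  have h1 : ∀ x : ℝ, gaussAtomFun s' ν' x * gaussAtomFun s ν x =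
      Complex.exp (-2 * (x : ℂ) ^ 2 + (-(2 * Real.pi * (ν + ν') * Complex.I) + 2 * (s + s')) * x +
        (-s ^ 2 - s' ^ 2)) := by
    intro x
    simp only [gaussAtomFun, ← Complex.exp_add]
    congr 1
    push_cast
    ring
  simp_rw [h1]
  rw [integral_cexp_quadratic (by norm_num), norm_mul, neg_neg, Complex.norm_exp]
  congr 2
  have : (-s ^ 2 - s' ^ 2 - (-(2 * Real.pi * (ν + ν') * Complex.I) + 2 * (s + s')) ^ 2 / (4 * -2) :
      ℂ) = ((-((s - s') ^ 2 / 2) - Real.pi ^ 2 / 2 * (ν + ν') ^ 2 : ℝ) : ℂ) +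
      ((-(Real.pi * (ν + ν') * (s + s')) : ℝ) : ℂ) * Complex.I := by
    push_cast
    ring_nf
    rw [Complex.I_sq]
    ring
  rw [this, Complex.add_re, Complex.ofReal_re, Complex.re_ofReal_mul, Complex.I_re, mul_zero,
    add_zero]

theorem norm_integral_mul_norm_thKernel_le : ∃ C : ℝ, 0 < C ∧ ∀ s ν z w,
    ‖∫ x : ℝ, gaussAtomFun z.1 z.2 x * gaussAtomFun s ν x‖ * ‖thKernel (z, w)‖ ≤
    C * ((Real.exp (-(1 / 4) * (s - z.1) ^ 2) * Real.exp (-2 * (ν + z.2) ^ 2)) *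
      (phaseWeight (s, -ν) w / (1 + |w.2.2.1 - w.2.1.1|))) := by
  obtain ⟨C, hC, h⟩ := norm_thKernel_le_gaussian
  set A := ‖(Real.pi / 2 : ℂ) ^ (1 / 2 : ℂ)‖
  refine ⟨(A + 1) * C, by positivity, fun s ν z w => ?_⟩
  rw [norm_integral_gaussAtomFun_mul]
  have hpi : 8 ≤ Real.pi ^ 2 := by nlinarith [Real.pi_gt_three]
  set τ := w.2.2.1 - w.2.1.1
  set N := w.1.2 + w.2.1.2 + w.2.2.2
  have key : Real.exp (-((s - z.1) ^ 2 / 2) - Real.pi ^ 2 / 2 * (ν + z.2) ^ 2) *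
      (Real.exp (-(2 * (z.2 + w.1.2 + w.2.1.2 + w.2.2.2) ^ 2)) *
        Real.exp (-(((w.1.1 - z.1 + τ) ^ 2 + (w.2.1.1 - z.1 - τ) ^ 2) / 20))) ≤
      (Real.exp (-(1 / 4) * (s - z.1) ^ 2) * Real.exp (-2 * (ν + z.2) ^ 2)) *
        phaseWeight (s, -ν) w := by
    simp only [phaseWeight, ← Real.exp_add]
    apply Real.exp_le_exp.mpr
    have h1 : (-ν + w.1.2 + w.2.1.2 + w.2.2.2) ^ 2 ≤
        2 * (z.2 + w.1.2 + w.2.1.2 + w.2.2.2) ^ 2 + 2 * (ν + z.2) ^ 2 := by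
      nlinarith [sq_nonneg ((z.2 + w.1.2 + w.2.1.2 + w.2.2.2) + (ν + z.2))]
    have h2 : (w.1.1 - s + τ) ^ 2 ≤ 2 * (w.1.1 - z.1 + τ) ^ 2 + 2 * (s - z.1) ^ 2 := by
      nlinarith [sq_nonneg ((w.1.1 - z.1 + τ) + (s - z.1))]
    have h3 : (w.2.1.1 - s - τ) ^ 2 ≤ 2 * (w.2.1.1 - z.1 - τ) ^ 2 + 2 * (s - z.1) ^ 2 := by
      nlinarith [sq_nonneg ((w.2.1.1 - z.1 - τ) + (s - z.1))]
    have h4 := mul_le_mul_of_nonneg_right hpi (sq_nonneg (ν + z.2))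
    have h5 := sq_nonneg (s - z.1)
    linarith
  calc _ ≤ A * Real.exp (-((s - z.1) ^ 2 / 2) - Real.pi ^ 2 / 2 * (ν + z.2) ^ 2) *
        (C * (Real.exp (-(2 * (z.2 + w.1.2 + w.2.1.2 + w.2.2.2) ^ 2)) *
        Real.exp (-(((w.1.1 - z.1 + τ) ^ 2 + (w.2.1.1 - z.1 - τ) ^ 2) / 20)) / (1 + |τ|))) := by
        gcongr
        exact h (z, w)
    _ = A * C * (Real.exp (-((s - z.1) ^ 2 / 2) - Real.pi ^ 2 / 2 * (ν + z.2) ^ 2) *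
      (Real.exp (-(2 * (z.2 + w.1.2 + w.2.1.2 + w.2.2.2) ^ 2)) *
        Real.exp (-(((w.1.1 - z.1 + τ) ^ 2 + (w.2.1.1 - z.1 - τ) ^ 2) / 20)))) / (1 + |τ|) := by
        ring
    _ ≤ (A + 1) * C * ((Real.exp (-(1 / 4) * (s - z.1) ^ 2) * Real.exp (-2 * (ν + z.2) ^ 2)) *
        phaseWeight (s, -ν) w) / (1 + |τ|) := by
        gcongr
        linarith
    _ = _ := by ring

/-! ### Continuity of the atoms in the Schwartz space -/

theorem iteratedDeriv_gaussAtomFun_hermite (n : ℕ) : ∃ H : Polynomial ℂ, ∀ t ν : ℝ,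
    iteratedDeriv n (gaussAtomFun t ν) = fun x : ℝ =>
      H.eval (-(2 * Real.pi * ν * Complex.I) - 2 * ((x : ℂ) - t)) * gaussAtomFun t ν x := by
  induction n with
  | zero => exact ⟨1, by simp⟩
  | succ n ih =>
    obtain ⟨H, hH⟩ := ih
    refine ⟨Polynomial.X * H - 2 * H.derivative, fun t ν => ?_⟩
    rw [iteratedDeriv_succ, hH]
    funext x
    have h0 : HasDerivAt (fun x : ℂ => H.eval (-(2 * Real.pi * ν * Complex.I) - 2 * (x - t)))
        (H.derivative.eval (-(2 * Real.pi * ν * Complex.I) - 2 * ((x : ℂ) - t)) * (-2)) x := by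
      have h1 : HasDerivAt (fun x : ℂ => -(2 * Real.pi * ν * Complex.I) - 2 * (x - t)) (-2)
          (x : ℂ) := by
        have := (((hasDerivAt_id (x : ℂ)).sub_const (t : ℂ)).const_mul 2).const_sub
          (-(2 * Real.pi * ν * Complex.I))
        simpa using this
      exact (H.hasDerivAt _).comp _ h1
    rw [(h0.comp_ofReal.fun_mul (hasDerivAt_gaussAtomFun t ν x)).deriv]
    simp
    ring

theorem add_two_mul_pow_mul_exp_le (A : ℝ) (hA : 0 ≤ A) (j : ℕ) (x : ℝ) :
    (A + 2 * |x|) ^ j * Real.exp (-|x|) ≤ 2 ^ j * j.factorial * Real.exp (A / 2) := by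
  have h := Real.pow_div_factorial_le_exp (A / 2 + |x|) (by positivity) j
  rw [div_le_iff₀ (by positivity), Real.exp_add] at h
  have h2 : (A + 2 * |x|) ^ j = 2 ^ j * (A / 2 + |x|) ^ j := by rw [← mul_pow]; congr 1; ring
  rw [h2]
  calc 2 ^ j * (A / 2 + |x|) ^ j * Real.exp (-|x|)
      ≤ 2 ^ j * (Real.exp (A / 2) * Real.exp |x| * j.factorial) * Real.exp (-|x|) := by gcongr
    _ = 2 ^ j * j.factorial * Real.exp (A / 2) * (Real.exp |x| * Real.exp (-|x|)) := by ring
    _ = _ := by rw [← Real.exp_add]; simp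

theorem gaussAtomFun_locally_bounded (R : ℝ) (hR : 0 ≤ R) (k : ℕ) (H : Polynomial ℂ) :
    ∃ C : ℝ, ∀ t ν x : ℝ, |t| ≤ R → |ν| ≤ R → |x| ^ k *
      ‖H.eval (-(2 * Real.pi * ν * Complex.I) - 2 * ((x : ℂ) - t)) * gaussAtomFun t ν x‖ ≤ C := by
  induction H using Polynomial.induction_on' with
  | add P Q hP hQ =>
    obtain ⟨C, hC⟩ := hP
    obtain ⟨D, hD⟩ := hQ
    refine ⟨C + D, fun t ν x ht hν => ?_⟩
    rw [Polynomial.eval_add, add_mul]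
    calc _ ≤ |x| ^ k * (‖P.eval (-(2 * Real.pi * ν * Complex.I) - 2 * ((x : ℂ) - t)) *
          gaussAtomFun t ν x‖ + ‖Q.eval (-(2 * Real.pi * ν * Complex.I) - 2 * ((x : ℂ) - t)) *
          gaussAtomFun t ν x‖) := by
          gcongr
          exact norm_add_le _ _
      _ ≤ C + D := by rw [mul_add]; exact add_le_add (hC t ν x ht hν) (hD t ν x ht hν)
  | monomial n a =>
    set A := 2 * Real.pi * R + 2 * R with hA
    have hA0 : 0 ≤ A := by positivity
    refine ⟨‖a‖ * Real.exp (1 + R) * (2 ^ (k + n) * (k + n).factorial * Real.exp (A / 2)),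
      fun t ν x ht hν => ?_⟩
    have h1 := exp_neg_sq_le t x
    have h2 := add_two_mul_pow_mul_exp_le A hA0 (k + n) x
    have h3 : ‖-(2 * Real.pi * ν * Complex.I) - 2 * ((x : ℂ) - t)‖ ≤ A + 2 * |x| := by
      calc _ ≤ ‖-(2 * Real.pi * ν * Complex.I)‖ + ‖2 * ((x : ℂ) - t)‖ := norm_sub_le _ _
        _ = 2 * Real.pi * |ν| + 2 * |x - t| := by
          rw [norm_neg, norm_mul, norm_mul, norm_mul, norm_mul, ← Complex.ofReal_sub,
            Complex.norm_real, Complex.norm_real, Complex.norm_real, Complex.norm_I]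
          simp [abs_of_pos Real.pi_pos]
        _ ≤ 2 * Real.pi * R + 2 * (|x| + R) := by
          gcongr
          exact (abs_sub _ _).trans (by gcongr)
        _ = _ := by rw [hA]; ring
    rw [norm_mul, norm_gaussAtomFun, Polynomial.eval_monomial, norm_mul, norm_pow]
    have hx : |x| ≤ A + 2 * |x| := by linarith [abs_nonneg x]
    calc _ ≤ (A + 2 * |x|) ^ k * (‖a‖ * (A + 2 * |x|) ^ n *
          (Real.exp (1 + R) * Real.exp (-|x|))) := by
          gcongr
          exact h1.trans (by gcongr)
      _ = ‖a‖ * Real.exp (1 + R) * ((A + 2 * |x|) ^ (k + n) * Real.exp (-|x|)) := by ring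
      _ ≤ _ := by gcongr

theorem continuous_gaussAtom : Continuous fun p : ℝ × ℝ => gaussAtom p.1 p.2 := by
  rw [continuous_iff_continuousAt]
  intro p₀
  rw [ContinuousAt, (schwartz_withSeminorms ℝ ℝ ℂ).tendsto_nhds]
  rintro ⟨k, n⟩ ε hε
  obtain ⟨H, hH⟩ := iteratedDeriv_gaussAtomFun_hermite n
  obtain ⟨Φ, hΦ⟩ : ∃ Φ : ℝ × ℝ → ℝ → ℂ, ∀ p x, Φ p x =
    H.eval (-(2 * Real.pi * p.2 * Complex.I) - 2 * ((x : ℂ) - p.1)) * gaussAtomFun p.1 p.2 x :=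
    ⟨_, fun _ _ => rfl⟩
  have hΦc : Continuous fun q : (ℝ × ℝ) × ℝ => Φ q.1 q.2 := by
    simp only [hΦ, gaussAtomFun]
    have := H.continuous
    fun_prop
  set R := |p₀.1| + |p₀.2| + 1 with hR
  have hR0 : 0 ≤ R := by positivity
  obtain ⟨C, hC⟩ := gaussAtomFun_locally_bounded R hR0 (k + 1) H
  set X := 4 * |C| / ε + 1 with hX
  have hX0 : 0 < X := by positivity
  have hnear : ∀ᶠ p : ℝ × ℝ in 𝓝 p₀, |p.1| ≤ R ∧ |p.2| ≤ R := by
    have h1 : ∀ᶠ p : ℝ × ℝ in 𝓝 p₀, |p.1| < R :=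
      (continuous_fst.abs).continuousAt.eventually_lt_const (by
        rw [hR]; linarith [abs_nonneg p₀.2])
    have h2 : ∀ᶠ p : ℝ × ℝ in 𝓝 p₀, |p.2| < R :=
      (continuous_snd.abs).continuousAt.eventually_lt_const (by
        rw [hR]; linarith [abs_nonneg p₀.1])
    filter_upwards [h1, h2] with p hp hp' using ⟨hp.le, hp'.le⟩
  have hcomp : ∀ᶠ p in 𝓝 p₀, ∀ x ∈ Set.Icc (-X) X, |x| ^ k * ‖Φ p x - Φ p₀ x‖ < ε / 2 := by
    refine isCompact_Icc.eventually_forall_of_forall_eventually fun x _ => ?_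
    have hc : Continuous fun q : (ℝ × ℝ) × ℝ => |q.2| ^ k * ‖Φ q.1 q.2 - Φ p₀ q.2‖ := by
      have h3 : Continuous fun q : (ℝ × ℝ) × ℝ => Φ p₀ q.2 :=
        hΦc.comp (continuous_const.prodMk continuous_snd)
      fun_prop
    have h0 : |x| ^ k * ‖Φ p₀ x - Φ p₀ x‖ < ε / 2 := by
      rw [sub_self, norm_zero, mul_zero]
      positivity
    exact hc.continuousAt.eventually_lt_const h0
  filter_upwards [hnear, hcomp] with p hp hpc
  refine lt_of_le_of_lt (SchwartzMap.seminorm_le_bound' ℝ k n _ (by positivity : 0 ≤ ε / 2)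
    fun x => ?_) (half_lt_self hε)
  have hdiff : iteratedDeriv n (⇑(gaussAtom p.1 p.2 - gaussAtom p₀.1 p₀.2)) x =
      Φ p x - Φ p₀ x := by
    have hs : ∀ t ν : ℝ, ContDiffAt ℝ n (gaussAtomFun t ν) x := fun t ν =>
      ((contDiff_gaussAtomFun t ν).of_le (by exact_mod_cast le_top)).contDiffAt
    have : (⇑(gaussAtom p.1 p.2 - gaussAtom p₀.1 p₀.2) : ℝ → ℂ) =
        gaussAtomFun p.1 p.2 - gaussAtomFun p₀.1 p₀.2 := rfl
    rw [this, iteratedDeriv_sub (hs _ _) (hs _ _), hH, hH, hΦ, hΦ]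
  rw [hdiff]
  by_cases hx : |x| ≤ X
  · exact (hpc x (abs_le.mp hx)).le
  · have hx' : X < |x| := not_le.mp hx
    have hxp : 0 < |x| := hX0.trans hx'
    have b1 := hC p.1 p.2 x hp.1 hp.2
    rw [← hΦ] at b1
    have b2 := hC p₀.1 p₀.2 x (by rw [hR]; linarith [abs_nonneg p₀.2])
      (by rw [hR]; linarith [abs_nonneg p₀.1])
    rw [← hΦ] at b2
    have b3 : |x| * (|x| ^ k * ‖Φ p x - Φ p₀ x‖) ≤ 2 * |C| := by
      calc _ = |x| ^ (k + 1) * ‖Φ p x - Φ p₀ x‖ := by ring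
        _ ≤ |x| ^ (k + 1) * (‖Φ p x‖ + ‖Φ p₀ x‖) := by gcongr; exact norm_sub_le _ _
        _ ≤ C + C := by rw [mul_add]; exact add_le_add b1 b2
        _ ≤ _ := by linarith [le_abs_self C]
    have b4 : 2 * |C| ≤ X * (ε / 2) := by
      have : X * (ε / 2) = 2 * |C| + ε / 2 := by rw [hX]; field_simp; ring
      linarith
    by_contra hcon
    have hcon' := not_le.mp hcon
    have : X * (ε / 2) < |x| * (|x| ^ k * ‖Φ p x - Φ p₀ x‖) := by gcongr
    linarith

theorem continuous_stft (u : 𝓢'(ℝ, ℂ)) : Continuous fun p : ℝ × ℝ => stft u p.1 p.2 :=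
  (map_continuous u).comp continuous_gaussAtom

/-! ### The short-time Fourier transform of a Schwartz function -/

theorem stft_coe (ψ : 𝓢(ℝ, ℂ)) (s ν : ℝ) :
    stft (ψ : 𝓢'(ℝ, ℂ)) s ν = ∫ x : ℝ, gaussAtomFun s ν x * ψ x :=
  SchwartzMap.coe_apply ψ (gaussAtom s ν)

/-- The operator `ψ ↦ ψ' - 2xψ`. -/
def lowering : 𝓢(ℝ, ℂ) →L[ℂ] 𝓢(ℝ, ℂ) :=
  SchwartzMap.derivCLM ℂ ℂ - (2 : ℂ) • SchwartzMap.smulLeftCLM ℂ (fun x : ℝ => (x : ℂ))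

theorem lowering_apply (ψ : 𝓢(ℝ, ℂ)) (x : ℝ) : lowering ψ x = deriv ψ x - 2 * (x * ψ x) := by
  have h : Function.HasTemperateGrowth (fun x : ℝ => (x : ℂ)) := Complex.ofRealCLM.hasTemperateGrowth
  simp [lowering, SchwartzMap.smulLeftCLM_apply_apply h]

theorem stft_lowering (ψ : 𝓢(ℝ, ℂ)) (s ν : ℝ) :
    2 * Real.pi * ν * Complex.I * stft (ψ : 𝓢'(ℝ, ℂ)) s ν =
      stft (lowering ψ : 𝓢'(ℝ, ℂ)) s ν + 2 * s * stft (ψ : 𝓢'(ℝ, ℂ)) s ν := by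
  have hx : Function.HasTemperateGrowth (fun x : ℝ => (x : ℂ)) := Complex.ofRealCLM.hasTemperateGrowth
  have hint : ∀ ψ : 𝓢(ℝ, ℂ), Integrable fun x : ℝ => gaussAtomFun s ν x * ψ x := fun ψ => by
    have := (SchwartzMap.pairing (ContinuousLinearMap.mul ℂ ℂ) (gaussAtom s ν) ψ).integrable
      (μ := volume)
    exact this
  have h1 := SchwartzMap.integral_mul_deriv_eq_neg_deriv_mul (gaussAtom s ν) ψ
  have i1 := hint ψ
  have i2 := hint (SchwartzMap.derivCLM ℂ ℂ ψ)
  have i3 := hint (SchwartzMap.smulLeftCLM ℂ (fun x : ℝ => (x : ℂ)) ψ)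
  simp only [SchwartzMap.derivCLM_apply, SchwartzMap.smulLeftCLM_apply_apply hx, smul_eq_mul]
    at i2 i3
  have h2 : ∫ x : ℝ, deriv (⇑(gaussAtom s ν)) x * ψ x =
      -(2 * Real.pi * ν * Complex.I) * (∫ x : ℝ, gaussAtomFun s ν x * ψ x) -
      2 * (∫ x : ℝ, gaussAtomFun s ν x * (x * ψ x)) +
      2 * s * ∫ x : ℝ, gaussAtomFun s ν x * ψ x := by
    have i13 : Integrable fun x : ℝ => -(2 * Real.pi * ν * Complex.I) *
        (gaussAtomFun s ν x * ψ x) - 2 * (gaussAtomFun s ν x * (x * ψ x)) :=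
      (i1.const_mul _).sub (i3.const_mul _)
    rw [← integral_const_mul, ← integral_const_mul, ← integral_const_mul,
      ← integral_sub (i1.const_mul _) (i3.const_mul _), ← integral_add i13 (i1.const_mul _)]
    apply integral_congr_ae
    refine Eventually.of_forall fun x => ?_
    have : deriv (⇑(gaussAtom s ν)) x = _ := (hasDerivAt_gaussAtomFun s ν x).deriv
    simp only [this]
    ring
  have h3 : ∫ x : ℝ, gaussAtomFun s ν x * lowering ψ x =
      (∫ x : ℝ, gaussAtomFun s ν x * deriv ψ x) -
        2 * ∫ x : ℝ, gaussAtomFun s ν x * (x * ψ x) := by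
    rw [← integral_const_mul, ← integral_sub i2 (i3.const_mul _)]
    apply integral_congr_ae
    refine Eventually.of_forall fun x => ?_
    simp only [lowering_apply]
    ring
  have h4 : ∫ x : ℝ, gaussAtomFun s ν x * deriv ψ x = ∫ x : ℝ, gaussAtom s ν x * deriv ψ x := rfl
  rw [stft_coe, stft_coe, h3, h4, h1, h2]
  ring

theorem integrable_one_add_abs_pow_mul_gaussian (a : ℕ) :
    Integrable fun y : ℝ => (1 + |y|) ^ a * Real.exp (-y ^ 2) := by
  have h1 : Integrable fun y : ℝ => 2 ^ a * a.factorial * Real.exp 1 *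
      Real.exp (-(1 / 2) * y ^ 2) := (integrable_exp_neg_mul_sq (by norm_num)).const_mul _
  refine h1.mono' (Continuous.aestronglyMeasurable (by fun_prop)) (Eventually.of_forall fun y => ?_)
  rw [Real.norm_of_nonneg (by positivity)]
  have h2 := add_two_mul_pow_mul_exp_le 1 zero_le_one a y
  have h3 : (1 + |y|) ^ a ≤ (1 + 2 * |y|) ^ a := by
    gcongr; linarith [abs_nonneg y]
  have h4 : Real.exp (-y ^ 2) ≤ Real.exp (-|y|) * (Real.exp (1 / 2) * Real.exp (-(1 / 2) * y ^ 2)) := by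
    rw [← Real.exp_add, ← Real.exp_add]
    apply Real.exp_le_exp.mpr
    have := sq_abs y
    nlinarith [sq_nonneg (|y| - 1)]
  have h5 : Real.exp (1 / 2) * Real.exp (1 / 2) = Real.exp 1 := by
    rw [← Real.exp_add]; norm_num
  calc _ ≤ (1 + 2 * |y|) ^ a * (Real.exp (-|y|) *
        (Real.exp (1 / 2) * Real.exp (-(1 / 2) * y ^ 2))) := by gcongr
    _ = ((1 + 2 * |y|) ^ a * Real.exp (-|y|)) *
        (Real.exp (1 / 2) * Real.exp (-(1 / 2) * y ^ 2)) := by ring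
    _ ≤ (2 ^ a * a.factorial * Real.exp (1 / 2)) *
        (Real.exp (1 / 2) * Real.exp (-(1 / 2) * y ^ 2)) := by gcongr
    _ = 2 ^ a * a.factorial * (Real.exp (1 / 2) * Real.exp (1 / 2)) *
        Real.exp (-(1 / 2) * y ^ 2) := by ring
    _ = _ := by rw [h5]

theorem exists_seminorm_one_add_pow_le (a : ℕ) : ∃ q : Seminorm ℂ 𝓢(ℝ, ℂ), Continuous q ∧
    ∀ (ψ : 𝓢(ℝ, ℂ)) (x : ℝ), (1 + |x|) ^ a * ‖ψ x‖ ≤ q ψ := by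
  set S := (Finset.Iic ((a, 0) : ℕ × ℕ)).sup (schwartzSeminormFamily ℂ ℝ ℂ) with hS
  have hc : Continuous S :=
    Seminorm.continuous_finsetSup fun i _ => (schwartz_withSeminorms ℂ ℝ ℂ).continuous_seminorm i
  refine ⟨((2 : ℝ≥0) ^ a) • S, ?_, fun ψ x => ?_⟩
  · exact hc.const_smul ((2 : ℝ≥0) ^ a)
  · have := SchwartzMap.one_add_le_sup_seminorm_apply (𝕜 := ℂ) (m := (a, 0)) (k := a) (n := 0)
      le_rfl le_rfl ψ x
    rw [norm_iteratedFDeriv_zero] at this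
    simpa using! this

theorem exists_seminorm_stft_le (b a : ℕ) : ∃ q : Seminorm ℂ 𝓢(ℝ, ℂ), Continuous q ∧
    ∀ (ψ : 𝓢(ℝ, ℂ)) (s ν : ℝ),
      (1 + |s|) ^ a * (1 + |ν|) ^ b * ‖stft (ψ : 𝓢'(ℝ, ℂ)) s ν‖ ≤ q ψ := by
  induction b generalizing a with
  | zero =>
    obtain ⟨q, hqc, hq⟩ := exists_seminorm_one_add_pow_le a
    have hI := integrable_one_add_abs_pow_mul_gaussian a
    set I := ∫ y : ℝ, (1 + |y|) ^ a * Real.exp (-y ^ 2) with hIdef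
    have hI0 : 0 ≤ I := integral_nonneg fun y => by positivity
    refine ⟨NNReal.mk I hI0 • q, hqc.const_smul (NNReal.mk I hI0), fun ψ s ν => ?_⟩
    have e : (NNReal.mk I hI0 • q) ψ = I * q ψ := rfl
    rw [e, pow_zero, mul_one, stft_coe]
    have hpos : 0 < (1 + |s|) ^ a := by positivity
    have h1 : ‖∫ x : ℝ, gaussAtomFun s ν x * ψ x‖ ≤
        ∫ x : ℝ, ((1 + |x - s|) ^ a * Real.exp (-(x - s) ^ 2)) * (((1 + |s|) ^ a)⁻¹ * q ψ) := by
      apply norm_integral_le_of_norm_le ((hI.comp_sub_right s).mul_const _)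
      refine Eventually.of_forall fun x => ?_
      rw [norm_mul, norm_gaussAtomFun]
      have h2 : (1 + |s|) ^ a * ‖ψ x‖ ≤ (1 + |x - s|) ^ a * q ψ := by
        have h3 : (1 + |s|) ^ a ≤ (1 + |x - s|) ^ a * (1 + |x|) ^ a := by
          rw [← mul_pow]
          gcongr
          have : |s| ≤ |x - s| + |x| := by
            have := abs_sub_abs_le_abs_sub s x
            rw [abs_sub_comm] at this
            linarith
          nlinarith [mul_nonneg (abs_nonneg (x - s)) (abs_nonneg x)]
        calc _ ≤ ((1 + |x - s|) ^ a * (1 + |x|) ^ a) * ‖ψ x‖ := by gcongr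
          _ = (1 + |x - s|) ^ a * ((1 + |x|) ^ a * ‖ψ x‖) := by ring
          _ ≤ _ := by gcongr; exact hq ψ x
      have h4 : ‖ψ x‖ ≤ ((1 + |s|) ^ a)⁻¹ * ((1 + |x - s|) ^ a * q ψ) := by
        rw [inv_mul_eq_div, le_div_iff₀ hpos, mul_comm]; exact h2
      calc _ ≤ Real.exp (-(x - s) ^ 2) * (((1 + |s|) ^ a)⁻¹ * ((1 + |x - s|) ^ a * q ψ)) := by
            gcongr
        _ = _ := by ring
    rw [integral_mul_const,
      integral_sub_right_eq_self (fun y : ℝ => (1 + |y|) ^ a * Real.exp (-y ^ 2)) s] at h1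
    calc _ ≤ (1 + |s|) ^ a * (I * (((1 + |s|) ^ a)⁻¹ * q ψ)) := by gcongr
      _ = _ := by field_simp
  | succ b ih =>
    obtain ⟨q, hqc, hq⟩ := ih a
    obtain ⟨q', hqc', hq'⟩ := ih (a + 1)
    refine ⟨q + q.comp lowering.toLinearMap + (2 : ℝ≥0) • q', ?_, fun ψ s ν => ?_⟩
    · exact (hqc.add (hqc.comp lowering.continuous)).add (hqc'.const_smul (2 : ℝ≥0))
    have e : (q + q.comp lowering.toLinearMap + (2 : ℝ≥0) • q') ψ =
      q ψ + q (lowering ψ) + 2 * q' ψ := rfl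
    rw [e]
    have h1 : |ν| * ‖stft (ψ : 𝓢'(ℝ, ℂ)) s ν‖ ≤ ‖stft (lowering ψ : 𝓢'(ℝ, ℂ)) s ν‖ +
        2 * |s| * ‖stft (ψ : 𝓢'(ℝ, ℂ)) s ν‖ := by
      have h2 := congrArg norm (stft_lowering ψ s ν)
      have h3 : ‖2 * (s : ℂ) * stft (ψ : 𝓢'(ℝ, ℂ)) s ν‖ =
          2 * |s| * ‖stft (ψ : 𝓢'(ℝ, ℂ)) s ν‖ := by simp
      have h4 : ‖2 * Real.pi * ν * Complex.I * stft (ψ : 𝓢'(ℝ, ℂ)) s ν‖ =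
          2 * Real.pi * |ν| * ‖stft (ψ : 𝓢'(ℝ, ℂ)) s ν‖ := by
        simp [abs_of_pos Real.pi_pos]
      have h5 := norm_add_le (stft (lowering ψ : 𝓢'(ℝ, ℂ)) s ν)
        (2 * s * stft (ψ : 𝓢'(ℝ, ℂ)) s ν)
      rw [h4] at h2
      rw [← h2, h3] at h5
      have h6 : 1 * |ν| * ‖stft (ψ : 𝓢'(ℝ, ℂ)) s ν‖ ≤
          2 * Real.pi * |ν| * ‖stft (ψ : 𝓢'(ℝ, ℂ)) s ν‖ := by
        gcongr; nlinarith [Real.pi_gt_three]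
      linarith
    set V := ‖stft (ψ : 𝓢'(ℝ, ℂ)) s ν‖
    have hV : 0 ≤ V := norm_nonneg _
    calc (1 + |s|) ^ a * (1 + |ν|) ^ (b + 1) * V
        = (1 + |s|) ^ a * (1 + |ν|) ^ b * (V + |ν| * V) := by ring
      _ ≤ (1 + |s|) ^ a * (1 + |ν|) ^ b *
          (V + (‖stft (lowering ψ : 𝓢'(ℝ, ℂ)) s ν‖ + 2 * (1 + |s|) * V)) := by
          have : 2 * |s| * V ≤ 2 * (1 + |s|) * V := by gcongr; linarith
          gcongr
          linarith
      _ = (1 + |s|) ^ a * (1 + |ν|) ^ b * V +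
          (1 + |s|) ^ a * (1 + |ν|) ^ b * ‖stft (lowering ψ : 𝓢'(ℝ, ℂ)) s ν‖ +
          2 * ((1 + |s|) ^ (a + 1) * (1 + |ν|) ^ b * V) := by ring
      _ ≤ _ := by
          gcongr
          · exact hq ψ s ν
          · exact hq _ s ν
          · exact hq' ψ s ν

/-- An integrable majorant on the line with polynomial decay. -/
def polyDecay (x : ℝ) : ℝ := ((1 + |x|) ^ 2)⁻¹

theorem polyDecay_pos (x : ℝ) : 0 < polyDecay x := by unfold polyDecay; positivity

theorem polyDecay_le_one (x : ℝ) : polyDecay x ≤ 1 := by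
  unfold polyDecay
  apply inv_le_one_of_one_le₀
  apply one_le_pow₀
  linarith [abs_nonneg x]

theorem continuous_polyDecay : Continuous polyDecay := by
  unfold polyDecay
  refine Continuous.inv₀ (by fun_prop) fun x => by positivity

theorem integrable_polyDecay : Integrable polyDecay := by
  have h := integrable_one_add_norm (E := ℝ) (μ := volume) (r := 2) (by simp)
  refine h.congr (Eventually.of_forall fun x => ?_)
  simp only [polyDecay, Real.norm_eq_abs]
  rw [Real.rpow_neg (by positivity)]
  norm_cast

theorem exists_seminorm_stft_le_polyDecay : ∃ q : Seminorm ℂ 𝓢(ℝ, ℂ), Continuous q ∧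
    ∀ (ψ : 𝓢(ℝ, ℂ)) (s ν : ℝ),
      (1 + |ν|) * ‖stft (ψ : 𝓢'(ℝ, ℂ)) s ν‖ ≤ q ψ * (polyDecay s * polyDecay ν) := by
  obtain ⟨q, hc, hq⟩ := exists_seminorm_stft_le 3 2
  refine ⟨q, hc, fun ψ s ν => ?_⟩
  have h := hq ψ s ν
  unfold polyDecay
  rw [← mul_inv, ← div_eq_mul_inv, le_div_iff₀ (by positivity)]
  linarith

theorem norm_stft_le_of_decay {q : Seminorm ℂ 𝓢(ℝ, ℂ)} (hq : ∀ (ψ : 𝓢(ℝ, ℂ)) (s ν : ℝ),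
      (1 + |ν|) * ‖stft (ψ : 𝓢'(ℝ, ℂ)) s ν‖ ≤ q ψ * (polyDecay s * polyDecay ν))
    (ψ : 𝓢(ℝ, ℂ)) (s ν : ℝ) :
    ‖stft (ψ : 𝓢'(ℝ, ℂ)) s ν‖ ≤ q ψ * (polyDecay s * polyDecay ν) := by
  refine le_trans ?_ (hq ψ s ν)
  nlinarith [mul_nonneg (abs_nonneg ν) (norm_nonneg (stft (ψ : 𝓢'(ℝ, ℂ)) s ν))]

theorem integrable_polyDecay_prod :
    Integrable (fun z : ℝ × ℝ => polyDecay z.1 * polyDecay z.2) :=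
  integrable_polyDecay.mul_prod integrable_polyDecay

theorem integrable_one_add_mul_norm_stft (ψ : 𝓢(ℝ, ℂ)) :
    Integrable fun z : ℝ × ℝ => (1 + |z.2|) * ‖stft (ψ : 𝓢'(ℝ, ℂ)) z.1 z.2‖ := by
  obtain ⟨q, _, hq⟩ := exists_seminorm_stft_le_polyDecay
  refine (integrable_polyDecay_prod.const_mul (q ψ)).mono' ?_ (Eventually.of_forall fun z => ?_)
  · have := continuous_stft (ψ : 𝓢'(ℝ, ℂ))
    exact Continuous.aestronglyMeasurable (by fun_prop)
  · rw [Real.norm_of_nonneg (by positivity)]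
    exact hq ψ z.1 z.2

theorem integrable_stft (ψ : 𝓢(ℝ, ℂ)) :
    Integrable fun z : ℝ × ℝ => stft (ψ : 𝓢'(ℝ, ℂ)) z.1 z.2 := by
  refine (integrable_one_add_mul_norm_stft ψ).mono'
    (continuous_stft (ψ : 𝓢'(ℝ, ℂ))).aestronglyMeasurable (Eventually.of_forall fun z => ?_)
  nlinarith [mul_nonneg (abs_nonneg z.2) (norm_nonneg (stft (ψ : 𝓢'(ℝ, ℂ)) z.1 z.2))]

theorem exists_seminorm_integral_norm_stft_le : ∃ q : Seminorm ℂ 𝓢(ℝ, ℂ), Continuous q ∧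
    ∀ ψ : 𝓢(ℝ, ℂ), ∫ z : ℝ × ℝ, ‖stft (ψ : 𝓢'(ℝ, ℂ)) z.1 z.2‖ ≤ q ψ := by
  obtain ⟨q, hc, hq⟩ := exists_seminorm_stft_le_polyDecay
  have hI0 : 0 ≤ ∫ z : ℝ × ℝ, polyDecay z.1 * polyDecay z.2 :=
    integral_nonneg fun z => mul_nonneg (polyDecay_pos _).le (polyDecay_pos _).le
  refine ⟨NNReal.mk _ hI0 • q, hc.const_smul (NNReal.mk _ hI0), fun ψ => ?_⟩
  have e : (NNReal.mk _ hI0 • q) ψ = (∫ z : ℝ × ℝ, polyDecay z.1 * polyDecay z.2) * q ψ := rfl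
  rw [e, mul_comm, ← integral_const_mul]
  exact integral_mono (integrable_stft ψ).norm (integrable_polyDecay_prod.const_mul _)
    fun z => norm_stft_le_of_decay hq ψ z.1 z.2

/-! ### Inversion -/

theorem continuous_phaseAtom : Continuous fun p : (ℝ × ℝ) × ℝ => phaseAtom p.1 p.2 := by
  unfold phaseAtom gaussAtomFun
  fun_prop

theorem norm_phaseAtom (z : ℝ × ℝ) (x : ℝ) : ‖phaseAtom z x‖ = Real.exp (-(x - z.1) ^ 2) :=
  norm_gaussAtomFun _ _ _

theorem norm_phaseAtom_le_one (z : ℝ × ℝ) (x : ℝ) : ‖phaseAtom z x‖ ≤ 1 := by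
  rw [norm_phaseAtom]
  exact Real.exp_le_one_iff.mpr (by nlinarith [sq_nonneg (x - z.1)])

theorem integral_stft_mul_character (ψ : 𝓢(ℝ, ℂ)) (s x : ℝ) :
    ∫ ν : ℝ, stft (ψ : 𝓢'(ℝ, ℂ)) s ν * phaseAtom (s, ν) x =
      ψ x * Real.exp (-2 * (x - s) ^ 2) := by
  obtain ⟨q, _, hq⟩ := exists_seminorm_stft_le_polyDecay
  set h : ℝ → ℂ := fun y => ψ y * Complex.exp (-((y - s : ℝ) : ℂ) ^ 2) with hh
  have hF : ∀ ν : ℝ, FourierTransform.fourier h ν = stft (ψ : 𝓢'(ℝ, ℂ)) s ν := by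
    intro ν
    rw [Real.fourier_real_eq_integral_exp_smul, stft_coe]
    apply integral_congr_ae
    refine Eventually.of_forall fun y => ?_
    simp only [hh, gaussAtomFun, smul_eq_mul]
    have : ((-2 * Real.pi * y * ν : ℝ) : ℂ) * Complex.I = -(2 * Real.pi * ν * y * Complex.I) := by
      push_cast; ring
    rw [this]
    ring
  have hc : Continuous h := by
    have := ψ.continuous
    fun_prop
  have hi : Integrable h := by
    refine (ψ.integrable (μ := volume)).norm.mono' hc.aestronglyMeasurable
      (Eventually.of_forall fun y => ?_)
    have := norm_phaseAtom_le_one (s, 0) y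
    simp only [phaseAtom, gaussAtomFun] at this
    simp only [hh, norm_mul]
    have h2 := mul_le_mul_of_nonneg_left this (norm_nonneg (ψ y))
    simpa using h2
  have hFi : Integrable (FourierTransform.fourier h) := by
    have hFeq : FourierTransform.fourier h = fun ν => stft (ψ : 𝓢'(ℝ, ℂ)) s ν := funext hF
    rw [hFeq]
    refine (integrable_polyDecay.const_mul (q ψ)).mono' ?_ (Eventually.of_forall fun ν => ?_)
    · have := continuous_stft (ψ : 𝓢'(ℝ, ℂ))
      exact (this.comp (continuous_const.prodMk continuous_id)).aestronglyMeasurable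
    · refine (norm_stft_le_of_decay hq ψ s ν).trans ?_
      gcongr
      calc polyDecay s * polyDecay ν ≤ 1 * polyDecay ν := by
            gcongr
            · exact (polyDecay_pos _).le
            · exact polyDecay_le_one s
        _ = _ := one_mul _
  have hinv := congrFun (hc.fourierInv_fourier_eq hi hFi) x
  rw [Real.fourierInv_eq'] at hinv
  have h3 : ∀ ν : ℝ, stft (ψ : 𝓢'(ℝ, ℂ)) s ν * phaseAtom (s, ν) x =
      (Complex.exp (((2 * Real.pi * inner ℝ ν x : ℝ) : ℂ) * Complex.I) •
        FourierTransform.fourier h ν) * Complex.exp (-((x - s : ℝ) : ℂ) ^ 2) := by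
    intro ν
    rw [hF]
    simp only [phaseAtom, gaussAtomFun, smul_eq_mul]
    have : ((2 * Real.pi * inner ℝ ν x : ℝ) : ℂ) * Complex.I =
        -(2 * Real.pi * ((-ν : ℝ) : ℂ) * x * Complex.I) := by
      simp; ring
    rw [this]
    ring
  simp_rw [h3]
  rw [integral_mul_const, hinv]
  simp only [hh]
  rw [mul_assoc, ← Complex.exp_add]
  congr 1
  push_cast
  congr 1
  ring

theorem integrable_stft_mul_phaseAtom (ψ : 𝓢(ℝ, ℂ)) (x : ℝ) :
    Integrable fun z : ℝ × ℝ => stft (ψ : 𝓢'(ℝ, ℂ)) z.1 z.2 * phaseAtom z x := by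
  refine (integrable_stft ψ).norm.mono' ?_ (Eventually.of_forall fun z => ?_)
  · have h1 := continuous_stft (ψ : 𝓢'(ℝ, ℂ))
    have h2 := continuous_phaseAtom
    exact (h1.mul (h2.comp (continuous_id.prodMk continuous_const))).aestronglyMeasurable
  · rw [norm_mul]
    exact mul_le_of_le_one_right (norm_nonneg _) (norm_phaseAtom_le_one z x)

theorem integral_stft_mul_phaseAtom (ψ : 𝓢(ℝ, ℂ)) (x : ℝ) :
    ∫ z : ℝ × ℝ, stft (ψ : 𝓢'(ℝ, ℂ)) z.1 z.2 * phaseAtom z x =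
      Real.sqrt (Real.pi / 2) * ψ x := by
  have hi := integrable_stft_mul_phaseAtom ψ x
  rw [Measure.volume_eq_prod] at hi ⊢
  rw [integral_prod _ hi]
  simp_rw [integral_stft_mul_character]
  rw [integral_const_mul, mul_comm]
  congr 1
  rw [integral_complex_ofReal, integral_sub_left_eq_self (fun s : ℝ => Real.exp (-2 * s ^ 2)),
    integral_gaussian]

section

/-! ### Hölder's inequality in the form needed for mixed norms -/

theorem lintegral_mul_le_essSup {α : Type*} [MeasurableSpace α] (μ : Measure α)
    {f : α → ℝ≥0∞} (hf : AEMeasurable f μ) (g : α → ℝ≥0∞) :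
    ∫⁻ x, f x * g x ∂μ ≤ eLpNorm f 1 μ * eLpNorm g ∞ μ := by
  rw [eLpNorm_one_eq_lintegral_enorm, eLpNorm_exponent_top, eLpNormEssSup]
  simp only [enorm_eq_self]
  rw [← lintegral_mul_const'' _ hf]
  apply lintegral_mono_ae
  filter_upwards [ENNReal.ae_le_essSup g] with x hx
  gcongr

theorem lintegral_mul_le_eLpNorm_mul_eLpNorm {α : Type*} [MeasurableSpace α] {μ : Measure α}
    {p q : ℝ≥0∞} (hpq : ENNReal.HolderConjugate p q) {f g : α → ℝ≥0∞} (hf : AEMeasurable f μ)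
    (hg : AEMeasurable g μ) : ∫⁻ x, f x * g x ∂μ ≤ eLpNorm f p μ * eLpNorm g q μ := by
  by_cases hp : p = ∞
  · have hq : q = 1 := (ENNReal.HolderConjugate.eq_top_iff_eq_one p q).mp hp
    subst hp hq
    simp_rw [mul_comm (f _)]
    rw [mul_comm]
    exact lintegral_mul_le_essSup μ hg f
  by_cases hq : q = ∞
  · have hp' : p = 1 := (ENNReal.HolderConjugate.eq_top_iff_eq_one q p).mp hq
    subst hq hp'
    exact lintegral_mul_le_essSup μ hf g
  have h := ENNReal.HolderConjugate.toReal_of_ne_top (p := p) (q := q) hp hq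
  rw [eLpNorm_eq_lintegral_rpow_enorm_toReal (ENNReal.HolderConjugate.ne_zero p q) hp,
    eLpNorm_eq_lintegral_rpow_enorm_toReal (ENNReal.HolderConjugate.ne_zero q p) hq]
  exact ENNReal.lintegral_mul_le_Lp_mul_Lq μ h hf hg

theorem eLpNorm_comp_mul_sub_le (p : ℝ≥0∞) {B : ℝ → ℝ≥0∞} (hB : Measurable B) {c : ℝ}
    (hc : 1 ≤ |c|) (z : ℝ) : eLpNorm (fun x => B (c * x - z)) p volume ≤ eLpNorm B p volume := by
  have hc0 : c ≠ 0 := by rintro rfl; simp at hc; linarith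
  have h1 : eLpNorm (fun x => B (c * x - z)) p volume =
      eLpNorm (fun y => B (y - z)) p (Measure.map (fun x => c * x) volume) := by
    rw [eLpNorm_map_measure]
    · rfl
    · exact (hB.comp (measurable_id.sub_const z)).aestronglyMeasurable
    · exact (measurable_const_mul c).aemeasurable
  have h2 : eLpNorm (fun y => B (y - z)) p volume = eLpNorm B p volume :=
    eLpNorm_comp_measurePreserving (g := B) (f := fun y => y - z) hB.aestronglyMeasurable
      (measurePreserving_sub_right volume z)
  rw [h1, Real.map_volume_mul_left hc0, ← h2]
  apply eLpNorm_mono_measure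
  refine Measure.le_iff.mpr fun s _ => ?_
  rw [Measure.smul_apply, smul_eq_mul]
  refine mul_le_of_le_one_left zero_le ?_
  rw [ENNReal.ofReal_le_one, abs_inv]
  exact inv_le_one_of_one_le₀ hc

theorem lintegral_lintegral_mul_kernel_le {p q : ℝ≥0∞} (hpq : ENNReal.HolderConjugate p q)
    {A B K : ℝ → ℝ≥0∞} (hA : Measurable A) (hB : Measurable B) (hK : Measurable K) {c : ℝ}
    (hc : 1 ≤ |c|) : ∫⁻ x, ∫⁻ y, A x * B y * K (c * x - y) ≤
      (∫⁻ x, K x) * (eLpNorm A p volume * eLpNorm B q volume) := by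
  have h1 : ∀ x, ∫⁻ y, A x * B y * K (c * x - y) = ∫⁻ z, A x * B (c * x - z) * K z := by
    intro x
    rw [← lintegral_sub_left_eq_self (fun z => A x * B (c * x - z) * K z) (c * x)]
    simp
  simp_rw [h1]
  rw [lintegral_lintegral_swap (by fun_prop), ← lintegral_mul_const _ hK]
  apply lintegral_mono
  intro z
  dsimp only
  rw [lintegral_mul_const _ (by fun_prop), mul_comm]
  gcongr
  refine (lintegral_mul_le_eLpNorm_mul_eLpNorm hpq hA.aemeasurable (by fun_prop)).trans ?_
  gcongr
  exact eLpNorm_comp_mul_sub_le q hB hc z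

/-- Hölder's inequality with respect to a weight. -/
theorem lintegral_mul_rpow_le {α : Type*} [MeasurableSpace α] {μ : Measure α} {r : ℝ} (hr : 1 < r)
    {Ω k : α → ℝ≥0∞} (hΩ : Measurable Ω) (hk : Measurable k) :
    (∫⁻ x, Ω x * k x ∂μ) ^ r ≤ (∫⁻ x, Ω x ∂μ) ^ (r - 1) * ∫⁻ x, Ω x * k x ^ r ∂μ := by
  have hc := Real.HolderConjugate.conjExponent hr
  set r' := Real.conjExponent r with hr'
  have h0 : 0 < r := by linarith
  have h0' : 0 < r' := hc.symm.pos
  have hsum : 1 / r' + 1 / r = 1 := by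
    have := hc.inv_add_inv_eq_one
    rw [one_div, one_div, add_comm]; exact this
  have h1 := ENNReal.lintegral_mul_le_Lp_mul_Lq μ hc.symm
    (f := fun x => Ω x ^ (1 / r')) (g := fun x => Ω x ^ (1 / r) * k x)
    (by fun_prop) (by fun_prop)
  have e1 : ∀ x, ((fun x => Ω x ^ (1 / r')) * fun x => Ω x ^ (1 / r) * k x) x = Ω x * k x := by
    intro x
    simp only [Pi.mul_apply]
    rw [← mul_assoc, ← ENNReal.rpow_add_of_nonneg _ _ (by positivity) (by positivity), hsum,
      ENNReal.rpow_one]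
  have e2 : ∀ x, (Ω x ^ (1 / r')) ^ r' = Ω x := by
    intro x
    rw [← ENNReal.rpow_mul, one_div_mul_cancel h0'.ne', ENNReal.rpow_one]
  have e3 : ∀ x, (Ω x ^ (1 / r) * k x) ^ r = Ω x * k x ^ r := by
    intro x
    rw [ENNReal.mul_rpow_of_nonneg _ _ h0.le, ← ENNReal.rpow_mul, one_div_mul_cancel h0.ne',
      ENNReal.rpow_one]
  simp only [e1, e2, e3] at h1
  calc _ ≤ ((∫⁻ x, Ω x ∂μ) ^ (1 / r') * (∫⁻ x, Ω x * k x ^ r ∂μ) ^ (1 / r)) ^ r := by gcongr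
    _ = _ := by
      rw [ENNReal.mul_rpow_of_nonneg _ _ h0.le, ← ENNReal.rpow_mul, ← ENNReal.rpow_mul,
        one_div_mul_cancel h0.ne', ENNReal.rpow_one]
      congr 2
      have : 1 / r' = 1 - 1 / r := by linarith
      rw [this]
      field_simp

/-! ### The Gaussian weights -/

/-- The Gaussian weight in the time variables. -/
def timeGauss (x : ℝ) : ℝ≥0∞ := ENNReal.ofReal (Real.exp (-(x ^ 2 / 40)))

/-- The Gaussian weight in the frequency variables. -/
def freqGauss (x : ℝ) : ℝ≥0∞ := ENNReal.ofReal (Real.exp (-x ^ 2))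

@[fun_prop]
theorem measurable_timeGauss : Measurable timeGauss := by
  unfold timeGauss; fun_prop

@[fun_prop]
theorem measurable_freqGauss : Measurable freqGauss := by
  unfold freqGauss; fun_prop

theorem lintegral_ofReal_gaussian_lt_top {b : ℝ} (hb : 0 < b) :
    ∫⁻ x : ℝ, ENNReal.ofReal (Real.exp (-b * x ^ 2)) < ∞ :=
  (integrable_exp_neg_mul_sq hb).lintegral_lt_top

theorem lintegral_timeGauss_lt_top : ∫⁻ x, timeGauss x < ∞ := by
  refine lt_of_eq_of_lt (lintegral_congr fun x => ?_)
    (lintegral_ofReal_gaussian_lt_top (b := 1 / 40) (by norm_num))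
  unfold timeGauss
  congr 2; ring

theorem lintegral_freqGauss_lt_top : ∫⁻ x, freqGauss x < ∞ := by
  refine lt_of_eq_of_lt (lintegral_congr fun x => ?_)
    (lintegral_ofReal_gaussian_lt_top (b := 1) one_pos)
  unfold freqGauss
  congr 2; ring

theorem eLpNorm_timeGauss_lt_top {p : ℝ≥0∞} (hp : 1 ≤ p) : eLpNorm timeGauss p volume < ∞ := by
  have hle : ∀ x, timeGauss x ≤ 1 := fun x => by
    unfold timeGauss
    rw [ENNReal.ofReal_le_one, Real.exp_le_one_iff]
    have : 0 ≤ x ^ 2 / 40 := by positivity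
    linarith
  by_cases h : p = ∞
  · rw [h, eLpNorm_exponent_top]
    refine lt_of_le_of_lt (essSup_le_of_ae_le 1 (Eventually.of_forall fun x => ?_))
      ENNReal.one_lt_top
    simpa using hle x
  · have hp0 : p ≠ 0 := (zero_lt_one.trans_le hp).ne'
    rw [eLpNorm_eq_lintegral_rpow_enorm_toReal hp0 h]
    have hr : 1 ≤ p.toReal := by
      have := ENNReal.toReal_mono h hp
      simpa using this
    refine ENNReal.rpow_lt_top_of_nonneg (by positivity) (ne_of_lt ?_)
    refine lt_of_le_of_lt (lintegral_mono fun x => ?_) lintegral_timeGauss_lt_top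
    simp only [enorm_eq_self]
    calc timeGauss x ^ p.toReal ≤ timeGauss x ^ (1 : ℝ) :=
          ENNReal.rpow_le_rpow_of_exponent_ge (hle x) hr
      _ = _ := ENNReal.rpow_one _

theorem lintegral_mul_timeGauss_le {p q : ℝ≥0∞} (hpq : ENNReal.HolderConjugate p q)
    {F : ℝ → ℝ≥0∞} (hF : Measurable F) (c : ℝ) : ∫⁻ x, F x * timeGauss (x + c) ≤
      eLpNorm timeGauss q volume * eLpNorm F p volume := by
  refine (lintegral_mul_le_eLpNorm_mul_eLpNorm hpq hF.aemeasurable (by fun_prop)).trans ?_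
  rw [mul_comm]
  gcongr
  have := eLpNorm_comp_mul_sub_le q measurable_timeGauss (c := 1) (by simp) (-c)
  simpa using this

/-! ### The estimates in the time variables -/

variable {p q p₁ q₁ : ℝ≥0∞} {F₁ F₂ F₃ κ : ℝ → ℝ≥0∞}

theorem lintegral_time_le (hpq : ENNReal.HolderConjugate p q)
    (hpq₁ : ENNReal.HolderConjugate p₁ q₁) (h₁ : Measurable F₁) (h₂ : Measurable F₂)
    (h₃ : Measurable F₃) (s : ℝ) :
    ∫⁻ s₂, ∫⁻ s₃, ∫⁻ s₁, F₁ s₁ * F₂ s₂ * F₃ s₃ *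
      (timeGauss (s₁ - s + (s₃ - s₂)) * timeGauss (s₂ - s - (s₃ - s₂))) ≤
    (eLpNorm timeGauss q₁ volume * ∫⁻ x, timeGauss x) *
      (eLpNorm F₁ p₁ volume * eLpNorm F₂ p volume * eLpNorm F₃ q volume) := by
  have h1 : ∀ s₂ s₃ : ℝ, ∫⁻ s₁, F₁ s₁ * F₂ s₂ * F₃ s₃ *
      (timeGauss (s₁ - s + (s₃ - s₂)) * timeGauss (s₂ - s - (s₃ - s₂))) ≤
      (F₂ s₂ * F₃ s₃ * timeGauss ((2 * s₂ - s₃) - s)) *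
        (eLpNorm timeGauss q₁ volume * eLpNorm F₁ p₁ volume) := by
    intro s₂ s₃
    refine le_trans (le_of_eq ?_) (mul_le_mul_right
      (lintegral_mul_timeGauss_le hpq₁ h₁ (s₃ - s₂ - s)) _)
    rw [← lintegral_const_mul _ (by fun_prop)]
    apply lintegral_congr
    intro s₁
    have e1 : s₁ - s + (s₃ - s₂) = s₁ + (s₃ - s₂ - s) := by ring
    have e2 : s₂ - s - (s₃ - s₂) = (2 * s₂ - s₃) - s := by ring
    rw [e1, e2]
    ring
  calc _ ≤ ∫⁻ s₂, ∫⁻ s₃, (F₂ s₂ * F₃ s₃ * timeGauss ((2 * s₂ - s₃) - s)) *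
        (eLpNorm timeGauss q₁ volume * eLpNorm F₁ p₁ volume) :=
        lintegral_mono fun s₂ => lintegral_mono fun s₃ => h1 s₂ s₃
    _ = (∫⁻ s₂, ∫⁻ s₃, F₂ s₂ * F₃ s₃ * timeGauss ((2 * s₂ - s₃) - s)) *
        (eLpNorm timeGauss q₁ volume * eLpNorm F₁ p₁ volume) := by
        rw [← lintegral_mul_const _ (by fun_prop)]
        refine lintegral_congr fun s₂ => ?_
        rw [lintegral_mul_const _ (by fun_prop)]
    _ ≤ ((∫⁻ x, timeGauss (x - s)) * (eLpNorm F₂ p volume * eLpNorm F₃ q volume)) *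
        (eLpNorm timeGauss q₁ volume * eLpNorm F₁ p₁ volume) := by
        gcongr
        exact lintegral_lintegral_mul_kernel_le hpq h₂ h₃ (K := fun x => timeGauss (x - s))
          (by fun_prop) (c := 2) (by norm_num)
    _ = _ := by
        rw [lintegral_sub_right_eq_self timeGauss s]
        ring

theorem lintegral_time_kernel_le (hpq : ENNReal.HolderConjugate p q)
    (hpq₁ : ENNReal.HolderConjugate p₁ q₁) (h₁ : Measurable F₁) (h₂ : Measurable F₂)
    (h₃ : Measurable F₃) (hκ : Measurable κ) :
    ∫⁻ s₂, ∫⁻ s₃, ∫⁻ s₁, ∫⁻ s, F₁ s₁ * F₂ s₂ * F₃ s₃ *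
      (timeGauss (s₁ - s + (s₃ - s₂)) * timeGauss (s₂ - s - (s₃ - s₂))) * κ (s₃ - s₂) ≤
    (eLpNorm timeGauss q₁ volume * (∫⁻ x, timeGauss x) * ∫⁻ x, κ x) *
      (eLpNorm F₁ p₁ volume * eLpNorm F₂ p volume * eLpNorm F₃ q volume) := by
  have h1 : ∀ s₂ s₃ : ℝ, ∫⁻ s₁, ∫⁻ s, F₁ s₁ * F₂ s₂ * F₃ s₃ *
      (timeGauss (s₁ - s + (s₃ - s₂)) * timeGauss (s₂ - s - (s₃ - s₂))) * κ (s₃ - s₂) ≤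
      (F₂ s₂ * F₃ s₃ * κ (-(1 * s₂ - s₃))) *
        (eLpNorm timeGauss q₁ volume * eLpNorm F₁ p₁ volume * ∫⁻ x, timeGauss x) := by
    intro s₂ s₃
    rw [lintegral_lintegral_swap (by fun_prop)]
    calc _ = ∫⁻ s, (F₂ s₂ * F₃ s₃ * κ (-(1 * s₂ - s₃))) *
          ((∫⁻ s₁, F₁ s₁ * timeGauss (s₁ + (s₃ - s₂ - s))) * timeGauss ((2 * s₂ - s₃) - s)) := by
          refine lintegral_congr fun s => ?_
          rw [← lintegral_mul_const _ (by fun_prop), ← lintegral_const_mul _ (by fun_prop)]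
          refine lintegral_congr fun s₁ => ?_
          have e1 : s₁ - s + (s₃ - s₂) = s₁ + (s₃ - s₂ - s) := by ring
          have e2 : s₂ - s - (s₃ - s₂) = (2 * s₂ - s₃) - s := by ring
          have e3 : -(1 * s₂ - s₃) = s₃ - s₂ := by ring
          rw [e1, e2, e3]
          ring
      _ ≤ ∫⁻ s, (F₂ s₂ * F₃ s₃ * κ (-(1 * s₂ - s₃))) *
          ((eLpNorm timeGauss q₁ volume * eLpNorm F₁ p₁ volume) *
            timeGauss ((2 * s₂ - s₃) - s)) := by
          refine lintegral_mono fun s => ?_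
          dsimp only
          gcongr
          exact lintegral_mul_timeGauss_le hpq₁ h₁ _
      _ = _ := by
          rw [lintegral_const_mul _ (by fun_prop), lintegral_const_mul _ (by fun_prop),
            lintegral_sub_left_eq_self timeGauss]
  calc _ ≤ ∫⁻ s₂, ∫⁻ s₃, (F₂ s₂ * F₃ s₃ * κ (-(1 * s₂ - s₃))) *
        (eLpNorm timeGauss q₁ volume * eLpNorm F₁ p₁ volume * ∫⁻ x, timeGauss x) :=
        lintegral_mono fun s₂ => lintegral_mono fun s₃ => h1 s₂ s₃
    _ = (∫⁻ s₂, ∫⁻ s₃, F₂ s₂ * F₃ s₃ * κ (-(1 * s₂ - s₃))) *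
        (eLpNorm timeGauss q₁ volume * eLpNorm F₁ p₁ volume * ∫⁻ x, timeGauss x) := by
        rw [← lintegral_mul_const _ (by fun_prop)]
        refine lintegral_congr fun s₂ => ?_
        rw [lintegral_mul_const _ (by fun_prop)]
    _ ≤ ((∫⁻ x, κ (-x)) * (eLpNorm F₂ p volume * eLpNorm F₃ q volume)) *
        (eLpNorm timeGauss q₁ volume * eLpNorm F₁ p₁ volume * ∫⁻ x, timeGauss x) := by
        gcongr
        exact lintegral_lintegral_mul_kernel_le hpq h₂ h₃ (K := fun x => κ (-x))
          (by fun_prop) (c := 1) (by norm_num)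
    _ = _ := by
        rw [lintegral_neg_eq_self κ]
        ring

/-! ### The estimate in the frequency variables -/

theorem lintegral_freq_le (hpq : ENNReal.HolderConjugate p q) (h₁ : Measurable F₁)
    (h₂ : Measurable F₂) (h₃ : Measurable F₃) (ν : ℝ) :
    ∫⁻ ν₂, ∫⁻ ν₃, ∫⁻ ν₁, F₁ ν₁ * F₂ ν₂ * F₃ ν₃ * freqGauss (ν + ν₁ + ν₂ + ν₃) ≤
    (∫⁻ x, freqGauss x) * (eLpNorm F₁ 1 volume * eLpNorm F₂ p volume * eLpNorm F₃ q volume) := by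
  set K : ℝ → ℝ≥0∞ := fun x => ∫⁻ ν₁, F₁ ν₁ * freqGauss ((ν + ν₁) - x) with hK
  have hKm : Measurable K := by fun_prop
  have h4 : ∫⁻ x, K x = (∫⁻ x, freqGauss x) * eLpNorm F₁ 1 volume := by
    rw [hK, lintegral_lintegral_swap (by fun_prop), eLpNorm_one_eq_lintegral_enorm]
    simp only [enorm_eq_self]
    rw [← lintegral_const_mul _ h₁]
    refine lintegral_congr fun ν₁ => ?_
    rw [lintegral_const_mul _ (by fun_prop), lintegral_sub_left_eq_self freqGauss, mul_comm]
  calc _ = ∫⁻ ν₂, ∫⁻ ν₃, F₂ ν₂ * F₃ ν₃ * K (-1 * ν₂ - ν₃) := by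
        refine lintegral_congr fun ν₂ => lintegral_congr fun ν₃ => ?_
        rw [hK, ← lintegral_const_mul _ (by fun_prop)]
        refine lintegral_congr fun ν₁ => ?_
        have : ν + ν₁ - (-1 * ν₂ - ν₃) = ν + ν₁ + ν₂ + ν₃ := by ring
        rw [this]
        ring
    _ ≤ (∫⁻ x, K x) * (eLpNorm F₂ p volume * eLpNorm F₃ q volume) :=
        lintegral_lintegral_mul_kernel_le hpq h₂ h₃ hKm (c := -1) (by norm_num)
    _ = _ := by rw [h4]; ring

/-! ### Reordering of the integrals -/

theorem lintegral_phase_space_eq {F : (ℝ × ℝ) × (ℝ × ℝ) × (ℝ × ℝ) → ℝ≥0∞} (hF : Measurable F) :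
    ∫⁻ w, F w = ∫⁻ ν₂, ∫⁻ ν₃, ∫⁻ ν₁, ∫⁻ s₂, ∫⁻ s₃, ∫⁻ s₁,
      F ((s₁, ν₁), (s₂, ν₂), (s₃, ν₃)) := by
  have e : ∀ G : ℝ × ℝ → ℝ≥0∞, Measurable G → ∫⁻ z, G z = ∫⁻ ν, ∫⁻ s, G (s, ν) := fun G hG => by
    rw [Measure.volume_eq_prod]; exact lintegral_prod_symm' G hG
  rw [Measure.volume_eq_prod, lintegral_prod_symm' F hF, Measure.volume_eq_prod,
    lintegral_prod _ (by fun_prop), e _ (by fun_prop)]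
  refine lintegral_congr fun ν₂ => ?_
  calc _ = ∫⁻ s₂, ∫⁻ ν₃, ∫⁻ ν₁, ∫⁻ s₃, ∫⁻ s₁, F ((s₁, ν₁), (s₂, ν₂), (s₃, ν₃)) := by
        refine lintegral_congr fun s₂ => ?_
        rw [e _ (by fun_prop)]
        refine lintegral_congr fun ν₃ => ?_
        rw [lintegral_lintegral_swap (f := fun ν₁ s₃ => ∫⁻ s₁, F ((s₁, ν₁), (s₂, ν₂), (s₃, ν₃)))
          (by fun_prop)]
        refine lintegral_congr fun s₃ => ?_
        rw [e _ (by fun_prop)]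
    _ = ∫⁻ ν₃, ∫⁻ s₂, ∫⁻ ν₁, ∫⁻ s₃, ∫⁻ s₁, F ((s₁, ν₁), (s₂, ν₂), (s₃, ν₃)) :=
        lintegral_lintegral_swap (by fun_prop)
    _ = _ := lintegral_congr fun ν₃ => lintegral_lintegral_swap (by fun_prop)

end

section

/-! ### The weighted estimates on phase space -/

/-- The mixed norm `‖U‖_{L^q_ν(L^p_s)}` of a function on phase space. -/
def mixedNorm (p q : ℝ≥0∞) (U : ℝ × ℝ → ℝ≥0∞) : ℝ≥0∞ :=
  eLpNorm (fun ν : ℝ => eLpNorm (fun s : ℝ => U (s, ν)) p volume) q volume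

theorem measurable_eLpNorm_section {p : ℝ≥0∞} (hp0 : p ≠ 0) (hp : p ≠ ∞) {U : ℝ × ℝ → ℝ≥0∞}
    (hU : Measurable U) : Measurable fun ν : ℝ => eLpNorm (fun s : ℝ => U (s, ν)) p volume := by
  simp_rw [eLpNorm_eq_lintegral_rpow_enorm_toReal hp0 hp, enorm_eq_self]
  fun_prop

/-- The product of three functions on phase space and of the Gaussian weight. -/
def phaseDensity (U₁ U₂ U₃ : ℝ × ℝ → ℝ≥0∞) (z : ℝ × ℝ) (w : (ℝ × ℝ) × (ℝ × ℝ) × (ℝ × ℝ)) : ℝ≥0∞ :=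
  U₁ w.1 * U₂ w.2.1 * U₃ w.2.2 * ENNReal.ofReal (phaseWeight z w)

theorem measurable_phaseWeight :
    Measurable fun p : (ℝ × ℝ) × (ℝ × ℝ) × (ℝ × ℝ) × (ℝ × ℝ) => phaseWeight p.1 p.2 := by
  unfold phaseWeight
  fun_prop

theorem measurable_phaseDensity {U₁ U₂ U₃ : ℝ × ℝ → ℝ≥0∞} (h₁ : Measurable U₁)
    (h₂ : Measurable U₂) (h₃ : Measurable U₃) :
    Measurable fun p : (ℝ × ℝ) × (ℝ × ℝ) × (ℝ × ℝ) × (ℝ × ℝ) =>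
      phaseDensity U₁ U₂ U₃ p.1 p.2 := by
  have := measurable_phaseWeight
  unfold phaseDensity
  fun_prop

theorem ofReal_phaseWeight (z : ℝ × ℝ) (w : (ℝ × ℝ) × (ℝ × ℝ) × (ℝ × ℝ)) :
    ENNReal.ofReal (phaseWeight z w) = freqGauss (z.2 + w.1.2 + w.2.1.2 + w.2.2.2) *
      (timeGauss (w.1.1 - z.1 + (w.2.2.1 - w.2.1.1)) *
        timeGauss (w.2.1.1 - z.1 - (w.2.2.1 - w.2.1.1))) := by
  unfold phaseWeight freqGauss timeGauss
  rw [ENNReal.ofReal_mul (Real.exp_pos _).le, ENNReal.ofReal_mul (Real.exp_pos _).le]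

variable {p p' q q' p₁ q₁ : ℝ≥0∞} {U₁ U₂ U₃ : ℝ × ℝ → ℝ≥0∞}

theorem lintegral_freq_mixed_le (hq : ENNReal.HolderConjugate q q')
    (hp0 : p ≠ 0) (hp : p ≠ ∞) (hp0' : p' ≠ 0) (hp' : p' ≠ ∞) (hp₁0 : p₁ ≠ 0) (hp₁ : p₁ ≠ ∞)
    (h₁ : Measurable U₁) (h₂ : Measurable U₂) (h₃ : Measurable U₃) (c : ℝ≥0∞) (ν : ℝ) :
    ∫⁻ ν₂, ∫⁻ ν₃, ∫⁻ ν₁, freqGauss (ν + ν₁ + ν₂ + ν₃) *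
      (c * (eLpNorm (fun s : ℝ => U₁ (s, ν₁)) p₁ volume *
        eLpNorm (fun s : ℝ => U₂ (s, ν₂)) p volume *
        eLpNorm (fun s : ℝ => U₃ (s, ν₃)) p' volume)) ≤
      (c * ∫⁻ x, freqGauss x) *
        (mixedNorm p₁ 1 U₁ * mixedNorm p q U₂ * mixedNorm p' q' U₃) := by
  have key : ∀ N₁ N₂ N₃ : ℝ → ℝ≥0∞, Measurable N₁ → Measurable N₂ → Measurable N₃ →
      ∫⁻ ν₂, ∫⁻ ν₃, ∫⁻ ν₁, freqGauss (ν + ν₁ + ν₂ + ν₃) * (c * (N₁ ν₁ * N₂ ν₂ * N₃ ν₃)) ≤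
      (c * ∫⁻ x, freqGauss x) *
        (eLpNorm N₁ 1 volume * eLpNorm N₂ q volume * eLpNorm N₃ q' volume) := by
    intro N₁ N₂ N₃ m₁ m₂ m₃
    calc _ = c * ∫⁻ ν₂, ∫⁻ ν₃, ∫⁻ ν₁, N₁ ν₁ * N₂ ν₂ * N₃ ν₃ * freqGauss (ν + ν₁ + ν₂ + ν₃) := by
          rw [← lintegral_const_mul _ (by fun_prop)]
          refine lintegral_congr fun ν₂ => ?_
          rw [← lintegral_const_mul _ (by fun_prop)]
          refine lintegral_congr fun ν₃ => ?_
          rw [← lintegral_const_mul _ (by fun_prop)]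
          refine lintegral_congr fun ν₁ => ?_
          ring
      _ ≤ c * ((∫⁻ x, freqGauss x) *
          (eLpNorm N₁ 1 volume * eLpNorm N₂ q volume * eLpNorm N₃ q' volume)) := by
          gcongr
          exact lintegral_freq_le hq m₁ m₂ m₃ ν
      _ = _ := by ring
  exact key _ _ _ (measurable_eLpNorm_section hp₁0 hp₁ h₁) (measurable_eLpNorm_section hp0 hp h₂)
    (measurable_eLpNorm_section hp0' hp' h₃)

theorem lintegral_phaseDensity_le (hp : ENNReal.HolderConjugate p p')
    (hq : ENNReal.HolderConjugate q q') (hpq₁ : ENNReal.HolderConjugate p₁ q₁) (hpt : p ≠ ∞)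
    (hpt' : p' ≠ ∞) (hpt₁ : p₁ ≠ ∞)
    (h₁ : Measurable U₁) (h₂ : Measurable U₂) (h₃ : Measurable U₃) (z : ℝ × ℝ) :
    ∫⁻ w, phaseDensity U₁ U₂ U₃ z w ≤
      (eLpNorm timeGauss q₁ volume * (∫⁻ x, timeGauss x) * ∫⁻ x, freqGauss x) *
        (mixedNorm p₁ 1 U₁ * mixedNorm p q U₂ * mixedNorm p' q' U₃) := by
  have hm := measurable_phaseDensity h₁ h₂ h₃
  rw [lintegral_phase_space_eq (by fun_prop)]
  refine le_trans ?_ (lintegral_freq_mixed_le hq (ENNReal.HolderConjugate.ne_zero p p') hpt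
    (ENNReal.HolderConjugate.ne_zero p' p) hpt' (ENNReal.HolderConjugate.ne_zero p₁ q₁) hpt₁
    h₁ h₂ h₃ _ z.2)
  refine lintegral_mono fun ν₂ => lintegral_mono fun ν₃ => lintegral_mono fun ν₁ => ?_
  have h := lintegral_time_le hp hpq₁ (F₁ := fun s => U₁ (s, ν₁)) (F₂ := fun s => U₂ (s, ν₂))
    (F₃ := fun s => U₃ (s, ν₃)) (by fun_prop) (by fun_prop) (by fun_prop) z.1
  refine le_trans (le_of_eq ?_) (mul_le_mul_right h _)
  rw [← lintegral_const_mul _ (by fun_prop)]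
  refine lintegral_congr fun s₂ => ?_
  rw [← lintegral_const_mul _ (by fun_prop)]
  refine lintegral_congr fun s₃ => ?_
  rw [← lintegral_const_mul _ (by fun_prop)]
  refine lintegral_congr fun s₁ => ?_
  rw [phaseDensity, ofReal_phaseWeight]
  ring

theorem lintegral_phaseDensity_kernel_le (hp : ENNReal.HolderConjugate p p')
    (hq : ENNReal.HolderConjugate q q') (hpq₁ : ENNReal.HolderConjugate p₁ q₁) (hpt : p ≠ ∞)
    (hpt' : p' ≠ ∞) (hpt₁ : p₁ ≠ ∞)
    (h₁ : Measurable U₁) (h₂ : Measurable U₂) (h₃ : Measurable U₃) {κ : ℝ → ℝ≥0∞}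
    (hκ : Measurable κ) (ν : ℝ) :
    ∫⁻ s, ∫⁻ w, phaseDensity U₁ U₂ U₃ (s, ν) w * κ (w.2.2.1 - w.2.1.1) ≤
      (eLpNorm timeGauss q₁ volume * (∫⁻ x, timeGauss x) * (∫⁻ x, κ x) * ∫⁻ x, freqGauss x) *
        (mixedNorm p₁ 1 U₁ * mixedNorm p q U₂ * mixedNorm p' q' U₃) := by
  have hm := measurable_phaseDensity h₁ h₂ h₃
  rw [lintegral_lintegral_swap (by fun_prop), lintegral_phase_space_eq (by fun_prop)]
  refine le_trans ?_ (lintegral_freq_mixed_le hq (ENNReal.HolderConjugate.ne_zero p p') hpt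
    (ENNReal.HolderConjugate.ne_zero p' p) hpt' (ENNReal.HolderConjugate.ne_zero p₁ q₁) hpt₁
    h₁ h₂ h₃ _ ν)
  refine lintegral_mono fun ν₂ => lintegral_mono fun ν₃ => lintegral_mono fun ν₁ => ?_
  have h := lintegral_time_kernel_le hp hpq₁ (F₁ := fun s => U₁ (s, ν₁))
    (F₂ := fun s => U₂ (s, ν₂)) (F₃ := fun s => U₃ (s, ν₃)) (by fun_prop) (by fun_prop)
    (by fun_prop) hκ
  refine le_trans (le_of_eq ?_) (mul_le_mul_right h _)
  rw [← lintegral_const_mul _ (by fun_prop)]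
  refine lintegral_congr fun s₂ => ?_
  rw [← lintegral_const_mul _ (by fun_prop)]
  refine lintegral_congr fun s₃ => ?_
  rw [← lintegral_const_mul _ (by fun_prop)]
  refine lintegral_congr fun s₁ => ?_
  rw [← lintegral_const_mul _ (by fun_prop)]
  refine lintegral_congr fun s => ?_
  rw [phaseDensity, ofReal_phaseWeight]
  ring

/-- The decay of the Hilbert kernel away from its singularity. -/
def hilbertDecay (τ : ℝ) : ℝ≥0∞ := ENNReal.ofReal (1 + |τ|)⁻¹

@[fun_prop]
theorem measurable_hilbertDecay : Measurable hilbertDecay := by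
  unfold hilbertDecay; fun_prop

theorem hilbertDecay_le_one (τ : ℝ) : hilbertDecay τ ≤ 1 := by
  unfold hilbertDecay
  rw [ENNReal.ofReal_le_one]
  exact inv_le_one_of_one_le₀ (by linarith [abs_nonneg τ])

theorem lintegral_hilbertDecay_rpow_lt_top {r : ℝ} (hr : 1 < r) :
    ∫⁻ τ, hilbertDecay τ ^ r < ∞ := by
  have h := integrable_one_add_norm (E := ℝ) (μ := volume) (r := r) (by simpa using hr)
  refine lt_of_eq_of_lt (lintegral_congr fun τ => ?_) h.lintegral_lt_top
  unfold hilbertDecay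
  rw [ENNReal.ofReal_rpow_of_nonneg (by positivity) (by linarith), Real.norm_eq_abs,
    Real.inv_rpow (by positivity), Real.rpow_neg (by positivity)]

theorem exists_bound_phaseDensity {p₀ : ℝ≥0∞} (hp₀ : 1 < p₀) (hpt₀ : p₀ ≠ ∞) (hp₁ : 1 ≤ p₁)
    (hpt₁ : p₁ ≠ ∞) : ∃ C : ℝ≥0, ∀ p p' q q' : ℝ≥0∞, ENNReal.HolderConjugate p p' →
      ENNReal.HolderConjugate q q' → p ≠ ∞ → p' ≠ ∞ → ∀ U₁ U₂ U₃ : ℝ × ℝ → ℝ≥0∞,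
      Measurable U₁ → Measurable U₂ → Measurable U₃ →
      (∀ z, ∫⁻ w, phaseDensity U₁ U₂ U₃ z w ≤
        C * (mixedNorm p₁ 1 U₁ * mixedNorm p q U₂ * mixedNorm p' q' U₃)) ∧
      ∀ ν, eLpNorm (fun s => ∫⁻ w, phaseDensity U₁ U₂ U₃ (s, ν) w *
          hilbertDecay (w.2.2.1 - w.2.1.1)) p₀ volume ≤
        C * (mixedNorm p₁ 1 U₁ * mixedNorm p q U₂ * mixedNorm p' q' U₃) := by
  set q₁ := ENNReal.conjExponent p₁
  have hpq₁ : ENNReal.HolderConjugate p₁ q₁ := ENNReal.HolderConjugate.conjExponent hp₁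
  have hp₀0 : p₀ ≠ 0 := (zero_lt_one.trans hp₀).ne'
  have hr : 1 < p₀.toReal := by
    have := (ENNReal.toReal_lt_toReal ENNReal.one_ne_top hpt₀).mpr hp₀
    simpa using this
  set r := p₀.toReal
  have hr0 : 0 < r := by linarith
  set A := eLpNorm timeGauss q₁ volume * (∫⁻ x, timeGauss x) * ∫⁻ x, freqGauss x with hA
  set B := eLpNorm timeGauss q₁ volume * (∫⁻ x, timeGauss x) * (∫⁻ x, hilbertDecay x ^ r) *
    ∫⁻ x, freqGauss x with hB
  have hAt : A < ∞ := ENNReal.mul_lt_top (ENNReal.mul_lt_top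
    (eLpNorm_timeGauss_lt_top (ENNReal.HolderConjugate.one_le q₁ p₁)) lintegral_timeGauss_lt_top)
    lintegral_freqGauss_lt_top
  have hBt : B < ∞ := ENNReal.mul_lt_top (ENNReal.mul_lt_top (ENNReal.mul_lt_top
    (eLpNorm_timeGauss_lt_top (ENNReal.HolderConjugate.one_le q₁ p₁)) lintegral_timeGauss_lt_top)
    (lintegral_hilbertDecay_rpow_lt_top hr)) lintegral_freqGauss_lt_top
  set C := A + B with hC
  have hCt : C ≠ ∞ := (ENNReal.add_lt_top.mpr ⟨hAt, hBt⟩).ne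
  refine ⟨C.toNNReal, fun p p' q q' hp hq hpt hpt' U₁ U₂ U₃ h₁ h₂ h₃ => ?_⟩
  rw [ENNReal.coe_toNNReal hCt]
  set N := mixedNorm p₁ 1 U₁ * mixedNorm p q U₂ * mixedNorm p' q' U₃
  have hm := measurable_phaseDensity h₁ h₂ h₃
  have ha : ∀ z, ∫⁻ w, phaseDensity U₁ U₂ U₃ z w ≤ C * N := fun z =>
    (lintegral_phaseDensity_le hp hq hpq₁ hpt hpt' hpt₁ h₁ h₂ h₃ z).trans
      (mul_le_mul_left le_self_add N)
  refine ⟨ha, fun ν => ?_⟩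
  rw [eLpNorm_eq_lintegral_rpow_enorm_toReal hp₀0 hpt₀]
  simp only [enorm_eq_self]
  have hb : ∫⁻ s, ∫⁻ w, phaseDensity U₁ U₂ U₃ (s, ν) w *
      hilbertDecay (w.2.2.1 - w.2.1.1) ^ r ≤ C * N :=
    (lintegral_phaseDensity_kernel_le hp hq hpq₁ hpt hpt' hpt₁ h₁ h₂ h₃
      (κ := fun τ => hilbertDecay τ ^ r) (by fun_prop) ν).trans
      (mul_le_mul_left le_add_self N)
  have hc : ∫⁻ s, (∫⁻ w, phaseDensity U₁ U₂ U₃ (s, ν) w *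
      hilbertDecay (w.2.2.1 - w.2.1.1)) ^ r ≤ (C * N) ^ r := by
    calc _ ≤ ∫⁻ s, (C * N) ^ (r - 1) * ∫⁻ w, phaseDensity U₁ U₂ U₃ (s, ν) w *
          hilbertDecay (w.2.2.1 - w.2.1.1) ^ r := by
          refine lintegral_mono fun s => ?_
          refine (lintegral_mul_rpow_le hr (by fun_prop) (by fun_prop)).trans ?_
          gcongr
          exact ha (s, ν)
      _ = (C * N) ^ (r - 1) * ∫⁻ s, ∫⁻ w, phaseDensity U₁ U₂ U₃ (s, ν) w *
          hilbertDecay (w.2.2.1 - w.2.1.1) ^ r := lintegral_const_mul _ (by fun_prop)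
      _ ≤ (C * N) ^ (r - 1) * (C * N) ^ (1 : ℝ) := by
          rw [ENNReal.rpow_one]; gcongr
      _ = _ := by
          rw [← ENNReal.rpow_add_of_nonneg _ _ (by linarith) zero_le_one]
          congr 1; ring
  calc _ ≤ ((C * N) ^ r) ^ (1 / r) := by gcongr
    _ = _ := by rw [← ENNReal.rpow_mul, mul_one_div_cancel hr0.ne', ENNReal.rpow_one]

end

/-! ### The symmetrized integrand of the trilinear Hilbert transform -/

/-- The integrand of `TH`, symmetrized in `t`. -/
def symmIntegrand (f g h : ℝ → ℂ) (x t : ℝ) : ℂ :=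
  (f (x - t) * (g (x + t) * h (x + 2 * t)) - f (x + t) * (g (x - t) * h (x - 2 * t))) / t

theorem norm_symmIntegrand_le {f g h : ℝ → ℂ} {M₁ M₂ M₃ L₁ L₂ L₃ : ℝ}
    (hf : ∀ y, ‖f y‖ ≤ M₁) (hg : ∀ y, ‖g y‖ ≤ M₂) (hh : ∀ y, ‖h y‖ ≤ M₃)
    (hf' : ∀ y y', ‖f y - f y'‖ ≤ L₁ * |y - y'|) (hg' : ∀ y y', ‖g y - g y'‖ ≤ L₂ * |y - y'|)
    (hh' : ∀ y y', ‖h y - h y'‖ ≤ L₃ * |y - y'|) (x t : ℝ) :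
    ‖symmIntegrand f g h x t‖ ≤ 2 * L₁ * M₂ * M₃ + 2 * M₁ * L₂ * M₃ + 4 * M₁ * M₂ * L₃ := by
  have hM₁ : 0 ≤ M₁ := (norm_nonneg _).trans (hf 0)
  have hM₂ : 0 ≤ M₂ := (norm_nonneg _).trans (hg 0)
  have hM₃ : 0 ≤ M₃ := (norm_nonneg _).trans (hh 0)
  have hL₁ : 0 ≤ L₁ := by simpa using (norm_nonneg _).trans (hf' 1 0)
  have hL₂ : 0 ≤ L₂ := by simpa using (norm_nonneg _).trans (hg' 1 0)
  have hL₃ : 0 ≤ L₃ := by simpa using (norm_nonneg _).trans (hh' 1 0)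
  rcases eq_or_ne t 0 with rfl | ht
  · simp only [symmIntegrand, Complex.ofReal_zero, div_zero, norm_zero]
    positivity
  have ht' : 0 < |t| := abs_pos.mpr ht
  rw [symmIntegrand, norm_div, Complex.norm_real, Real.norm_eq_abs, div_le_iff₀ ht']
  have e : f (x - t) * (g (x + t) * h (x + 2 * t)) - f (x + t) * (g (x - t) * h (x - 2 * t)) =
      (f (x - t) - f (x + t)) * (g (x + t) * h (x + 2 * t)) +
      f (x + t) * ((g (x + t) - g (x - t)) * h (x + 2 * t)) +
      f (x + t) * (g (x - t) * (h (x + 2 * t) - h (x - 2 * t))) := by ring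
  have d1 : ‖f (x - t) - f (x + t)‖ ≤ L₁ * (2 * |t|) := by
    refine (hf' _ _).trans (le_of_eq ?_)
    have : x - t - (x + t) = -2 * t := by ring
    rw [this, abs_mul]; norm_num
  have d2 : ‖g (x + t) - g (x - t)‖ ≤ L₂ * (2 * |t|) := by
    refine (hg' _ _).trans (le_of_eq ?_)
    have : x + t - (x - t) = 2 * t := by ring
    rw [this, abs_mul]; norm_num
  have d3 : ‖h (x + 2 * t) - h (x - 2 * t)‖ ≤ L₃ * (4 * |t|) := by
    refine (hh' _ _).trans (le_of_eq ?_)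
    have : x + 2 * t - (x - 2 * t) = 4 * t := by ring
    rw [this, abs_mul]; norm_num
  rw [e]
  refine (norm_add₃_le).trans ?_
  simp only [norm_mul]
  calc _ ≤ (L₁ * (2 * |t|)) * (M₂ * M₃) + M₁ * ((L₂ * (2 * |t|)) * M₃) +
        M₁ * (M₂ * (L₃ * (4 * |t|))) := by
        gcongr
        · exact hg _
        · exact hh _
        · exact hf _
        · exact hh _
        · exact hf _
        · exact hg _
    _ = _ := by ring

theorem norm_symmIntegrand_le_of_one_le {f g h : ℝ → ℂ} {M₂ M₃ : ℝ}
    (hg : ∀ y, ‖g y‖ ≤ M₂) (hh : ∀ y, ‖h y‖ ≤ M₃) (x : ℝ) {t : ℝ} (ht : 1 ≤ t) :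
    ‖symmIntegrand f g h x t‖ ≤ M₂ * M₃ * (‖f (x - t)‖ + ‖f (x + t)‖) := by
  have hM₂ : 0 ≤ M₂ := (norm_nonneg _).trans (hg 0)
  have hM₃ : 0 ≤ M₃ := (norm_nonneg _).trans (hh 0)
  rw [symmIntegrand, norm_div, Complex.norm_real, Real.norm_eq_abs, abs_of_nonneg (by linarith),
    div_le_iff₀ (by linarith)]
  refine (norm_sub_le _ _).trans ?_
  simp only [norm_mul]
  calc _ ≤ ‖f (x - t)‖ * (M₂ * M₃) + ‖f (x + t)‖ * (M₂ * M₃) := by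
        gcongr
        · exact hg _
        · exact hh _
        · exact hg _
        · exact hh _
    _ = M₂ * M₃ * (‖f (x - t)‖ + ‖f (x + t)‖) * 1 := by ring
    _ ≤ _ := by gcongr

theorem norm_sub_le_of_norm_deriv_le {f : ℝ → ℂ} (hf : Differentiable ℝ f) {L : ℝ}
    (hL : ∀ y, ‖deriv f y‖ ≤ L) (y y' : ℝ) : ‖f y - f y'‖ ≤ L * |y - y'| := by
  have := convex_univ.norm_image_sub_le_of_norm_deriv_le (𝕜 := ℝ) (f := f) (C := L)
    (fun z _ => hf z) (fun z _ => hL z) (Set.mem_univ y') (Set.mem_univ y)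
  simpa using this

/-! ### Existence of the principal value for Schwartz functions -/

theorem exists_norm_le (f : 𝓢(ℝ, ℂ)) : ∃ M, ∀ y, ‖f y‖ ≤ M := by
  obtain ⟨C, _, hC⟩ := f.decay 0 0
  exact ⟨C, fun y => by simpa using hC y⟩

theorem exists_lipschitz (f : 𝓢(ℝ, ℂ)) : ∃ L, ∀ y y', ‖f y - f y'‖ ≤ L * |y - y'| := by
  obtain ⟨L, hL⟩ := exists_norm_le (SchwartzMap.derivCLM ℂ ℂ f)
  exact ⟨L, norm_sub_le_of_norm_deriv_le f.differentiable fun y => by simpa using hL y⟩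

theorem continuousOn_symmIntegrand {f g h : ℝ → ℂ} (hf : Continuous f) (hg : Continuous g)
    (hh : Continuous h) (x : ℝ) : ContinuousOn (symmIntegrand f g h x) (Set.Ioi 0) := by
  unfold symmIntegrand
  refine ContinuousOn.div (by fun_prop) (by fun_prop) fun t ht => ?_
  exact_mod_cast (ne_of_gt ht)

theorem integrableOn_symmIntegrand (f g h : 𝓢(ℝ, ℂ)) (x : ℝ) :
    IntegrableOn (symmIntegrand f g h x) (Set.Ioi 0) := by
  obtain ⟨M₁, hM₁⟩ := exists_norm_le f
  obtain ⟨M₂, hM₂⟩ := exists_norm_le g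
  obtain ⟨M₃, hM₃⟩ := exists_norm_le h
  obtain ⟨L₁, hL₁⟩ := exists_lipschitz f
  obtain ⟨L₂, hL₂⟩ := exists_lipschitz g
  obtain ⟨L₃, hL₃⟩ := exists_lipschitz h
  have hc := continuousOn_symmIntegrand f.continuous g.continuous h.continuous x
  have hu : Set.Ioi (0 : ℝ) = Set.Ioc 0 1 ∪ Set.Ioi 1 := by simp
  rw [hu] at hc ⊢
  refine IntegrableOn.union ?_ ?_
  · refine (integrable_const (2 * L₁ * M₂ * M₃ + 2 * M₁ * L₂ * M₃ + 4 * M₁ * M₂ * L₃)).mono'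
      ((hc.mono Set.subset_union_left).aestronglyMeasurable measurableSet_Ioc) ?_
    exact Eventually.of_forall fun t => norm_symmIntegrand_le hM₁ hM₂ hM₃ hL₁ hL₂ hL₃ x t
  · have hi : Integrable fun t => M₂ * M₃ * (‖f (x - t)‖ + ‖f (x + t)‖) :=
      ((f.integrable.norm.comp_sub_left x).add (f.integrable.norm.comp_add_left x)).const_mul _
    refine hi.integrableOn.mono'
      ((hc.mono Set.subset_union_right).aestronglyMeasurable measurableSet_Ioi) ?_
    refine (ae_restrict_iff' measurableSet_Ioi).mpr (Eventually.of_forall fun t ht => ?_)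
    exact norm_symmIntegrand_le_of_one_le hM₂ hM₃ x (le_of_lt ht)

theorem truncatedTH_eq (f g h : 𝓢(ℝ, ℂ)) (x : ℝ) {ε : ℝ} (hε : 0 < ε) :
    truncatedTH f g h x ε = ∫ t in Set.Ioi ε, symmIntegrand f g h x t := by
  obtain ⟨M₂, hM₂⟩ := exists_norm_le g
  obtain ⟨M₃, hM₃⟩ := exists_norm_le h
  have hM₂0 : 0 ≤ M₂ := (norm_nonneg _).trans (hM₂ 0)
  have hM₃0 : 0 ≤ M₃ := (norm_nonneg _).trans (hM₃ 0)
  set F : ℝ → ℂ := fun t => f (x - t) * g (x + t) * h (x + 2 * t) / (t : ℂ) with hF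
  have hset : {t : ℝ | ε < |t|} = Set.Ioi ε ∪ Set.Iio (-ε) := by
    ext t
    simp only [Set.mem_ofPred_eq, lt_abs, Set.mem_union, Set.mem_Ioi, Set.mem_Iio]
    constructor <;> rintro (h | h) <;> first | exact Or.inl h | (right; linarith)
  have hmeas : MeasurableSet {t : ℝ | ε < |t|} := by
    rw [hset]; exact measurableSet_Ioi.union measurableSet_Iio
  have hint : IntegrableOn F {t : ℝ | ε < |t|} := by
    have hi : Integrable fun t => ‖f (x - t)‖ * (M₂ * M₃ / ε) :=
      (f.integrable.norm.comp_sub_left x).mul_const _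
    refine hi.integrableOn.mono' ?_ ?_
    · have : ContinuousOn F {t : ℝ | ε < |t|} := by
        have := f.continuous
        have := g.continuous
        have := h.continuous
        refine ContinuousOn.div (by fun_prop) (by fun_prop) fun t ht => ?_
        simp only [Set.mem_ofPred_eq] at ht
        have : t ≠ 0 := abs_pos.mp (hε.trans ht)
        exact_mod_cast this
      exact this.aestronglyMeasurable hmeas
    · refine (ae_restrict_iff' hmeas).mpr (Eventually.of_forall fun t ht => ?_)
      simp only [Set.mem_ofPred_eq] at ht
      simp only [hF, norm_div, norm_mul, Complex.norm_real, Real.norm_eq_abs]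
      calc _ ≤ ‖f (x - t)‖ * M₂ * M₃ / ε := by
            gcongr
            · exact hM₂ _
            · exact hM₃ _
        _ = _ := by ring
  have hint1 : IntegrableOn F (Set.Ioi ε) := hint.mono_set (by rw [hset]; exact Set.subset_union_left)
  have hint2 : IntegrableOn F (Set.Iio (-ε)) :=
    hint.mono_set (by rw [hset]; exact Set.subset_union_right)
  have hdisj : Disjoint (Set.Ioi ε) (Set.Iio (-ε)) := by
    rw [Set.disjoint_left]
    intro t ht ht'
    simp only [Set.mem_Ioi, Set.mem_Iio] at ht ht'
    linarith
  have hint3 : IntegrableOn (fun t => F (-t)) (Set.Ioi ε) := by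
    have := ((Measure.measurePreserving_neg (volume : Measure ℝ)).integrableOn_comp_preimage
      (MeasurableEquiv.neg ℝ).measurableEmbedding).mpr hint2
    simpa [Function.comp_def] using this
  rw [truncatedTH, hset, setIntegral_union hdisj measurableSet_Iio hint1 hint2,
    ← integral_Iic_eq_integral_Iio, ← integral_comp_neg_Ioi, ← integral_add hint1 hint3]
  refine setIntegral_congr_fun measurableSet_Ioi fun t ht => ?_
  simp only [hF, symmIntegrand]
  have e1 : x - -t = x + t := by ring
  have e2 : x + -t = x - t := by ring
  have e3 : x + 2 * -t = x - 2 * t := by ring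
  rw [e1, e2, e3]
  push_cast
  rw [div_neg]
  ring

theorem tendsto_truncatedTH (f g h : 𝓢(ℝ, ℂ)) (x : ℝ) :
    Tendsto (truncatedTH f g h x) (𝓝[>] (0 : ℝ))
      (𝓝 (∫ t in Set.Ioi (0 : ℝ), symmIntegrand f g h x t)) := by
  have hi := integrableOn_symmIntegrand f g h x
  have h1 : Tendsto (fun ε : ℝ => ∫ t in Set.Ioi (0 : ℝ),
      (Set.Ioi ε).indicator (symmIntegrand f g h x) t) (𝓝[>] (0 : ℝ))
      (𝓝 (∫ t in Set.Ioi (0 : ℝ), symmIntegrand f g h x t)) := by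
    refine tendsto_integral_filter_of_dominated_convergence (fun t => ‖symmIntegrand f g h x t‖)
      (Eventually.of_forall fun ε => hi.1.indicator measurableSet_Ioi)
      (Eventually.of_forall fun ε => Eventually.of_forall fun t => norm_indicator_le_norm_self _ _)
      hi.norm ?_
    refine (ae_restrict_iff' measurableSet_Ioi).mpr (Eventually.of_forall fun t ht => ?_)
    refine tendsto_const_nhds.congr' ?_
    have : ∀ᶠ ε in 𝓝[>] (0 : ℝ), ε < t := nhdsWithin_le_nhds (Iio_mem_nhds ht)
    filter_upwards [this] with ε hε
    rw [Set.indicator_of_mem (show t ∈ Set.Ioi ε from hε)]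
  refine h1.congr' ?_
  filter_upwards [self_mem_nhdsWithin] with ε hε
  rw [truncatedTH_eq f g h x hε, setIntegral_indicator measurableSet_Ioi]
  congr 2
  exact Set.inter_eq_self_of_subset_right (Set.Ioi_subset_Ioi (le_of_lt hε))

theorem trilinearHilbert_eq (f g h : 𝓢(ℝ, ℂ)) (x : ℝ) :
    trilinearHilbert f g h x = ∫ t in Set.Ioi (0 : ℝ), symmIntegrand f g h x t :=
  (tendsto_truncatedTH f g h x).limUnder_eq

/-! ### The symmetrized integrand at four atoms -/

/-- The symmetrized integrand of the quadrilinear form of `TH` at four atoms. -/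
def quadDiff (z : (ℝ × ℝ) × (ℝ × ℝ) × (ℝ × ℝ) × (ℝ × ℝ)) (x t : ℝ) : ℂ :=
  phaseAtom z.1 x *
    symmIntegrand (phaseAtom z.2.1) (phaseAtom z.2.2.1) (phaseAtom z.2.2.2) x t

theorem quadDiff_eq (z : (ℝ × ℝ) × (ℝ × ℝ) × (ℝ × ℝ) × (ℝ × ℝ)) (x t : ℝ) :
    quadDiff z x t = (quadAtom z x t - quadAtom z x (-t)) / t := by
  simp only [quadDiff, symmIntegrand, quadAtom, sub_neg_eq_add, mul_neg, ← sub_eq_add_neg]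
  ring

theorem measurable_quadDiff :
    Measurable fun p : ((ℝ × ℝ) × (ℝ × ℝ) × (ℝ × ℝ) × (ℝ × ℝ)) × ℝ × ℝ =>
      quadDiff p.1 p.2.1 p.2.2 := by
  have h := continuous_phaseAtom
  have hn : Measurable fun p : ((ℝ × ℝ) × (ℝ × ℝ) × (ℝ × ℝ) × (ℝ × ℝ)) × ℝ × ℝ =>
      quadAtom p.1 p.2.1 p.2.2 - quadAtom p.1 p.2.1 (-p.2.2) := by
    refine Continuous.measurable ?_
    unfold quadAtom phaseAtom gaussAtomFun
    fun_prop
  simp_rw [quadDiff_eq]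
  exact hn.div (by fun_prop)

theorem measurable_quadDiff_section (z : (ℝ × ℝ) × (ℝ × ℝ) × (ℝ × ℝ) × (ℝ × ℝ)) :
    Measurable fun p : ℝ × ℝ => quadDiff z p.1 p.2 := by
  have hn : Measurable fun p : ℝ × ℝ => quadAtom z p.1 p.2 - quadAtom z p.1 (-p.2) := by
    refine Continuous.measurable ?_
    unfold quadAtom phaseAtom gaussAtomFun
    fun_prop
  simp_rw [quadDiff_eq]
  exact hn.div (by fun_prop)

theorem enorm_phaseAtom (z : ℝ × ℝ) (x : ℝ) : ‖phaseAtom z x‖ₑ = freqGauss (x - z.1) := by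
  rw [← ofReal_norm, norm_phaseAtom, freqGauss]

theorem phaseAtom_lipschitz (z : ℝ × ℝ) (y y' : ℝ) :
    ‖phaseAtom z y - phaseAtom z y'‖ ≤ 7 * (1 + |z.2|) * |y - y'| := by
  refine norm_sub_le_of_norm_deriv_le
    (fun x => (hasDerivAt_gaussAtomFun z.1 (-z.2) x).differentiableAt) (fun x => ?_) y y'
  have : deriv (gaussAtomFun z.1 (-z.2)) x = _ := (hasDerivAt_gaussAtomFun z.1 (-z.2) x).deriv
  rw [this, norm_mul, norm_gaussAtomFun]
  set u := x - z.1 with hu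
  have h1 : ‖-(2 * Real.pi * ((-z.2 : ℝ) : ℂ) * Complex.I) - 2 * ((x : ℂ) - z.1)‖ ≤
      2 * Real.pi * |z.2| + 2 * |u| := by
    refine (norm_sub_le _ _).trans (le_of_eq ?_)
    rw [← Complex.ofReal_sub, norm_neg]
    rw [norm_mul, norm_mul, norm_mul, norm_mul, Complex.norm_real, Complex.norm_real,
      Complex.norm_real, Complex.norm_I]
    simp [abs_of_pos Real.pi_pos, hu]
  have h2 : Real.exp (-u ^ 2) ≤ 1 := Real.exp_le_one_iff.mpr (by nlinarith [sq_nonneg u])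
  have h3 : 2 * |u| * Real.exp (-u ^ 2) ≤ 1 := by
    have h4 : 2 * |u| ≤ Real.exp (u ^ 2) := by
      have := Real.add_one_le_exp (u ^ 2)
      rw [← sq_abs] at this ⊢
      nlinarith [sq_nonneg (|u| - 1)]
    calc _ ≤ Real.exp (u ^ 2) * Real.exp (-u ^ 2) := by gcongr
      _ = 1 := by rw [← Real.exp_add]; simp
  have hpi : 2 * Real.pi ≤ 7 := by linarith [Real.pi_lt_d2]
  calc _ ≤ (2 * Real.pi * |z.2| + 2 * |u|) * Real.exp (-u ^ 2) := by gcongr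
    _ = 2 * Real.pi * |z.2| * Real.exp (-u ^ 2) + 2 * |u| * Real.exp (-u ^ 2) := by ring
    _ ≤ 7 * |z.2| * 1 + 1 := by gcongr
    _ ≤ _ := by linarith [abs_nonneg z.2]

theorem enorm_quadDiff_le (z : (ℝ × ℝ) × (ℝ × ℝ) × (ℝ × ℝ) × (ℝ × ℝ)) (x : ℝ) {t : ℝ}
    (ht : 0 < t) : ‖quadDiff z x t‖ₑ ≤ freqGauss (x - z.1.1) *
      (((Set.Ioc (0 : ℝ) 1).indicator (fun _ => 56 * ENNReal.ofReal
        ((1 + |z.2.1.2|) * ((1 + |z.2.2.1.2|) * (1 + |z.2.2.2.2|)))) t) +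
      (freqGauss ((x - z.2.1.1) - t) + freqGauss ((x - z.2.1.1) + t))) := by
  rw [quadDiff, enorm_mul, enorm_phaseAtom]
  gcongr
  rcases le_or_gt t 1 with h1 | h1
  · rw [Set.indicator_of_mem (show t ∈ Set.Ioc (0 : ℝ) 1 from ⟨ht, h1⟩)]
    refine le_add_right ?_
    have h56 : (56 : ℝ≥0∞) = ENNReal.ofReal 56 := by simp
    rw [← ofReal_norm, h56, ← ENNReal.ofReal_mul (by norm_num)]
    apply ENNReal.ofReal_le_ofReal
    refine (norm_symmIntegrand_le (norm_phaseAtom_le_one _) (norm_phaseAtom_le_one _)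
      (norm_phaseAtom_le_one _) (phaseAtom_lipschitz _) (phaseAtom_lipschitz _)
      (phaseAtom_lipschitz _) x t).trans ?_
    have a1 := abs_nonneg z.2.1.2
    have a2 := abs_nonneg z.2.2.1.2
    have a3 := abs_nonneg z.2.2.2.2
    nlinarith [mul_nonneg a1 a2, mul_nonneg a1 a3, mul_nonneg a2 a3,
      mul_nonneg a1 (mul_nonneg a2 a3)]
  · refine le_add_left ?_
    have h := norm_symmIntegrand_le_of_one_le (f := phaseAtom z.2.1)
      (norm_phaseAtom_le_one z.2.2.1) (norm_phaseAtom_le_one z.2.2.2) x h1.le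
    have e1 : x - z.2.1.1 - t = x - t - z.2.1.1 := by ring
    have e2 : x - z.2.1.1 + t = x + t - z.2.1.1 := by ring
    rw [e1, e2, ← enorm_phaseAtom, ← enorm_phaseAtom, ← ofReal_norm, ← ofReal_norm,
      ← ofReal_norm, ← ENNReal.ofReal_add (norm_nonneg _) (norm_nonneg _)]
    apply ENNReal.ofReal_le_ofReal
    simpa using h

theorem exists_lintegral_quadDiff_le : ∃ C : ℝ≥0∞, C ≠ ∞ ∧
    ∀ z : (ℝ × ℝ) × (ℝ × ℝ) × (ℝ × ℝ) × (ℝ × ℝ),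
      ∫⁻ x : ℝ, ∫⁻ t in Set.Ioi (0 : ℝ), ‖quadDiff z x t‖ₑ ≤ C * ENNReal.ofReal
        ((1 + |z.2.1.2|) * ((1 + |z.2.2.1.2|) * (1 + |z.2.2.2.2|))) := by
  set I := ∫⁻ x, freqGauss x with hI
  have hIt : I < ∞ := lintegral_freqGauss_lt_top
  refine ⟨I * (56 + (I + I)), (ENNReal.mul_lt_top hIt (ENNReal.add_lt_top.mpr
    ⟨ENNReal.ofNat_lt_top, ENNReal.add_lt_top.mpr ⟨hIt, hIt⟩⟩)).ne, fun z => ?_⟩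
  set P := ENNReal.ofReal ((1 + |z.2.1.2|) * ((1 + |z.2.2.1.2|) * (1 + |z.2.2.2.2|))) with hP
  have hP1 : 1 ≤ P := by
    rw [hP, ← ENNReal.ofReal_one]
    apply ENNReal.ofReal_le_ofReal
    have a1 := abs_nonneg z.2.1.2
    have a2 := abs_nonneg z.2.2.1.2
    have a3 := abs_nonneg z.2.2.2.2
    nlinarith [mul_nonneg a1 a2, mul_nonneg a1 a3, mul_nonneg a2 a3,
      mul_nonneg a1 (mul_nonneg a2 a3)]
  have h1 : ∀ x : ℝ, ∫⁻ t in Set.Ioi (0 : ℝ), ‖quadDiff z x t‖ₑ ≤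
      freqGauss (x - z.1.1) * (56 * P + (I + I)) := by
    intro x
    have hi : Measurable ((Set.Ioc (0 : ℝ) 1).indicator fun _ => 56 * P) :=
      measurable_const.indicator measurableSet_Ioc
    calc _ ≤ ∫⁻ t in Set.Ioi (0 : ℝ), freqGauss (x - z.1.1) *
          (((Set.Ioc (0 : ℝ) 1).indicator (fun _ => 56 * P) t) +
          (freqGauss ((x - z.2.1.1) - t) + freqGauss ((x - z.2.1.1) + t))) :=
          setLIntegral_mono' measurableSet_Ioi fun t ht => enorm_quadDiff_le z x ht
      _ ≤ ∫⁻ t, freqGauss (x - z.1.1) *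
          (((Set.Ioc (0 : ℝ) 1).indicator (fun _ => 56 * P) t) +
          (freqGauss ((x - z.2.1.1) - t) + freqGauss ((x - z.2.1.1) + t))) :=
          setLIntegral_le_lintegral _ _
      _ = _ := by
          rw [lintegral_const_mul _ (by fun_prop), lintegral_add_left hi,
            lintegral_add_left (by fun_prop), lintegral_sub_left_eq_self freqGauss,
            lintegral_add_left_eq_self freqGauss, lintegral_indicator_const measurableSet_Ioc]
          simp [hI]
  calc _ ≤ ∫⁻ x : ℝ, freqGauss (x - z.1.1) * (56 * P + (I + I)) := lintegral_mono h1
    _ = I * (56 * P + (I + I)) := by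
        rw [lintegral_mul_const _ (by fun_prop), lintegral_sub_right_eq_self freqGauss]
    _ ≤ I * (56 * P + (I + I) * P) := by
        gcongr
        exact le_mul_of_one_le_right' hP1
    _ = _ := by ring

theorem integrable_quadAtom (z : (ℝ × ℝ) × (ℝ × ℝ) × (ℝ × ℝ) × (ℝ × ℝ)) (t : ℝ) :
    Integrable fun x => quadAtom z x t := by
  have := integrable_cexp_quadratic (b := 4) (by norm_num) (quadAlpha z - 4 * t)
    (2 * Real.pi * t * (-z.2.1.2 + z.2.2.1.2 + 2 * z.2.2.2.2 : ℝ) * Complex.I -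
        (z.1.1 ^ 2 + (z.2.1.1 + t) ^ 2 + (z.2.2.1.1 - t) ^ 2 + (z.2.2.2.1 - 2 * t) ^ 2 : ℝ))
  exact this.congr (Eventually.of_forall fun x => (quadAtom_eq z x t).symm)

theorem integrable_quadDiff (z : (ℝ × ℝ) × (ℝ × ℝ) × (ℝ × ℝ) × (ℝ × ℝ)) :
    Integrable (fun p : ℝ × ℝ => quadDiff z p.1 p.2)
      ((volume : Measure ℝ).prod (volume.restrict (Set.Ioi (0 : ℝ)))) := by
  obtain ⟨C, hC, h⟩ := exists_lintegral_quadDiff_le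
  have hm := measurable_quadDiff_section z
  refine ⟨hm.aestronglyMeasurable, ?_⟩
  rw [HasFiniteIntegral, lintegral_prod _ hm.enorm.aemeasurable]
  exact lt_of_le_of_lt (h z) (ENNReal.mul_lt_top hC.lt_top ENNReal.ofReal_lt_top)

theorem integral_quadDiff (z : (ℝ × ℝ) × (ℝ × ℝ) × (ℝ × ℝ) × (ℝ × ℝ)) :
    ∫ p : ℝ × ℝ, quadDiff z p.1 p.2 ∂((volume : Measure ℝ).prod
      (volume.restrict (Set.Ioi (0 : ℝ)))) = thKernel z := by
  rw [integral_prod_symm _ (integrable_quadDiff z), thKernel, ← integral_gaussian_odd,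
    ← integral_const_mul]
  refine integral_congr_ae (Eventually.of_forall fun t => ?_)
  simp only [quadDiff_eq]
  rw [integral_div, integral_sub (integrable_quadAtom z t) (integrable_quadAtom z (-t)),
    integral_quadAtom, integral_quadAtom]
  push_cast
  rw [neg_sq, mul_neg]
  ring

/-! ### The quadrilinear form of `TH` on Schwartz functions -/

/-- The tensor product of four short-time Fourier transforms. -/
def stftProd (ψ f g h : 𝓢'(ℝ, ℂ)) (z : (ℝ × ℝ) × (ℝ × ℝ) × (ℝ × ℝ) × (ℝ × ℝ)) : ℂ :=
  stft ψ z.1.1 z.1.2 * (stft f z.2.1.1 z.2.1.2 *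
    (stft g z.2.2.1.1 z.2.2.1.2 * stft h z.2.2.2.1 z.2.2.2.2))

theorem continuous_stftProd (ψ f g h : 𝓢'(ℝ, ℂ)) : Continuous (stftProd ψ f g h) := by
  have h1 := continuous_stft ψ
  have h2 := continuous_stft f
  have h3 := continuous_stft g
  have h4 := continuous_stft h
  unfold stftProd
  exact (h1.comp continuous_fst).mul ((h2.comp (continuous_fst.comp continuous_snd)).mul
    ((h3.comp (continuous_fst.comp (continuous_snd.comp continuous_snd))).mul
      (h4.comp (continuous_snd.comp (continuous_snd.comp continuous_snd)))))

theorem integrable_stftProd_mul_quadAtom (ψ f g h : 𝓢(ℝ, ℂ)) (x t : ℝ) :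
    Integrable fun z => stftProd (ψ : 𝓢'(ℝ, ℂ)) (f : 𝓢'(ℝ, ℂ)) (g : 𝓢'(ℝ, ℂ)) (h : 𝓢'(ℝ, ℂ)) z *
      quadAtom z x t := by
  have := (integrable_stft_mul_phaseAtom ψ x).mul_prod
    ((integrable_stft_mul_phaseAtom f (x - t)).mul_prod
    ((integrable_stft_mul_phaseAtom g (x + t)).mul_prod
    (integrable_stft_mul_phaseAtom h (x + 2 * t))))
  refine this.congr (Eventually.of_forall fun z => ?_)
  simp only [stftProd, quadAtom]
  ring

theorem integral_prod_mul_four {α : Type*} [MeasureSpace α] [SFinite (volume : Measure α)]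
    (F₀ F₁ F₂ F₃ : α → ℂ) :
    ∫ z : α × α × α × α, F₀ z.1 * (F₁ z.2.1 * (F₂ z.2.2.1 * F₃ z.2.2.2)) =
      (∫ a, F₀ a) * ((∫ a, F₁ a) * ((∫ a, F₂ a) * ∫ a, F₃ a)) := by
  rw [← integral_prod_mul F₂ F₃, ← integral_prod_mul F₁, ← integral_prod_mul F₀]
  rfl

theorem integral_stftProd_mul_quadAtom (ψ f g h : 𝓢(ℝ, ℂ)) (x t : ℝ) :
    ∫ z, stftProd (ψ : 𝓢'(ℝ, ℂ)) (f : 𝓢'(ℝ, ℂ)) (g : 𝓢'(ℝ, ℂ)) (h : 𝓢'(ℝ, ℂ)) z *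
      quadAtom z x t = (Real.sqrt (Real.pi / 2) : ℂ) ^ 4 *
        (ψ x * (f (x - t) * (g (x + t) * h (x + 2 * t)))) := by
  have e := integral_prod_mul_four (fun z : ℝ × ℝ => stft (ψ : 𝓢'(ℝ, ℂ)) z.1 z.2 * phaseAtom z x)
    (fun z : ℝ × ℝ => stft (f : 𝓢'(ℝ, ℂ)) z.1 z.2 * phaseAtom z (x - t))
    (fun z : ℝ × ℝ => stft (g : 𝓢'(ℝ, ℂ)) z.1 z.2 * phaseAtom z (x + t))
    (fun z : ℝ × ℝ => stft (h : 𝓢'(ℝ, ℂ)) z.1 z.2 * phaseAtom z (x + 2 * t))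
  rw [integral_stft_mul_phaseAtom, integral_stft_mul_phaseAtom, integral_stft_mul_phaseAtom,
    integral_stft_mul_phaseAtom] at e
  refine Eq.trans (integral_congr_ae (Eventually.of_forall fun z => ?_)) (e.trans ?_)
  · simp only [stftProd, quadAtom]
    ring
  · ring

theorem integral_stftProd_mul_quadDiff (ψ f g h : 𝓢(ℝ, ℂ)) (x t : ℝ) :
    ∫ z, stftProd (ψ : 𝓢'(ℝ, ℂ)) (f : 𝓢'(ℝ, ℂ)) (g : 𝓢'(ℝ, ℂ)) (h : 𝓢'(ℝ, ℂ)) z *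
      quadDiff z x t = (Real.sqrt (Real.pi / 2) : ℂ) ^ 4 *
        (ψ x * symmIntegrand f g h x t) := by
  simp_rw [quadDiff_eq, mul_div_assoc', mul_sub]
  rw [integral_div, integral_sub (integrable_stftProd_mul_quadAtom ψ f g h x t)
    (integrable_stftProd_mul_quadAtom ψ f g h x (-t)), integral_stftProd_mul_quadAtom,
    integral_stftProd_mul_quadAtom, symmIntegrand]
  simp only [sub_neg_eq_add, mul_neg, ← sub_eq_add_neg]
  ring

theorem integrable_stftProd_mul_quadDiff (ψ f g h : 𝓢(ℝ, ℂ)) :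
    Integrable (fun p : ((ℝ × ℝ) × (ℝ × ℝ) × (ℝ × ℝ) × (ℝ × ℝ)) × ℝ × ℝ =>
      stftProd (ψ : 𝓢'(ℝ, ℂ)) (f : 𝓢'(ℝ, ℂ)) (g : 𝓢'(ℝ, ℂ)) (h : 𝓢'(ℝ, ℂ)) p.1 *
        quadDiff p.1 p.2.1 p.2.2)
      ((volume : Measure ((ℝ × ℝ) × (ℝ × ℝ) × (ℝ × ℝ) × (ℝ × ℝ))).prod
        ((volume : Measure ℝ).prod (volume.restrict (Set.Ioi (0 : ℝ))))) := by
  obtain ⟨C, hC, hb⟩ := exists_lintegral_quadDiff_le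
  set A := stftProd (ψ : 𝓢'(ℝ, ℂ)) (f : 𝓢'(ℝ, ℂ)) (g : 𝓢'(ℝ, ℂ)) (h : 𝓢'(ℝ, ℂ)) with hA
  have hAm : Measurable A := (continuous_stftProd _ _ _ _).measurable
  have hQ := measurable_quadDiff
  have hm : Measurable fun p : ((ℝ × ℝ) × (ℝ × ℝ) × (ℝ × ℝ) × (ℝ × ℝ)) × ℝ × ℝ =>
      A p.1 * quadDiff p.1 p.2.1 p.2.2 := (hAm.comp measurable_fst).mul hQ
  refine ⟨hm.aestronglyMeasurable, ?_⟩
  rw [HasFiniteIntegral, lintegral_prod _ hm.enorm.aemeasurable]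
  have hi := ((integrable_stft ψ).norm).mul_prod ((integrable_one_add_mul_norm_stft f).mul_prod
    ((integrable_one_add_mul_norm_stft g).mul_prod (integrable_one_add_mul_norm_stft h)))
  have hlt := ENNReal.mul_lt_top hC.lt_top hi.lintegral_lt_top
  refine lt_of_le_of_lt ?_ hlt
  rw [← lintegral_const_mul' _ _ hC]
  refine lintegral_mono fun z => ?_
  have hz := measurable_quadDiff_section z
  simp only [enorm_mul]
  rw [lintegral_const_mul _ hz.enorm, lintegral_prod _ hz.enorm.aemeasurable]
  refine (mul_le_mul_right (hb z) _).trans (le_of_eq ?_)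
  rw [← ofReal_norm, mul_left_comm, ← ENNReal.ofReal_mul (norm_nonneg _)]
  congr 2
  simp only [hA, stftProd, norm_mul]
  ring

theorem integrable_mul_symmIntegrand (ψ f g h : 𝓢(ℝ, ℂ)) :
    Integrable (fun p : ℝ × ℝ => ψ p.1 * symmIntegrand f g h p.1 p.2)
      ((volume : Measure ℝ).prod (volume.restrict (Set.Ioi (0 : ℝ)))) := by
  have h1 := (integrable_stftProd_mul_quadDiff ψ f g h).integral_prod_right
  simp only [integral_stftProd_mul_quadDiff] at h1
  have hc : (Real.sqrt (Real.pi / 2) : ℂ) ^ 4 ≠ 0 := by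
    apply pow_ne_zero
    exact_mod_cast (Real.sqrt_pos.mpr (by positivity)).ne'
  exact (integrable_const_mul_iff (isUnit_iff_ne_zero.mpr hc) _).mp h1

theorem integrable_mul_trilinearHilbert (ψ f g h : 𝓢(ℝ, ℂ)) :
    Integrable fun x : ℝ => ψ x * trilinearHilbert f g h x := by
  have h1 := (integrable_mul_symmIntegrand ψ f g h).integral_prod_left
  simpa only [integral_const_mul, ← trilinearHilbert_eq] using h1

theorem integral_stftProd_mul_thKernel (ψ f g h : 𝓢(ℝ, ℂ)) :
    ∫ z, stftProd (ψ : 𝓢'(ℝ, ℂ)) (f : 𝓢'(ℝ, ℂ)) (g : 𝓢'(ℝ, ℂ)) (h : 𝓢'(ℝ, ℂ)) z * thKernel z =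
      (Real.sqrt (Real.pi / 2) : ℂ) ^ 4 * ∫ x : ℝ, ψ x * trilinearHilbert f g h x := by
  have hi := integrable_stftProd_mul_quadDiff ψ f g h
  calc _ = ∫ z, ∫ p : ℝ × ℝ,
        stftProd (ψ : 𝓢'(ℝ, ℂ)) (f : 𝓢'(ℝ, ℂ)) (g : 𝓢'(ℝ, ℂ)) (h : 𝓢'(ℝ, ℂ)) z *
        quadDiff z p.1 p.2 ∂((volume : Measure ℝ).prod (volume.restrict (Set.Ioi (0 : ℝ)))) := by
        refine integral_congr_ae (Eventually.of_forall fun z => ?_)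
        simp only [integral_const_mul, integral_quadDiff]
    _ = ∫ p : ℝ × ℝ, (Real.sqrt (Real.pi / 2) : ℂ) ^ 4 * (ψ p.1 * symmIntegrand f g h p.1 p.2)
        ∂((volume : Measure ℝ).prod (volume.restrict (Set.Ioi (0 : ℝ)))) := by
        rw [integral_integral_swap hi]
        simp only [integral_stftProd_mul_quadDiff]
    _ = _ := by
        rw [integral_const_mul, integral_prod _ (integrable_mul_symmIntegrand ψ f g h)]
        simp only [integral_const_mul, ← trilinearHilbert_eq]

/-! ### The extension of the trilinear Hilbert transform -/

/-- `L` is the distribution obtained by expanding `u`, `v`, `w` and the test function in atoms. -/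
def IsAtomicTH (u v w L : 𝓢'(ℝ, ℂ)) : Prop :=
  ∀ ψ : 𝓢(ℝ, ℂ), Integrable (fun z => stftProd (ψ : 𝓢'(ℝ, ℂ)) u v w z * thKernel z) ∧
    L ψ = ((Real.sqrt (Real.pi / 2) : ℂ) ^ 4)⁻¹ *
      ∫ z, stftProd (ψ : 𝓢'(ℝ, ℂ)) u v w z * thKernel z

open Classical in
/-- The extension of the trilinear Hilbert transform. -/
def atomicTH (u v w : 𝓢'(ℝ, ℂ)) : 𝓢'(ℝ, ℂ) :=
  if h : ∃ L, IsAtomicTH u v w L then h.choose else 0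

theorem IsAtomicTH.unique {u v w L L' : 𝓢'(ℝ, ℂ)} (h : IsAtomicTH u v w L)
    (h' : IsAtomicTH u v w L') : L = L' := by
  ext ψ
  rw [(h ψ).2, (h' ψ).2]

theorem IsAtomicTH.atomicTH_eq {u v w L : 𝓢'(ℝ, ℂ)} (h : IsAtomicTH u v w L) :
    atomicTH u v w = L := by
  have he : ∃ L, IsAtomicTH u v w L := ⟨L, h⟩
  rw [atomicTH, dif_pos he]
  exact he.choose_spec.unique h

theorem stft_linear (a b : ℂ) (u u' : 𝓢'(ℝ, ℂ)) (s ν : ℝ) :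
    stft (a • u + b • u') s ν = a * stft u s ν + b * stft u' s ν := rfl

theorem isAtomicTH_of_linear {u v w L u' v' w' L' u'' v'' w'' : 𝓢'(ℝ, ℂ)} {a b : ℂ}
    (h : IsAtomicTH u v w L) (h' : IsAtomicTH u' v' w' L')
    (e : ∀ (ψ : 𝓢'(ℝ, ℂ)) z, stftProd ψ u'' v'' w'' z =
      a * stftProd ψ u v w z + b * stftProd ψ u' v' w' z) :
    IsAtomicTH u'' v'' w'' (a • L + b • L') := by
  intro ψ
  have e2 : ∀ z, stftProd (ψ : 𝓢'(ℝ, ℂ)) u'' v'' w'' z * thKernel z =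
      a * (stftProd (ψ : 𝓢'(ℝ, ℂ)) u v w z * thKernel z) +
      b * (stftProd (ψ : 𝓢'(ℝ, ℂ)) u' v' w' z * thKernel z) := fun z => by
    rw [e]; ring
  have i1 := (h ψ).1.const_mul a
  have i2 := (h' ψ).1.const_mul b
  simp only [e2]
  refine ⟨i1.add i2, ?_⟩
  have e3 : (a • L + b • L') ψ = a * L ψ + b * L' ψ := rfl
  rw [integral_add i1 i2, integral_const_mul, integral_const_mul, e3, (h ψ).2, (h' ψ).2]
  ring

theorem isTrilinearOn_atomicTH {M₁ M₂ M₃ : Set 𝓢'(ℝ, ℂ)}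
    (hM : ∀ u ∈ M₁, ∀ v ∈ M₂, ∀ w ∈ M₃, ∃ L, IsAtomicTH u v w L) :
    IsTrilinearOn M₁ M₂ M₃ atomicTH where
  map_left a b u hu u' hu' v hv w hw := by
    obtain ⟨L, hL⟩ := hM u hu v hv w hw
    obtain ⟨L', hL'⟩ := hM u' hu' v hv w hw
    rw [hL.atomicTH_eq, hL'.atomicTH_eq]
    refine (isAtomicTH_of_linear hL hL' fun ψ z => ?_).atomicTH_eq
    simp only [stftProd, stft_linear]
    ring
  map_middle a b u hu v hv v' hv' w hw := by
    obtain ⟨L, hL⟩ := hM u hu v hv w hw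
    obtain ⟨L', hL'⟩ := hM u hu v' hv' w hw
    rw [hL.atomicTH_eq, hL'.atomicTH_eq]
    refine (isAtomicTH_of_linear hL hL' fun ψ z => ?_).atomicTH_eq
    simp only [stftProd, stft_linear]
    ring
  map_right a b u hu v hv w hw w' hw' := by
    obtain ⟨L, hL⟩ := hM u hu v hv w hw
    obtain ⟨L', hL'⟩ := hM u hu v hv w' hw'
    rw [hL.atomicTH_eq, hL'.atomicTH_eq]
    refine (isAtomicTH_of_linear hL hL' fun ψ z => ?_).atomicTH_eq
    simp only [stftProd, stft_linear]
    ring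

theorem IsAtomicTH.isTrilinearHilbert {f g h : 𝓢(ℝ, ℂ)} {L : 𝓢'(ℝ, ℂ)}
    (hL : IsAtomicTH (f : 𝓢'(ℝ, ℂ)) (g : 𝓢'(ℝ, ℂ)) (h : 𝓢'(ℝ, ℂ)) L) :
    IsTrilinearHilbert f g h L := by
  refine ⟨fun x => ?_, fun ψ => ⟨integrable_mul_trilinearHilbert ψ f g h, ?_⟩⟩
  · rw [trilinearHilbert_eq]
    exact tendsto_truncatedTH f g h x
  · have hc : (Real.sqrt (Real.pi / 2) : ℂ) ^ 4 ≠ 0 := by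
      apply pow_ne_zero
      exact_mod_cast (Real.sqrt_pos.mpr (by positivity)).ne'
    rw [(hL ψ).2, integral_stftProd_mul_thKernel, inv_mul_cancel_left₀ hc]

/-! ### Existence and boundedness -/

/-- The modulus of the short-time Fourier transform, as a function on phase space. -/
def stftAbs (u : 𝓢'(ℝ, ℂ)) (z : ℝ × ℝ) : ℝ≥0∞ := ‖stft u z.1 z.2‖ₑ

theorem measurable_stftAbs (u : 𝓢'(ℝ, ℂ)) : Measurable (stftAbs u) :=
  (continuous_stft u).measurable.enorm

theorem phaseWeight_nonneg (z : ℝ × ℝ) (w : (ℝ × ℝ) × (ℝ × ℝ) × (ℝ × ℝ)) :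
    0 ≤ phaseWeight z w := by
  unfold phaseWeight; positivity

theorem enorm_stftProd_mul_thKernel_le {ψ u v w : 𝓢'(ℝ, ℂ)} {z z' : ℝ × ℝ}
    {x : (ℝ × ℝ) × (ℝ × ℝ) × (ℝ × ℝ)} {A : ℝ} (hA : 0 ≤ A)
    (h : ‖stft ψ z.1 z.2‖ * ‖thKernel (z, x)‖ ≤
      A * (phaseWeight z' x / (1 + |x.2.2.1 - x.2.1.1|))) :
    ‖stftProd ψ u v w (z, x) * thKernel (z, x)‖ₑ ≤ ENNReal.ofReal A *
      (phaseDensity (stftAbs u) (stftAbs v) (stftAbs w) z' x *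
        hilbertDecay (x.2.2.1 - x.2.1.1)) := by
  have h1 : ‖stft ψ z.1 z.2‖ₑ * ‖thKernel (z, x)‖ₑ ≤
      ENNReal.ofReal A * (ENNReal.ofReal (phaseWeight z' x) *
        hilbertDecay (x.2.2.1 - x.2.1.1)) := by
    rw [hilbertDecay, ← ENNReal.ofReal_mul (phaseWeight_nonneg _ _), ← ENNReal.ofReal_mul hA,
      ← enorm_mul, ← ofReal_norm, norm_mul]
    exact ENNReal.ofReal_le_ofReal (by simpa only [div_eq_mul_inv] using h)
  simp only [stftProd, enorm_mul, phaseDensity, stftAbs]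
  calc _ = (‖stft ψ z.1 z.2‖ₑ * ‖thKernel (z, x)‖ₑ) * (‖stft u x.1.1 x.1.2‖ₑ *
        ‖stft v x.2.1.1 x.2.1.2‖ₑ * ‖stft w x.2.2.1 x.2.2.2‖ₑ) := by ring
    _ ≤ (ENNReal.ofReal A * (ENNReal.ofReal (phaseWeight z' x) *
        hilbertDecay (x.2.2.1 - x.2.1.1))) * (‖stft u x.1.1 x.1.2‖ₑ *
        ‖stft v x.2.1.1 x.2.1.2‖ₑ * ‖stft w x.2.2.1 x.2.2.2‖ₑ) := by gcongr
    _ = _ := by ring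

theorem measurable_stftProd_mul_thKernel (ψ u v w : 𝓢'(ℝ, ℂ)) :
    Measurable fun z => stftProd ψ u v w z * thKernel z :=
  ((continuous_stftProd ψ u v w).mul continuous_thKernel).measurable

theorem exists_lintegral_enorm_form_le : ∃ A : ℝ≥0∞, A ≠ ∞ ∧ ∀ (u v w : 𝓢'(ℝ, ℂ)) (D : ℝ≥0∞),
    (∀ z, ∫⁻ x, phaseDensity (stftAbs u) (stftAbs v) (stftAbs w) z x ≤ D) → ∀ ψ : 𝓢'(ℝ, ℂ),
    ∫⁻ z, ‖stftProd ψ u v w z * thKernel z‖ₑ ≤ A * D * ∫⁻ z, stftAbs ψ z := by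
  obtain ⟨C, hC, hK⟩ := norm_thKernel_le
  refine ⟨ENNReal.ofReal C, ENNReal.ofReal_ne_top, fun u v w D hD ψ => ?_⟩
  have hm := measurable_phaseDensity (measurable_stftAbs u) (measurable_stftAbs v)
    (measurable_stftAbs w)
  rw [Measure.volume_eq_prod,
    lintegral_prod _ (measurable_stftProd_mul_thKernel ψ u v w).enorm.aemeasurable,
    ← lintegral_const_mul _ (measurable_stftAbs ψ)]
  refine lintegral_mono fun z => ?_
  calc ∫⁻ x, ‖stftProd ψ u v w (z, x) * thKernel (z, x)‖ₑ
      ≤ ∫⁻ x, ENNReal.ofReal (‖stft ψ z.1 z.2‖ * C) *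
        phaseDensity (stftAbs u) (stftAbs v) (stftAbs w) z x := by
        refine lintegral_mono fun x => ?_
        refine (enorm_stftProd_mul_thKernel_le (A := ‖stft ψ z.1 z.2‖ * C) (z' := z)
          (by positivity) ?_).trans ?_
        · rw [mul_assoc]
          gcongr
          exact hK z x
        · gcongr
          exact mul_le_of_le_one_right' (hilbertDecay_le_one _)
    _ ≤ ENNReal.ofReal (‖stft ψ z.1 z.2‖ * C) * D := by
        rw [lintegral_const_mul' _ _ ENNReal.ofReal_ne_top]
        gcongr
        exact hD z
    _ = _ := by
        rw [ENNReal.ofReal_mul (norm_nonneg _), ofReal_norm, stftAbs]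
        ring

theorem exists_isAtomicTH {u v w : 𝓢'(ℝ, ℂ)} {D : ℝ≥0∞} (hDt : D ≠ ∞)
    (hD : ∀ z, ∫⁻ x, phaseDensity (stftAbs u) (stftAbs v) (stftAbs w) z x ≤ D) :
    ∃ L, IsAtomicTH u v w L := by
  obtain ⟨A, hA, hb⟩ := exists_lintegral_enorm_form_le
  obtain ⟨q, hq, hqb⟩ := exists_seminorm_integral_norm_stft_le
  have hV : ∀ ψ : 𝓢(ℝ, ℂ), ∫⁻ z, stftAbs (ψ : 𝓢'(ℝ, ℂ)) z =
      ENNReal.ofReal (∫ z : ℝ × ℝ, ‖stft (ψ : 𝓢'(ℝ, ℂ)) z.1 z.2‖) := fun ψ => by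
    rw [ofReal_integral_norm_eq_lintegral_enorm (integrable_stft ψ)]
    rfl
  have hAD : A * D ≠ ∞ := ENNReal.mul_ne_top hA hDt
  have hint : ∀ ψ : 𝓢(ℝ, ℂ),
      Integrable (fun z => stftProd (ψ : 𝓢'(ℝ, ℂ)) u v w z * thKernel z) := fun ψ => by
    refine ⟨(measurable_stftProd_mul_thKernel _ u v w).aestronglyMeasurable, ?_⟩
    refine lt_of_le_of_lt (hb u v w D hD ψ) (ENNReal.mul_lt_top hAD.lt_top ?_)
    rw [hV]
    exact ENNReal.ofReal_lt_top
  set c : ℂ := ((Real.sqrt (Real.pi / 2) : ℂ) ^ 4)⁻¹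
  have hlin : ∀ (a b : ℂ) (ψ φ : 𝓢(ℝ, ℂ)) z,
      stftProd ((a • ψ + b • φ : 𝓢(ℝ, ℂ)) : 𝓢'(ℝ, ℂ)) u v w z * thKernel z =
      a * (stftProd (ψ : 𝓢'(ℝ, ℂ)) u v w z * thKernel z) +
      b * (stftProd (φ : 𝓢'(ℝ, ℂ)) u v w z * thKernel z) := by
    intro a b ψ φ z
    rw [map_add, map_smul, map_smul]
    simp only [stftProd, stft_linear]
    ring
  set Λ : 𝓢(ℝ, ℂ) →ₗ[ℂ] ℂ :=
    { toFun := fun ψ => c * ∫ z, stftProd (ψ : 𝓢'(ℝ, ℂ)) u v w z * thKernel z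
      map_add' := fun ψ φ => by
        have := hlin 1 1 ψ φ
        simp only [one_smul, one_mul] at this
        simp only [this]
        rw [integral_add (hint ψ) (hint φ), mul_add]
      map_smul' := fun a ψ => by
        have := hlin a 0 ψ 0
        simp only [zero_smul, add_zero, zero_mul] at this
        simp only [this]
        rw [integral_const_mul, smul_eq_mul, RingHom.id_apply, mul_left_comm] } with hΛ
  have hbound : ∀ ψ, ‖Λ ψ‖ ≤ (‖c‖ * (A * D).toReal) * q ψ := by
    intro ψ
    have h1 : ‖∫ z, stftProd (ψ : 𝓢'(ℝ, ℂ)) u v w z * thKernel z‖ ≤ (A * D).toReal * q ψ := by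
      rw [← toReal_enorm]
      have h2 := (enorm_integral_le_lintegral_enorm
        (fun z => stftProd (ψ : 𝓢'(ℝ, ℂ)) u v w z * thKernel z)).trans (hb u v w D hD ψ)
      rw [hV] at h2
      have h3 := ENNReal.toReal_mono (ENNReal.mul_ne_top hAD ENNReal.ofReal_ne_top) h2
      rw [ENNReal.toReal_mul, ENNReal.toReal_ofReal (integral_nonneg fun z => norm_nonneg _)] at h3
      exact h3.trans (by gcongr; exact hqb ψ)
    simp only [hΛ, LinearMap.coe_mk, AddHom.coe_mk, norm_mul]
    rw [mul_assoc]
    gcongr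
  have hcont : Continuous Λ := by
    have hs : Continuous ((normSeminorm ℂ ℂ).comp Λ) := by
      have hpos : 0 ≤ ‖c‖ * (A * D).toReal := by positivity
      refine Seminorm.continuous_of_le (q := NNReal.mk _ hpos • q) (hq.const_smul (NNReal.mk _ hpos))
        fun ψ => ?_
      exact hbound ψ
    refine continuous_of_continuousAt_zero Λ.toAddMonoidHom ?_
    rw [ContinuousAt]
    have h0 := hs.tendsto 0
    simp only [map_zero] at h0 ⊢
    exact tendsto_zero_iff_norm_tendsto_zero.mpr h0
  refine ⟨ContinuousLinearMap.toPointwiseConvergenceCLM _ _ _ _ ⟨Λ, hcont⟩,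
    fun ψ => ⟨hint ψ, rfl⟩⟩

theorem exists_enorm_stft_le : ∃ A : ℝ≥0∞, A ≠ ∞ ∧ ∀ u v w L : 𝓢'(ℝ, ℂ), IsAtomicTH u v w L →
    ∀ s ν, ‖stft L s ν‖ₑ ≤ A *
      ∫⁻ x, phaseDensity (stftAbs u) (stftAbs v) (stftAbs w) (s, -ν) x *
        hilbertDecay (x.2.2.1 - x.2.1.1) := by
  obtain ⟨C, hC, hK⟩ := norm_integral_mul_norm_thKernel_le
  set c : ℂ := ((Real.sqrt (Real.pi / 2) : ℂ) ^ 4)⁻¹ with hc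
  set I₁ := ∫⁻ x : ℝ, ENNReal.ofReal (Real.exp (-(1 / 4) * x ^ 2)) with hI₁
  set I₂ := ∫⁻ x : ℝ, ENNReal.ofReal (Real.exp (-2 * x ^ 2)) with hI₂
  have hI₁t : I₁ < ∞ := lintegral_ofReal_gaussian_lt_top (by norm_num)
  have hI₂t : I₂ < ∞ := lintegral_ofReal_gaussian_lt_top (by norm_num)
  refine ⟨‖c‖ₑ * (ENNReal.ofReal C * (I₁ * I₂)), ENNReal.mul_ne_top enorm_ne_top
    (ENNReal.mul_ne_top ENNReal.ofReal_ne_top (ENNReal.mul_ne_top hI₁t.ne hI₂t.ne)),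
    fun u v w L hL s ν => ?_⟩
  have hm := measurable_phaseDensity (measurable_stftAbs u) (measurable_stftAbs v)
    (measurable_stftAbs w)
  set ψ : 𝓢'(ℝ, ℂ) := (gaussAtom s ν : 𝓢'(ℝ, ℂ)) with hψ
  set Φ := ∫⁻ x, phaseDensity (stftAbs u) (stftAbs v) (stftAbs w) (s, -ν) x *
        hilbertDecay (x.2.2.1 - x.2.1.1) with hΦ
  have hG : ∫⁻ z : ℝ × ℝ, ENNReal.ofReal
      (C * (Real.exp (-(1 / 4) * (s - z.1) ^ 2) * Real.exp (-2 * (ν + z.2) ^ 2))) =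
      ENNReal.ofReal C * (I₁ * I₂) := by
    have : ∀ z : ℝ × ℝ, ENNReal.ofReal
        (C * (Real.exp (-(1 / 4) * (s - z.1) ^ 2) * Real.exp (-2 * (ν + z.2) ^ 2))) =
        ENNReal.ofReal C * (ENNReal.ofReal (Real.exp (-(1 / 4) * (s - z.1) ^ 2)) *
          ENNReal.ofReal (Real.exp (-2 * (ν + z.2) ^ 2))) := fun z => by
      rw [ENNReal.ofReal_mul hC.le, ENNReal.ofReal_mul (Real.exp_pos _).le]
    simp_rw [this]
    rw [lintegral_const_mul _ (by fun_prop), Measure.volume_eq_prod,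
      lintegral_prod_mul (f := fun x : ℝ => ENNReal.ofReal (Real.exp (-(1 / 4) * (s - x) ^ 2)))
        (g := fun y : ℝ => ENNReal.ofReal (Real.exp (-2 * (ν + y) ^ 2))) (by fun_prop)
        (by fun_prop),
      lintegral_sub_left_eq_self (fun x : ℝ => ENNReal.ofReal (Real.exp (-(1 / 4) * x ^ 2))),
      lintegral_add_left_eq_self (fun x : ℝ => ENNReal.ofReal (Real.exp (-2 * x ^ 2)))]
  have h1 : ∫⁻ z, ‖stftProd ψ u v w z * thKernel z‖ₑ ≤ ENNReal.ofReal C * (I₁ * I₂) * Φ := by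
    rw [Measure.volume_eq_prod,
      lintegral_prod _ (measurable_stftProd_mul_thKernel ψ u v w).enorm.aemeasurable, ← hG,
      ← lintegral_mul_const _ (by fun_prop)]
    refine lintegral_mono fun z => ?_
    dsimp only
    rw [hΦ, ← lintegral_const_mul' _ _ ENNReal.ofReal_ne_top]
    refine lintegral_mono fun x => ?_
    refine enorm_stftProd_mul_thKernel_le (by positivity) ?_
    have := hK s ν z x
    rw [hψ, stft_coe, mul_assoc]
    exact this
  have h2 : stft L s ν = c * ∫ z, stftProd ψ u v w z * thKernel z := (hL (gaussAtom s ν)).2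
  rw [h2, enorm_mul, mul_assoc]
  gcongr
  exact (enorm_integral_le_lintegral_enorm _).trans h1

theorem modNorm_eq_mixedNorm_stftAbs (p q : ℝ≥0∞) (u : 𝓢'(ℝ, ℂ)) :
    modNorm p q u = mixedNorm p q (stftAbs u) := by
  unfold modNorm mixedNorm stftAbs
  simp only [eLpNorm_enorm]

theorem exists_modNorm_atomicTH_le {p₀ p₁ : ℝ≥0∞} (hp₀ : 1 < p₀) (hpt₀ : p₀ ≠ ∞) (hp₁ : 1 ≤ p₁)
    (hpt₁ : p₁ ≠ ∞) : ∃ C : ℝ≥0, 0 < C ∧ ∀ p p' q q' : ℝ≥0∞, ENNReal.HolderConjugate p p' →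
      ENNReal.HolderConjugate q q' → p ≠ ∞ → p' ≠ ∞ → ∀ u ∈ modSpace p₁ 1, ∀ v ∈ modSpace p q,
      ∀ w ∈ modSpace p' q', IsAtomicTH u v w (atomicTH u v w) ∧
        modNorm p₀ ∞ (atomicTH u v w) ≤
          C * modNorm p₁ 1 u * modNorm p q v * modNorm p' q' w := by
  obtain ⟨C, hC⟩ := exists_bound_phaseDensity hp₀ hpt₀ hp₁ hpt₁
  obtain ⟨A, hA, hst⟩ := exists_enorm_stft_le
  refine ⟨A.toNNReal * C + 1, by positivity, fun p p' q q' hp hq hpt hpt' u hu v hv w hw => ?_⟩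
  obtain ⟨h1, h2⟩ := hC p p' q q' hp hq hpt hpt' (stftAbs u) (stftAbs v) (stftAbs w)
    (measurable_stftAbs u) (measurable_stftAbs v) (measurable_stftAbs w)
  simp only [← modNorm_eq_mixedNorm_stftAbs] at h1 h2
  set N := modNorm p₁ 1 u * modNorm p q v * modNorm p' q' w
  have hN : N < ∞ := ENNReal.mul_lt_top (ENNReal.mul_lt_top hu hv) hw
  obtain ⟨L, hL⟩ := exists_isAtomicTH (ENNReal.mul_ne_top ENNReal.coe_ne_top hN.ne) h1
  rw [hL.atomicTH_eq]
  refine ⟨hL, ?_⟩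
  have h3 : ∀ ν, eLpNorm (fun t => stft L t ν) p₀ volume ≤ A * (C * N) := by
    intro ν
    refine le_trans ?_ (mul_le_mul_right (h2 (-ν)) A)
    have h4 := eLpNorm_le_nnreal_smul_eLpNorm_of_ae_le_mul' (c := A.toNNReal) (p := p₀)
      (f := fun t => stft L t ν) (μ := volume)
      (g := fun s => ∫⁻ x, phaseDensity (stftAbs u) (stftAbs v) (stftAbs w) (s, -ν) x *
        hilbertDecay (x.2.2.1 - x.2.1.1)) (Eventually.of_forall fun s => by
          rw [ENNReal.coe_toNNReal hA, enorm_eq_self]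
          exact hst u v w L hL s ν)
    rw [ENNReal.smul_def, smul_eq_mul, ENNReal.coe_toNNReal hA] at h4
    exact h4
  rw [modNorm, eLpNorm_exponent_top]
  refine (essSup_le_of_ae_le (A * (C * N)) (Eventually.of_forall fun ν => ?_)).trans ?_
  · simpa using h3 ν
  · rw [mul_assoc, mul_assoc, ← mul_assoc (modNorm p₁ 1 u), ENNReal.coe_add, ENNReal.coe_mul,
      ENNReal.coe_toNNReal hA, ← mul_assoc]
    gcongr
    exact le_self_add

/-! ### Schwartz functions belong to all modulation spaces -/

theorem eLpNorm_polyDecay_lt_top {p : ℝ≥0∞} (hp : 1 ≤ p) : eLpNorm polyDecay p volume < ∞ := by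
  have h1 : MemLp polyDecay 1 volume := memLp_one_iff_integrable.mpr integrable_polyDecay
  have htop : MemLp polyDecay ∞ volume := by
    refine memLp_top_of_bound continuous_polyDecay.aestronglyMeasurable 1
      (Eventually.of_forall fun x => ?_)
    rw [Real.norm_of_nonneg (polyDecay_pos x).le]
    exact polyDecay_le_one x
  by_cases h : p = ∞
  · rw [h]; exact htop.2
  have hp0 : p ≠ 0 := (zero_lt_one.trans_le hp).ne'
  rw [eLpNorm_eq_lintegral_rpow_enorm_toReal hp0 h]
  have hr : 1 ≤ p.toReal := by simpa using ENNReal.toReal_mono h hp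
  refine ENNReal.rpow_lt_top_of_nonneg (by positivity) (ne_of_lt ?_)
  refine lt_of_le_of_lt (lintegral_mono fun x => ?_) integrable_polyDecay.2
  have hle : ‖polyDecay x‖ₑ ≤ 1 := by
    rw [Real.enorm_of_nonneg (polyDecay_pos x).le, ENNReal.ofReal_le_one]
    exact polyDecay_le_one x
  calc ‖polyDecay x‖ₑ ^ p.toReal ≤ ‖polyDecay x‖ₑ ^ (1 : ℝ) :=
        ENNReal.rpow_le_rpow_of_exponent_ge hle hr
    _ = _ := ENNReal.rpow_one _

theorem schwartz_mem_modSpace (f : 𝓢(ℝ, ℂ)) {p q : ℝ≥0∞} (hp : 1 ≤ p) (hq : 1 ≤ q) :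
    (f : 𝓢'(ℝ, ℂ)) ∈ modSpace p q := by
  obtain ⟨σ, _, hσ⟩ := exists_seminorm_stft_le_polyDecay
  have hP := eLpNorm_polyDecay_lt_top hp
  set N := eLpNorm polyDecay p volume with hN
  have h1 : ∀ ν, eLpNorm (fun t => stft (f : 𝓢'(ℝ, ℂ)) t ν) p volume ≤
      (ENNReal.ofReal (σ f) * N) * ‖polyDecay ν‖ₑ := by
    intro ν
    have h2 : eLpNorm (fun t => stft (f : 𝓢'(ℝ, ℂ)) t ν) p volume ≤
        eLpNorm ((σ f * polyDecay ν) • polyDecay) p volume := by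
      refine eLpNorm_mono fun t => ?_
      rw [Pi.smul_apply, smul_eq_mul, Real.norm_of_nonneg (mul_nonneg (mul_nonneg
        (apply_nonneg σ f) (polyDecay_pos _).le) (polyDecay_pos _).le)]
      refine (norm_stft_le_of_decay hσ f t ν).trans (le_of_eq ?_)
      ring
    refine h2.trans (le_of_eq ?_)
    rw [eLpNorm_const_smul, enorm_mul, Real.enorm_of_nonneg (apply_nonneg σ f)]
    ring
  have hc : ENNReal.ofReal (σ f) * N ≠ ∞ := ENNReal.mul_ne_top ENNReal.ofReal_ne_top hP.ne
  have h3 : modNorm p q (f : 𝓢'(ℝ, ℂ)) ≤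
      (ENNReal.ofReal (σ f) * N).toNNReal • eLpNorm polyDecay q volume := by
    refine eLpNorm_le_nnreal_smul_eLpNorm_of_ae_le_mul' (Eventually.of_forall fun ν => ?_) q
    rw [ENNReal.coe_toNNReal hc, enorm_eq_self]
    exact h1 ν
  refine lt_of_le_of_lt h3 ?_
  rw [ENNReal.smul_def, smul_eq_mul]
  exact ENNReal.mul_lt_top ENNReal.coe_lt_top (eLpNorm_polyDecay_lt_top hq)

/-! ### The embedding of `L²` into `M^{2,2}` -/

/-- The squared `L²` norm of the short-time Fourier transform. -/
def stftEnergy (u : 𝓢'(ℝ, ℂ)) : ℝ≥0∞ := ∫⁻ z : ℝ × ℝ, ‖stft u z.1 z.2‖ₑ ^ 2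

theorem modNorm_two_two (u : 𝓢'(ℝ, ℂ)) : modNorm 2 2 u = stftEnergy u ^ (1 / 2 : ℝ) := by
  have hm : Measurable fun z : ℝ × ℝ => ‖stft u z.1 z.2‖ₑ ^ 2 :=
    (continuous_stft u).measurable.enorm.pow_const 2
  unfold modNorm stftEnergy
  rw [eLpNorm_eq_lintegral_rpow_enorm_toReal two_ne_zero ENNReal.ofNat_ne_top, ENNReal.toReal_ofNat]
  congr 1
  rw [Measure.volume_eq_prod, lintegral_prod_symm _ hm.aemeasurable]
  refine lintegral_congr fun ν => ?_
  rw [eLpNorm_eq_lintegral_rpow_enorm_toReal two_ne_zero ENNReal.ofNat_ne_top,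
    ENNReal.toReal_ofNat, enorm_eq_self, ← ENNReal.rpow_mul]
  norm_num

theorem lintegral_enorm_sq_eq_eLpNorm_sq (f : ℝ → ℂ) :
    ∫⁻ x, ‖f x‖ₑ ^ 2 = eLpNorm f 2 volume ^ 2 := by
  have h := eLpNorm_nnreal_pow_eq_lintegral (p := 2) (f := f) (μ := volume) two_ne_zero
  simpa using h.symm

theorem lintegral_enorm_fourier_sq (f : 𝓢(ℝ, ℂ)) :
    ∫⁻ ν, ‖FourierTransform.fourier f ν‖ₑ ^ 2 = ∫⁻ x, ‖f x‖ₑ ^ 2 := by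
  rw [lintegral_enorm_sq_eq_eLpNorm_sq, lintegral_enorm_sq_eq_eLpNorm_sq]
  have h : ‖(FourierTransform.fourier f).toLp 2 volume‖ = ‖f.toLp 2 volume‖ :=
    f.norm_fourier_toL2_eq
  rw [SchwartzMap.norm_toLp, SchwartzMap.norm_toLp, ENNReal.toReal_eq_toReal_iff'
    ((FourierTransform.fourier f).memLp 2 volume).eLpNorm_ne_top
    (f.memLp 2 volume).eLpNorm_ne_top] at h
  rw [h]

theorem lintegral_enorm_stft_sq (ψ : 𝓢(ℝ, ℂ)) (s : ℝ) :
    ∫⁻ ν, ‖stft (ψ : 𝓢'(ℝ, ℂ)) s ν‖ₑ ^ 2 =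
      ∫⁻ x, ‖ψ x‖ₑ ^ 2 * ENNReal.ofReal (Real.exp (-2 * (x - s) ^ 2)) := by
  set h : 𝓢(ℝ, ℂ) := SchwartzMap.pairing (ContinuousLinearMap.mul ℂ ℂ) (gaussAtom s 0) ψ with hh
  have hx : ∀ x, h x = gaussAtomFun s 0 x * ψ x := fun x => rfl
  have hF : ∀ ν, stft (ψ : 𝓢'(ℝ, ℂ)) s ν = FourierTransform.fourier h ν := by
    intro ν
    rw [SchwartzMap.fourier_coe, Real.fourier_real_eq_integral_exp_smul, stft_coe]
    refine integral_congr_ae (Eventually.of_forall fun y => ?_)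
    simp only [hx, gaussAtomFun, smul_eq_mul]
    have : ((-2 * Real.pi * y * ν : ℝ) : ℂ) * Complex.I = -(2 * Real.pi * ν * y * Complex.I) := by
      push_cast; ring
    rw [this]
    simp
    ring
  simp_rw [hF]
  rw [lintegral_enorm_fourier_sq]
  refine lintegral_congr fun x => ?_
  rw [hx, enorm_mul, mul_pow, mul_comm, ← ofReal_norm (gaussAtomFun s 0 x), norm_gaussAtomFun,
    ← ENNReal.ofReal_pow (Real.exp_pos _).le, ← Real.exp_nat_mul]
  congr 3
  push_cast
  ring

theorem stftEnergy_coe (ψ : 𝓢(ℝ, ℂ)) : stftEnergy (ψ : 𝓢'(ℝ, ℂ)) =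
    (∫⁻ x : ℝ, ENNReal.ofReal (Real.exp (-2 * x ^ 2))) * ‖ψ.toLp 2 volume‖ₑ ^ 2 := by
  have hm : Measurable fun z : ℝ × ℝ => ‖stft (ψ : 𝓢'(ℝ, ℂ)) z.1 z.2‖ₑ ^ 2 :=
    (continuous_stft _).measurable.enorm.pow_const 2
  have hψ : Measurable ψ := ψ.continuous.measurable
  unfold stftEnergy
  rw [Measure.volume_eq_prod, lintegral_prod _ hm.aemeasurable]
  simp_rw [lintegral_enorm_stft_sq]
  rw [lintegral_lintegral_swap (by fun_prop), Lp.enorm_def,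
    eLpNorm_congr_ae (ψ.coeFn_toLp 2 volume), ← lintegral_enorm_sq_eq_eLpNorm_sq,
    ← lintegral_const_mul _ (by fun_prop)]
  refine lintegral_congr fun x => ?_
  rw [lintegral_const_mul _ (by fun_prop), mul_comm,
    lintegral_sub_left_eq_self (fun s : ℝ => ENNReal.ofReal (Real.exp (-2 * s ^ 2))) x]

theorem stftEnergy_le (v : Lp ℂ 2 (volume : Measure ℝ)) : stftEnergy (v : 𝓢'(ℝ, ℂ)) ≤
    (∫⁻ x : ℝ, ENNReal.ofReal (Real.exp (-2 * x ^ 2))) * ‖v‖ₑ ^ 2 := by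
  set I := ∫⁻ x : ℝ, ENNReal.ofReal (Real.exp (-2 * x ^ 2)) with hI
  have hI' : I ≠ ∞ := (lintegral_ofReal_gaussian_lt_top two_pos).ne
  have hd : v ∈ closure (Set.range (SchwartzMap.toLpCLM ℝ ℂ 2 (volume : Measure ℝ))) :=
    SchwartzMap.denseRange_toLpCLM ENNReal.ofNat_ne_top v
  obtain ⟨V, hV, hlim⟩ := mem_closure_iff_seq_limit.mp hd
  choose ψ hψ using hV
  have hcoe : ∀ n, (V n : 𝓢'(ℝ, ℂ)) = (ψ n : 𝓢'(ℝ, ℂ)) := fun n => by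
    rw [← hψ n, SchwartzMap.toLpCLM_apply]
    exact Lp.toTemperedDistribution_toLp_eq (ψ n)
  have hE : ∀ n, stftEnergy (V n : 𝓢'(ℝ, ℂ)) = I * ‖V n‖ₑ ^ 2 := fun n => by
    rw [hcoe, stftEnergy_coe, ← hψ n, SchwartzMap.toLpCLM_apply]
  have hpt : ∀ z : ℝ × ℝ, Tendsto (fun n => ‖stft (V n : 𝓢'(ℝ, ℂ)) z.1 z.2‖ₑ ^ 2) atTop
      (𝓝 (‖stft (v : 𝓢'(ℝ, ℂ)) z.1 z.2‖ₑ ^ 2)) := by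
    intro z
    have hc : Continuous fun y : Lp ℂ 2 (volume : Measure ℝ) =>
        stft (y : 𝓢'(ℝ, ℂ)) z.1 z.2 :=
      ((PointwiseConvergenceCLM.evalCLM (RingHom.id ℂ) ℂ (gaussAtom z.1 z.2)).continuous).comp
        (Lp.toTemperedDistributionCLM ℂ volume 2).continuous
    exact (ENNReal.continuous_pow 2).continuousAt.tendsto.comp
      ((hc.tendsto v).comp hlim).enorm
  have hlim' : Tendsto (fun n => I * ‖V n‖ₑ ^ 2) atTop (𝓝 (I * ‖v‖ₑ ^ 2)) :=
    ENNReal.Tendsto.const_mul ((ENNReal.continuous_pow 2).continuousAt.tendsto.comp hlim.enorm)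
      (Or.inr hI')
  calc stftEnergy (v : 𝓢'(ℝ, ℂ))
      = ∫⁻ z : ℝ × ℝ, liminf (fun n => ‖stft (V n : 𝓢'(ℝ, ℂ)) z.1 z.2‖ₑ ^ 2) atTop :=
        lintegral_congr fun z => (hpt z).liminf_eq.symm
    _ ≤ liminf (fun n => stftEnergy (V n : 𝓢'(ℝ, ℂ))) atTop :=
        lintegral_liminf_le fun n => (continuous_stft _).measurable.enorm.pow_const 2
    _ = I * ‖v‖ₑ ^ 2 := by
        simp_rw [hE]
        exact hlim'.liminf_eq

theorem exists_modNorm_two_two_le : ∃ K : ℝ≥0, 0 < K ∧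
    ∀ v : Lp ℂ 2 (volume : Measure ℝ), modNorm 2 2 (v : 𝓢'(ℝ, ℂ)) ≤ K * ‖v‖ₑ := by
  set I := ∫⁻ x : ℝ, ENNReal.ofReal (Real.exp (-2 * x ^ 2)) with hI
  have hI' : I ^ (1 / 2 : ℝ) ≠ ∞ :=
    ENNReal.rpow_ne_top_of_nonneg (by norm_num) (lintegral_ofReal_gaussian_lt_top two_pos).ne
  refine ⟨(I ^ (1 / 2 : ℝ)).toNNReal + 1, by positivity, fun v => ?_⟩
  rw [modNorm_two_two]
  calc stftEnergy (v : 𝓢'(ℝ, ℂ)) ^ (1 / 2 : ℝ) ≤ (I * ‖v‖ₑ ^ 2) ^ (1 / 2 : ℝ) := by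
        gcongr; exact stftEnergy_le v
    _ = I ^ (1 / 2 : ℝ) * ‖v‖ₑ := by
        rw [ENNReal.mul_rpow_of_nonneg _ _ (by norm_num), ← ENNReal.rpow_natCast,
          ← ENNReal.rpow_mul]
        norm_num
    _ ≤ _ := by
        rw [ENNReal.coe_add, ENNReal.coe_toNNReal hI']
        gcongr
        exact le_self_add

theorem IsTrilinearOn.comp_linear {E₁ E₂ E₃ F G₂ G₃ : Type*} [AddCommGroup E₁] [Module ℂ E₁]
    [AddCommGroup E₂] [Module ℂ E₂] [AddCommGroup E₃] [Module ℂ E₃] [AddCommGroup F] [Module ℂ F]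
    [AddCommGroup G₂] [Module ℂ G₂] [AddCommGroup G₃] [Module ℂ G₃]
    {M₁ : Set E₁} {M₂ : Set E₂} {M₃ : Set E₃} {T : E₁ → E₂ → E₃ → F}
    (h : IsTrilinearOn M₁ M₂ M₃ T) (A : G₂ →ₗ[ℂ] E₂) (B : G₃ →ₗ[ℂ] E₃) (hA : ∀ v, A v ∈ M₂)
    (hB : ∀ w, B w ∈ M₃) :
    IsTrilinearOn M₁ Set.univ Set.univ fun u v w => T u (A v) (B w) where
  map_left a b u hu u' hu' v _ w _ := h.map_left a b u hu u' hu' _ (hA v) _ (hB w)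
  map_middle a b u hu v _ v' _ w _ := by
    rw [map_add, map_smul, map_smul]
    exact h.map_middle a b u hu _ (hA v) _ (hA v') _ (hB w)
  map_right a b u hu v _ w _ w' _ := by
    rw [map_add, map_smul, map_smul]
    exact h.map_right a b u hu _ (hA v) _ (hB w) _ (hB w')

end ModulationSpaces

end

theorem theorem4p6 :
    (∀ p p' p₀ p₁ q q' : ℝ≥0∞, 1 < p → p < ∞ → 1 < p₀ → p₀ < ∞ → 1 < p₁ → p₁ < ∞ →
      1 ≤ q → ENNReal.HolderConjugate p p' → ENNReal.HolderConjugate q q' →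
      ∃ (C : ℝ≥0) (T : 𝓢'(ℝ, ℂ) → 𝓢'(ℝ, ℂ) → 𝓢'(ℝ, ℂ) → 𝓢'(ℝ, ℂ)),
        0 < C ∧
        ModulationSpaces.IsTrilinearOn (ModulationSpaces.modSpace p₁ 1)
          (ModulationSpaces.modSpace p q) (ModulationSpaces.modSpace p' q') T ∧
        (∀ f g h : 𝓢(ℝ, ℂ),
          (f : 𝓢'(ℝ, ℂ)) ∈ ModulationSpaces.modSpace p₁ 1 ∧
          (g : 𝓢'(ℝ, ℂ)) ∈ ModulationSpaces.modSpace p q ∧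
          (h : 𝓢'(ℝ, ℂ)) ∈ ModulationSpaces.modSpace p' q' ∧
          ModulationSpaces.IsTrilinearHilbert f g h
            (T (f : 𝓢'(ℝ, ℂ)) (g : 𝓢'(ℝ, ℂ)) (h : 𝓢'(ℝ, ℂ)))) ∧
        (∀ u ∈ ModulationSpaces.modSpace p₁ 1, ∀ v ∈ ModulationSpaces.modSpace p q,
          ∀ w ∈ ModulationSpaces.modSpace p' q',
            ModulationSpaces.modNorm p₀ ∞ (T u v w) ≤
              C * ModulationSpaces.modNorm p₁ 1 u * ModulationSpaces.modNorm p q v *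
                ModulationSpaces.modNorm p' q' w)) ∧
    (∀ (r : ℝ≥0∞) (ε : ℝ≥0), 1 ≤ r → r < ∞ → 0 < ε →
      ∃ (C : ℝ≥0) (T : 𝓢'(ℝ, ℂ) → Lp ℂ 2 (volume : Measure ℝ) → Lp ℂ 2 (volume : Measure ℝ) →
          𝓢'(ℝ, ℂ)),
        0 < C ∧
        ModulationSpaces.IsTrilinearOn (ModulationSpaces.modSpace r 1) Set.univ Set.univ T ∧
        (∀ f g h : 𝓢(ℝ, ℂ),
          (f : 𝓢'(ℝ, ℂ)) ∈ ModulationSpaces.modSpace r 1 ∧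
          ModulationSpaces.IsTrilinearHilbert f g h
            (T (f : 𝓢'(ℝ, ℂ)) (g.toLp 2 volume) (h.toLp 2 volume))) ∧
        (∀ u ∈ ModulationSpaces.modSpace r 1, ∀ v w : Lp ℂ 2 (volume : Measure ℝ),
            ModulationSpaces.modNorm (1 + ε) ∞ (T u v w) ≤
              C * ModulationSpaces.modNorm r 1 u * ‖v‖ₑ * ‖w‖ₑ)) := by
  constructor
  · intro p p' p₀ p₁ q q' hp hpt hp₀ hpt₀ hp₁ hpt₁ hq hpp hqq
    obtain ⟨C, hC0, hC⟩ := ModulationSpaces.exists_modNorm_atomicTH_le hp₀ hpt₀.ne hp₁.le hpt₁.ne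
    have hpt' : p' ≠ ∞ :=
      ((ENNReal.HolderConjugate.lt_top_iff_one_lt p' p).mpr hp).ne
    have hp1' : 1 ≤ p' := ENNReal.HolderConjugate.one_le p' p
    have hq1' : 1 ≤ q' := ENNReal.HolderConjugate.one_le q' q
    have hT := hC p p' q q' hpp hqq hpt.ne hpt'
    refine ⟨C, ModulationSpaces.atomicTH, hC0, ModulationSpaces.isTrilinearOn_atomicTH fun u hu v hv w hw =>
      ⟨_, (hT u hu v hv w hw).1⟩, fun f g h => ?_, fun u hu v hv w hw => (hT u hu v hv w hw).2⟩
    have hf := ModulationSpaces.schwartz_mem_modSpace f hp₁.le (le_refl 1)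
    have hg := ModulationSpaces.schwartz_mem_modSpace g hp.le hq
    have hh := ModulationSpaces.schwartz_mem_modSpace h hp1' hq1'
    exact ⟨hf, hg, hh, (hT _ hf _ hg _ hh).1.isTrilinearHilbert⟩
  · intro r ε hr hrt hε
    obtain ⟨C, hC0, hC⟩ := ModulationSpaces.exists_modNorm_atomicTH_le (p₀ := 1 + ε)
      (ENNReal.lt_add_right ENNReal.one_ne_top (by exact_mod_cast hε.ne'))
      (by simp) hr hrt.ne
    obtain ⟨K, hK0, hK⟩ := ModulationSpaces.exists_modNorm_two_two_le
    have hT := hC 2 2 2 2 inferInstance inferInstance ENNReal.ofNat_ne_top ENNReal.ofNat_ne_top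
    have hmem : ∀ v : Lp ℂ 2 (volume : Measure ℝ), (v : 𝓢'(ℝ, ℂ)) ∈ ModulationSpaces.modSpace 2 2 := fun v =>
      (hK v).trans_lt (ENNReal.mul_lt_top ENNReal.coe_lt_top enorm_lt_top)
    refine ⟨C * K * K, fun u v w => ModulationSpaces.atomicTH u (v : 𝓢'(ℝ, ℂ)) (w : 𝓢'(ℝ, ℂ)), by positivity,
      ?_, fun f g h => ?_, fun u hu v w => ?_⟩
    · exact (ModulationSpaces.isTrilinearOn_atomicTH fun u hu v hv w hw => ⟨_, (hT u hu v hv w hw).1⟩).comp_linear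
        (Lp.toTemperedDistributionCLM ℂ volume 2).toLinearMap
        (Lp.toTemperedDistributionCLM ℂ volume 2).toLinearMap hmem hmem
    · have hf := ModulationSpaces.schwartz_mem_modSpace f hr (le_refl 1)
      have hg := ModulationSpaces.schwartz_mem_modSpace g (one_le_two (α := ℝ≥0∞)) (one_le_two (α := ℝ≥0∞))
      have hh := ModulationSpaces.schwartz_mem_modSpace h (one_le_two (α := ℝ≥0∞)) (one_le_two (α := ℝ≥0∞))
      refine ⟨hf, ?_⟩
      dsimp only
      rw [Lp.toTemperedDistribution_toLp_eq, Lp.toTemperedDistribution_toLp_eq]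
      exact (hT _ hf _ hg _ hh).1.isTrilinearHilbert
    · refine ((hT u hu _ (hmem v) _ (hmem w)).2).trans ?_
      calc _ ≤ C * ModulationSpaces.modNorm r 1 u * (K * ‖v‖ₑ) * (K * ‖w‖ₑ) := by
            gcongr
            · exact hK v
            · exact hK w
        _ = _ := by push_cast; ring
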